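/- For a group $G$ put $\mathrm{Hol}(G)=G\rtimes\mathrm{Aut}(G)$, and let $F_n$ be the free group on $x_1,\dots,x_n$. Let $E:\mathrm{Hol}(F_n)\to\mathrm{Aut}(F_{n+1})$ be the embedding that sends $(w,\alpha)$ to the automorphism which equals $\alpha$ on $F_n$ and maps $x_{n+1}$ to $w^{-1}x_{n+1}w$. Define $\mathcal H_{(1)}=\mathrm{Hol}(F_2)$ and $\mathcal H_{(n)}=F_{n+1}\rtimes E(\mathcal H_{(n-1)})<\mathrm{Hol}(F_{n+1})$ for $n\ge 2$. A group is CAT(0) if it acts properly and cocompactly by isometries on a non-empty CAT(0) space. Let $n\ge 2$, let $\{i,j\}=\{1,2\}$, and let $\mathbb Z/2=\langle t_1\rangle$, $\mathbb Z=\langle t_2\rangle$. Let $\varphi:\mathbb Z\times\mathbb Z/2\to\mathrm{Aut}(F_n)$ be a homomorphism such that $\varphi(t_1)$ maps $x_i$ to $x_i^{-1}$ and fixes $x_l$ for all $l\ne i$. Put $G=F_n\rtimes_\varphi(\mathbb Z\times\mathbb Z/2)$. (1) If the image of the natural map $G\to\mathrm{Hol}(F_n)$, $(w,q)\mapsto(w,\varphi(q))$,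 lies in $\mathcal H_{(n-1)}$, then $G$ is a CAT(0) group. If moreover $\varphi$ is injective, then this map is injective, so that $G$ is isomorphic to its image, a subgroup $F_n\rtimes(\mathbb Z\times\mathbb Z/2)<\mathcal H_{(n-1)}$, which is therefore a CAT(0) group. (2) Suppose that for some $k,r\in\mathbb Z$ and $\varepsilon,\delta\in\{1,-1\}$ $$\varphi(t_2)(x_i)=x_j^{k}x_i^{\varepsilon}x_j^{-k},\qquad \varphi(t_2)(x_j)=x_j^{\delta},\qquad \varphi(t_2)(x_l)=x_j^{r}x_lx_j^{-r}\quad(3\le l\le n).$$ Then the image of $G$ in $\mathrm{Hol}(F_n)$ lies in $\mathcal H_{(n-1)}$ (so $G$ is CAT(0) by (1)). Put $\xi=x_j^{-r}t_2\in G$, $K_1=\langle t_1,\xi,x_3,\dots,x_n\rangle$, $K=\langle t_1,\xi\rangle$ and $K_2=\langle t_1,\xi,x_1,x_2\rangle$. Then $G=K_1*_KK_2$, with $K_1\cong F_{n-2}\times\mathbb Z\times\mathbb Z/2$, $K\cong\mathbb Z\times\mathbb Z/2$, and $K_2\cong F_2\rtimes(\mathbb Z\times\mathbb Z/2)$, where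 the generator of $\mathbb Z/2$ acts on $F_2$ by $x_1\mapsto x_1^{-1}$, $x_2\mapsto x_2$, and the generator of $\mathbb Z$ acts by $x_1\mapsto x_2^{k-r}x_1^{\varepsilon}x_2^{-(k-r)}$, $x_2\mapsto x_2^{\delta}$. -/

import Mathlib

/-! ### CAT(0) spaces and CAT(0) groups -/

/-- A metric space in which any two points are joined by a geodesic segment. -/
def IsGeodesicSpace (X : Type*) [MetricSpace X] : Prop :=
  ∀ x y : X, ∃ γ : ℝ → X, γ 0 = x ∧ γ (dist x y) = y ∧
    ∀ s ∈ Set.Icc (0 : ℝ) (dist x y), ∀ t ∈ Set.Icc (0 : ℝ) (dist x y),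
      dist (γ s) (γ t) = |s - t|

/-- `p' q' r'` is a comparison triangle in the Euclidean plane for the triangle `p q r`; the point
`x` lies on a side `[p, q]`, the point `y` on a side `[p, r]`, and `x'`, `y'` are their comparison
points. The `CAT(0)` inequality is `dist x y ≤ dist x' y'`. (In a geodesic space, `x` lies on some
geodesic from `p` to `q` exactly when `dist p x + dist x q = dist p q`. Since `p`, `q`, `r` are
arbitrary, all pairs of distinct sides are covered; for two points of the same side the
inequality is an equality.) -/
def IsCAT0Space (X : Type*) [MetricSpace X] : Prop :=
  IsGeodesicSpace X ∧
    ∀ (p q r x y : X) (p' q' r' x' y' : EuclideanSpace ℝ (Fin 2)),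
      dist p' q' = dist p q → dist q' r' = dist q r → dist p' r' = dist p r →
      dist p x + dist x q = dist p q → dist p y + dist y r = dist p r →
      dist p' x' = dist p x → dist x' q' = dist x q →
      dist p' y' = dist p y → dist y' r' = dist y r →
      dist x y ≤ dist x' y'

/-- A group is `CAT(0)` if it acts properly and cocompactly by isometries on some (non-empty)
`CAT(0)` space. -/
def IsCAT0Group (G : Type) [Group G] : Prop :=
  ∃ (X : Type) (_ : MetricSpace X) (_ : MulAction G X),
    Nonempty X ∧ IsCAT0Space X ∧
    (∀ (g : G) (x y : X), dist (g • x) (g • y) = dist x y) ∧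
    (∀ x : X, ∃ r : ℝ, 0 < r ∧
      {g : G | ((fun z : X => g • z) '' Metric.ball x r ∩ Metric.ball x r).Nonempty}.Finite) ∧
    (∃ C : Set X, IsCompact C ∧ ∀ x : X, ∃ g : G, ∃ c ∈ C, g • c = x)

/-! ### The groups `H_(n)` -/

/-- The free group of rank `n`; its basis is `gen 0, …, gen (n - 1)`. -/
abbrev FreeGp (n : ℕ) : Type := FreeGroup (Fin n)

/-- The basis element `x_{l+1}` of the free group of rank `n`. -/
def gen {n : ℕ} (l : Fin n) : FreeGp n := FreeGroup.of l

/-- The holomorph `Hol(G) = G ⋊ Aut(G)`. -/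
abbrev Hol (G : Type) [Group G] : Type := G ⋊[MonoidHom.id (MulAut G)] MulAut G

/-- The standard inclusion `F_n → F_{n+1} = F_n * ℤ`. -/
def freeIncl (n : ℕ) : FreeGp n →* FreeGp (n + 1) := FreeGroup.map Fin.castSucc

/-- The endomorphism of `F_{n+1}` attached to `(w, α) ∈ Hol(F_n)`: it is `α` on `F_n`, and it
conjugates the last basis element by `w⁻¹`. -/
def holEnd {n : ℕ} (h : Hol (FreeGp n)) : FreeGp (n + 1) →* FreeGp (n + 1) :=
  FreeGroup.lift (Fin.lastCases
    ((freeIncl n h.left)⁻¹ * gen (Fin.last n) * freeIncl n h.left)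
    (fun l : Fin n => freeIncl n (h.right (gen l))))

theorem holEnd_last {n : ℕ} (h : Hol (FreeGp n)) :
    holEnd h (gen (Fin.last n)) =
      (freeIncl n h.left)⁻¹ * gen (Fin.last n) * freeIncl n h.left := by
  simp [holEnd, gen]

theorem holEnd_incl {n : ℕ} (h : Hol (FreeGp n)) (w : FreeGp n) :
    holEnd h (freeIncl n w) = freeIncl n (h.right w) := by
  have : (holEnd h).comp (freeIncl n) = (freeIncl n).comp h.right.toMonoidHom := by
    ext l
    simp [holEnd, freeIncl, gen]
  exact DFunLike.congr_fun this w

theorem freeGp_succ_hom_ext {n : ℕ} {f g : FreeGp (n + 1) →* FreeGp (n + 1)}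
    (h1 : ∀ w : FreeGp n, f (freeIncl n w) = g (freeIncl n w))
    (h2 : f (gen (Fin.last n)) = g (gen (Fin.last n))) : f = g := by
  ext l
  refine Fin.lastCases ?_ (fun l => ?_) l
  · exact h2
  · simpa [freeIncl] using h1 (FreeGroup.of l)

theorem holEnd_mul {n : ℕ} (h k : Hol (FreeGp n)) :
    holEnd (h * k) = (holEnd h).comp (holEnd k) := by
  apply freeGp_succ_hom_ext
  · intro w
    simp [holEnd_incl]
  · simp [holEnd_incl, holEnd_last, mul_assoc]

theorem holEnd_one {n : ℕ} : holEnd (1 : Hol (FreeGp n)) = MonoidHom.id _ := by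
  apply freeGp_succ_hom_ext
  · intro w
    simp [holEnd_incl]
  · simp [holEnd_last]

/-- The embedding `E : Hol(F_n) → Aut(F_n * ℤ) = Aut(F_{n+1})`. -/
def holEmb (n : ℕ) : Hol (FreeGp n) →* MulAut (FreeGp (n + 1)) where
  toFun h := MonoidHom.toMulEquiv (holEnd h) (holEnd h⁻¹)
    (by rw [← holEnd_mul, inv_mul_cancel, holEnd_one])
    (by rw [← holEnd_mul, mul_inv_cancel, holEnd_one])
  map_one' := by
    ext x
    simp [holEnd_one]
  map_mul' h k := by
    ext x
    simp [holEnd_mul]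

/-- `holTower m` is the group `H_(m+1)`, as a subgroup of `Hol(F_{m+2})`: `H_(1) = Hol(F_2)` and
`H_(m+2) = F_{m+3} ⋊ E(H_(m+1))`. -/
def holTower : (m : ℕ) → Subgroup (Hol (FreeGp (m + 2)))
  | 0 => ⊤
  | m + 1 => ((holTower m).map (holEmb (m + 2))).comap SemidirectProduct.rightHom

/-! ### The groups `F_n ⋊ (ℤ × ℤ/2)` -/

/-- The group `ℤ × ℤ/2`, written multiplicatively. -/
abbrev ZxZ2 : Type := Multiplicative ℤ × Multiplicative (ZMod 2)

/-- The generator of `ℤ/2`. -/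
def t1 : ZxZ2 := (1, Multiplicative.ofAdd 1)

/-- The generator of `ℤ`. -/
def t2 : ZxZ2 := (Multiplicative.ofAdd 1, 1)

/-- `t₁` inverts the basis element `i` and fixes all the others. -/
def InvertsOne {n : ℕ} (φ : ZxZ2 →* MulAut (FreeGp n)) (i : Fin n) : Prop :=
  φ t1 (gen i) = (gen i)⁻¹ ∧ ∀ l, l ≠ i → φ t1 (gen l) = gen l

/-- `t₂` acts on the two basis elements `i`, `j` by
`x_i ↦ x_j ^ k * x_i ^ ε * x_j ^ (-k)`, `x_j ↦ x_j ^ δ` with `ε, δ = ±1`,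
and on each of the others by conjugation by `x_j ^ r`. -/
def ActsByType {n : ℕ} (φ : ZxZ2 →* MulAut (FreeGp n)) (i j : Fin n) (k r : ℤ) (ε δ : ℤˣ) :
    Prop :=
  φ t2 (gen i) = gen j ^ k * gen i ^ (ε : ℤ) * gen j ^ (-k) ∧
  φ t2 (gen j) = gen j ^ (δ : ℤ) ∧
  ∀ l, l ≠ i → l ≠ j → φ t2 (gen l) = gen j ^ r * gen l * gen j ^ (-r)

/-- The natural homomorphism `F_n ⋊_φ (ℤ × ℤ/2) → Hol(F_n)`, `(w, q) ↦ (w, φ q)`. -/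
def toHol {n : ℕ} (φ : ZxZ2 →* MulAut (FreeGp n)) :
    FreeGp n ⋊[φ] ZxZ2 →* Hol (FreeGp n) :=
  SemidirectProduct.map (MonoidHom.id _) φ (fun _ => rfl)

/-! ### Amalgamated products -/

/-- `G` is the amalgamated free product `K₁ *_K K₂` of its subgroups `K₁`, `K₂` along their common
subgroup `K`: the natural homomorphism from the amalgamated product to `G` is bijective. -/
def IsAmalgam {G : Type*} [Group G] (K₁ K K₂ : Subgroup G) : Prop :=
  ∃ h : ∀ b : Bool, K ≤ cond b K₁ K₂,
    Function.Bijective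
      (Monoid.PushoutI.lift (φ := fun b => Subgroup.inclusion (h b))
        (fun b => (cond b K₁ K₂).subtype) K.subtype (fun _ => rfl))

/-- The element `ξ = x_j ^ (-r) * t₂`. -/
def xi {n : ℕ} (φ : ZxZ2 →* MulAut (FreeGp n)) (j : Fin n) (r : ℤ) : FreeGp n ⋊[φ] ZxZ2 :=
  SemidirectProduct.inl (gen j ^ (-r)) * SemidirectProduct.inr t2

/-- `K = ⟨t₁, ξ⟩`. -/
def subK {n : ℕ} (φ : ZxZ2 →* MulAut (FreeGp n)) (j : Fin n) (r : ℤ) :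
    Subgroup (FreeGp n ⋊[φ] ZxZ2) :=
  Subgroup.closure {SemidirectProduct.inr t1, xi φ j r}

/-- `K₁ = ⟨t₁, ξ, x₃, …, x_n⟩`. -/
def subK1 {n : ℕ} (φ : ZxZ2 →* MulAut (FreeGp n)) (j : Fin n) (r : ℤ) :
    Subgroup (FreeGp n ⋊[φ] ZxZ2) :=
  Subgroup.closure ({SemidirectProduct.inr t1, xi φ j r} ∪
    {g | ∃ l : Fin n, 2 ≤ (l : ℕ) ∧ g = SemidirectProduct.inl (gen l)})

/-- `K₂ = ⟨t₁, ξ, x₁, x₂⟩`. -/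
def subK2 {n : ℕ} (φ : ZxZ2 →* MulAut (FreeGp n)) (j : Fin n) (r : ℤ) :
    Subgroup (FreeGp n ⋊[φ] ZxZ2) :=
  Subgroup.closure ({SemidirectProduct.inr t1, xi φ j r} ∪
    {g | ∃ l : Fin n, (l : ℕ) < 2 ∧ g = SemidirectProduct.inl (gen l)})

/-!
The `CAT(0)` property is proved by induction on the rank. Let `Q = ℤ × ℤ/2`. If the image of
`F_{n+1} ⋊ Q` in the holomorph lies in the tower, then `Q` acts on `F_{n+1}` through the embedding
`E`, by a homomorphism `η : Q → Hol(F_n)` into the preceding group of the tower. The action of `Q` on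
`F_n` that underlies `η` gives a group `P = F_n ⋊ Q`, which is `CAT(0)` by induction, and `η` itself
gives a section `σ` of `P → Q`. The definition of `E` says that the last letter of `F_{n+1}` commutes
with `σ(Q)`; hence `F_{n+1} ⋊ Q` is obtained from `P` by adding a letter that centralizes `σ(Q)`, and
it is isomorphic to `F ⋊ P` for the free group `F` on the cosets `P / σ(Q)` (`isStewartGroup_holEmb`).
If `P` acts geometrically on a `CAT(0)` space `X`, then the element of infinite order of `σ(Q)` has an
axis in the fixed point set of the involution (`ActsGeometrically.exists_axis`). Now join copies of
`X`, one for each element of `F`, by strips along the translates of this axis. The resulting tree of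
spaces (`TreeSpace`) is `CAT(0)` by Reshetnyak's gluing theorem (`CNOn.union`, `TreeSpace.CNOn_univ`),
and `F ⋊ P` acts on it geometrically (`TreeSpace.isStewartGroup`).

Throughout, the `CAT(0)` inequality is used in the form of the inequality of Stewart for the distance
of a point from the points of a segment. It makes sense in pseudometric spaces, so that the tree of
spaces need not be given as a quotient until the end.

The induction starts in rank `2`. An automorphism of `F_2` that commutes with the inversion of `x_i`
has the form `x_i ↦ x_j ^ k * x_i ^ ε * x_j ^ (-k)`, `x_j ↦ x_j ^ δ` (`exists_type_of_commute`), by a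
length argument with reduced words. After a change of the complement of `F_2`, the group `Q` permutes
the letters and their inverses, and the same tree of spaces, with `X` a line, can be used
(`isStewartGroup_two`).

For the amalgamated decomposition, `t₁` and `ξ` generate another complement of `F_n`. It fixes
`x_3, …, x_n`, and it preserves `⟨x_1, x_2⟩`. Thus it preserves both parts of a partition of the basis
of `F_n`, and the semidirect product is the amalgam, over the complement, of its semidirect products
with the two free factors (`isAmalgam_of_partition`).
-/

/-! ### The inequality of Stewart and its gluing -/

/-- The comparison inequality for the distance from `y` to a point `x` that divides a segment
from `p` to `q` in the ratio `t : 1 - t`; in a Euclidean space it is an equality (Stewart). -/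
def Stewart {X : Type*} [PseudoMetricSpace X] (p q : X) (t : ℝ) (x y : X) : Prop :=
  dist y x ^ 2 ≤ (1 - t) * dist y p ^ 2 + t * dist y q ^ 2 - t * (1 - t) * dist p q ^ 2

/-- Any two points of `U` have dividing points in `U` that satisfy the comparison inequality
with respect to all points of `U`. A metric space with this property is a `CAT(0)` space. -/
def CNOn {X : Type*} [PseudoMetricSpace X] (U : Set X) : Prop :=
  ∀ p ∈ U, ∀ q ∈ U, ∀ t ∈ Set.Icc (0 : ℝ) 1, ∃ x ∈ U, ∀ y ∈ U, Stewart p q t x y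

section Stewart

variable {X : Type*} [PseudoMetricSpace X]

theorem Stewart.symm {p q x y : X} {t : ℝ} (h : Stewart p q t x y) : Stewart q p (1 - t) x y := by
  unfold Stewart at *
  rw [dist_comm q p]
  linarith

theorem dist_eq_of_dist_eq_zero {x x' : X} (h : dist x x' = 0) (y : X) : dist y x = dist y x' := by
  have h1 := dist_triangle y x x'
  have h2 := dist_triangle y x' x
  rw [dist_comm x' x] at h2
  linarith

theorem Stewart.congr_point {p q x x' y : X} {t : ℝ} (h : Stewart p q t x y)
    (hx : dist x x' = 0) : Stewart p q t x' y := by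
  unfold Stewart at *
  rwa [← dist_eq_of_dist_eq_zero hx y]

theorem Stewart.dist_left {p q x : X} {t : ℝ} (h0 : 0 ≤ t) (h : Stewart p q t x p) :
    dist p x ≤ t * dist p q := by
  unfold Stewart at h
  rw [dist_self] at h
  apply le_of_sq_le_sq _ (by positivity)
  nlinarith

theorem Stewart.dist_right {p q x : X} {t : ℝ} (h1 : t ≤ 1) (h : Stewart p q t x q) :
    dist x q ≤ (1 - t) * dist p q := by
  have := h.symm.dist_left (by linarith)
  rwa [dist_comm, dist_comm q p] at this

/-- The comparison inequality forces a dividing point to be unique. -/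
theorem Stewart.dist_eq_zero {p q x y : X} {t : ℝ} (h0 : 0 ≤ t) (h1 : t ≤ 1)
    (h : Stewart p q t x y) (hp : dist p y ≤ t * dist p q)
    (hq : dist y q ≤ (1 - t) * dist p q) : dist x y = 0 := by
  unfold Stewart at h
  have a := pow_le_pow_left₀ dist_nonneg hp 2
  have b := pow_le_pow_left₀ dist_nonneg hq 2
  rw [dist_comm y p] at h
  have hz : dist y x ^ 2 ≤ 0 := by
    nlinarith [mul_le_mul_of_nonneg_left a (sub_nonneg.2 h1), mul_le_mul_of_nonneg_left b h0]
  rw [dist_comm]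
  nlinarith [sq_nonneg (dist y x)]

/-- A first variation argument: `m` divides a segment from `y` to `q`, and the points near `m` on
a segment from `m` to `p` satisfy the comparison inequality with respect to `y` and `q`. -/
theorem stewart_of_variation {y q m p : X} {μ : ℝ} (h0 : 0 ≤ μ) (h1 : μ ≤ 1)
    (hy : dist y m ≤ μ * dist y q) (hq : dist m q ≤ (1 - μ) * dist y q)
    (h : ∀ s ∈ Set.Icc (0 : ℝ) 1, ∃ w, Stewart m p s w y ∧ Stewart m p s w q) :
    Stewart y q μ m p := by
  rcases eq_or_lt_of_le h0 with rfl | h0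
  · have : dist y m = 0 := le_antisymm (by simpa using hy) dist_nonneg
    unfold Stewart
    rw [dist_eq_of_dist_eq_zero this]
    linarith
  rcases eq_or_lt_of_le h1 with rfl | h1
  · have : dist m q = 0 := le_antisymm (by simpa using hq) dist_nonneg
    unfold Stewart
    rw [dist_eq_of_dist_eq_zero this]
    linarith
  have key : ∀ s : ℝ, 0 < s → s ≤ 1 →
      (1 - s) * dist p m ^ 2 ≤
        (1 - μ) * dist p y ^ 2 + μ * dist p q ^ 2 - μ * (1 - μ) * dist y q ^ 2 := by
    intro s hs hs1
    obtain ⟨w, hwy, hwq⟩ := h s ⟨hs.le, hs1⟩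
    unfold Stewart at hwy hwq
    have a := pow_le_pow_left₀ dist_nonneg hy 2
    have b := pow_le_pow_left₀ dist_nonneg hq 2
    have c := pow_le_pow_left₀ dist_nonneg (dist_triangle y w q) 2
    rw [dist_comm w q] at c
    rw [dist_comm m q] at b
    rw [dist_comm y p, dist_comm m p] at hwy
    rw [dist_comm q p, dist_comm m p] at hwq
    -- the inequality of Cauchy, with weights `μ` and `1 - μ`
    have cauchy : μ * (1 - μ) * (dist y w + dist q w) ^ 2 ≤
        (1 - μ) * dist y w ^ 2 + μ * dist q w ^ 2 := by
      nlinarith [sq_nonneg ((1 - μ) * dist y w - μ * dist q w)]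
    have e1 := mul_le_mul_of_nonneg_left hwy (sub_pos.2 h1).le
    have e2 := mul_le_mul_of_nonneg_left hwq h0.le
    have e3 := mul_le_mul_of_nonneg_left c (mul_pos h0 (sub_pos.2 h1)).le
    have e4 := mul_le_mul_of_nonneg_left a (mul_nonneg (sub_nonneg.2 hs1) (sub_pos.2 h1).le)
    have e5 := mul_le_mul_of_nonneg_left b (mul_nonneg (sub_nonneg.2 hs1) h0.le)
    have : s * ((1 - s) * dist p m ^ 2) ≤ s * ((1 - μ) * dist p y ^ 2 + μ * dist p q ^ 2
        - μ * (1 - μ) * dist y q ^ 2) := by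
      nlinarith
    exact le_of_mul_le_mul_left this hs
  unfold Stewart
  by_contra hc
  push Not at hc
  set R := (1 - μ) * dist p y ^ 2 + μ * dist p q ^ 2 - μ * (1 - μ) * dist y q ^ 2 with hR
  have hL : 0 ≤ dist p m ^ 2 := sq_nonneg _
  set L := dist p m ^ 2 with hLdef
  by_cases hpos : 0 < L
  · set s := min 1 ((L - R) / (2 * L)) with hsdef
    have hs : 0 < s := lt_min one_pos (div_pos (by linarith) (by linarith))
    have k := key s hs (min_le_left _ _)
    have hs2 : s * (2 * L) ≤ L - R := by
      have : s ≤ (L - R) / (2 * L) := min_le_right _ _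
      rwa [le_div_iff₀ (by linarith)] at this
    nlinarith
  · have hL0 : L = 0 := by linarith
    have k := key 1 one_pos le_rfl
    linarith

/-- Alexandrov's lemma in metric form. The triangle `p y q` is cut by a segment from `p` to the
point `m` of its side from `y` to `q`; if the inequality holds in both parts, it holds for `y` and
the points of the side from `p` to `q`. In the comparison triangle the segment from `y` to `z`
meets the one from `p` to `m` in the point that has the parameters `ν` and `lam` on them. -/
theorem stewart_of_cut {y q m p z : X} {μ t : ℝ} (h0 : 0 ≤ μ) (h1 : μ ≤ 1)
    (ht0 : 0 ≤ t) (ht1 : t ≤ 1)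
    (hy : dist y m ≤ μ * dist y q) (hq : dist m q ≤ (1 - μ) * dist y q)
    (h : ∀ s ∈ Set.Icc (0 : ℝ) 1, ∃ w, Stewart p m s w y ∧ Stewart p m s w q ∧
      Stewart p m s w p ∧ Stewart p q t z w) :
    Stewart p q t z y := by
  have hvar : Stewart y q μ m p := by
    refine stewart_of_variation h0 h1 hy hq fun s hs => ?_
    obtain ⟨w, hw1, hw2, -, -⟩ := h (1 - s) ⟨by linarith [hs.2], by linarith [hs.1]⟩
    exact ⟨w, by simpa using hw1.symm, by simpa using hw2.symm⟩
  rcases eq_or_lt_of_le ht0 with rfl | ht0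
  · obtain ⟨w, -, -, hw, hz⟩ := h 0 ⟨le_rfl, zero_le_one⟩
    have e1 : dist p w = 0 := le_antisymm (by simpa using hw.dist_left le_rfl) dist_nonneg
    have e2 : dist w p = 0 := by rwa [dist_comm]
    unfold Stewart at hz ⊢
    rw [e2] at hz
    have e3 : dist w z = 0 := by nlinarith [sq_nonneg (dist w z)]
    rw [← dist_eq_of_dist_eq_zero e3 y, dist_eq_of_dist_eq_zero e2 y]
    linarith
  set den := μ + t - μ * t with hden
  have hdpos : 0 < den := by nlinarith
  set lam := t / den with hlam
  set ν := μ / den with hν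
  have hlam0 : 0 ≤ lam := by positivity
  have hν0 : 0 ≤ ν := by positivity
  have hlam1 : lam ≤ 1 := by rw [hlam, div_le_one hdpos]; nlinarith
  have hν1 : ν ≤ 1 := by rw [hν, div_le_one hdpos]; nlinarith
  have r1 : lam * μ = ν * t := by rw [hlam, hν]; ring
  have r2 : 1 - lam = ν * (1 - t) := by rw [hlam, hν]; field_simp; rw [hden]; ring
  have r3 : 1 - ν = lam * (1 - μ) := by rw [hlam, hν]; field_simp; rw [hden]; ring
  obtain ⟨w, hwy, hwq, hwp, hwz⟩ := h lam ⟨hlam0, hlam1⟩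
  have hwp' := hwp.dist_left hlam0
  have hpw := pow_le_pow_left₀ dist_nonneg hwp' 2
  have ey := pow_le_pow_left₀ dist_nonneg hy 2
  have eq := pow_le_pow_left₀ dist_nonneg hq 2
  unfold Stewart at hvar hwy hwq hwz ⊢
  rw [dist_comm m q] at eq
  rw [dist_comm w p, dist_comm w q] at hwz
  rw [dist_comm q p] at hwq
  rw [dist_comm p y] at hvar
  have htri := dist_triangle y w z
  have hyz0 : 0 ≤ dist y z := dist_nonneg
  have hBL : dist p m ≤ dist p q + dist q m ∧ dist p q ≤ dist p m + dist q m :=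
    ⟨dist_triangle _ _ _, by simpa [dist_comm] using dist_triangle p m q⟩
  generalize dist y z = yz at *
  generalize dist w z = b at *
  generalize dist y w = a at *
  generalize dist p w = pw at *
  generalize dist q w = qw at *
  generalize dist p m = L at *
  generalize dist y m = ym at *
  generalize dist q m = qm at *
  generalize dist y p = P at *
  generalize dist p q = B at *
  generalize dist y q = D at *
  set R := (1 - t) * P ^ 2 + t * D ^ 2 - t * (1 - t) * B ^ 2 with hR
  set κ := lam * (1 - t) * ((1 - μ) * P ^ 2 + μ * B ^ 2 - μ * (1 - μ) * D ^ 2 - L ^ 2) with hκ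
  have hκ0 : 0 ≤ κ := mul_nonneg (mul_nonneg hlam0 (by linarith)) (by linarith)
  have id1 : (1 - lam) * P ^ 2 + lam * (μ * D) ^ 2 - lam * (1 - lam) * L ^ 2
      = ν ^ 2 * R + ν * κ := by
    rw [hκ, hR, hlam, hν]; field_simp; rw [hden]; ring
  have id2 : (1 - t) * (lam * L) ^ 2 + t * ((1 - lam) * B ^ 2 + lam * ((1 - μ) * D) ^ 2
      - lam * (1 - lam) * L ^ 2) - t * (1 - t) * B ^ 2 = (1 - ν) ^ 2 * R - (1 - ν) * κ := by
    rw [hκ, hR, hlam, hν]; field_simp; rw [hden]; ring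
  have ha : a ^ 2 ≤ ν ^ 2 * R + ν * κ := by
    have := mul_le_mul_of_nonneg_left ey hlam0
    linarith
  have hb : b ^ 2 ≤ (1 - ν) ^ 2 * R - (1 - ν) * κ := by
    have e1 := mul_le_mul_of_nonneg_left hpw (sub_nonneg.2 ht1)
    have e2 := mul_le_mul_of_nonneg_left eq hlam0
    have e3 := mul_le_mul_of_nonneg_left (hwq.trans (by linarith : _ ≤ (1 - lam) * B ^ 2 +
      lam * ((1 - μ) * D) ^ 2 - lam * (1 - lam) * L ^ 2)) ht0.le
    linarith
  have hsq := pow_le_pow_left₀ hyz0 htri 2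
  refine hsq.trans ?_
  rcases eq_or_lt_of_le hν0 with h | hν0
  · rw [← h] at ha hb
    have : a = 0 := pow_eq_zero_iff two_ne_zero |>.1 (le_antisymm (by linarith) (sq_nonneg a))
    rw [this]
    linarith
  rcases eq_or_lt_of_le hν1 with h | hν1
  · have hμ1 : μ = 1 := by
      rw [h] at r3
      have : lam ≠ 0 := by positivity
      have : 1 - μ = 0 := by simpa [this] using r3.symm
      linarith
    have hqm : qm = 0 := by
      rw [hμ1] at eq
      exact pow_eq_zero_iff two_ne_zero |>.1 (le_antisymm (by linarith) (sq_nonneg qm))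
    have hLB : L = B := by
      rw [hqm] at hBL
      exact le_antisymm (by linarith [hBL.1]) (by linarith [hBL.2])
    have hκz : κ = 0 := by rw [hκ, hμ1, hLB]; ring
    rw [h, hκz] at ha hb
    have : b = 0 := pow_eq_zero_iff two_ne_zero |>.1 (le_antisymm (by linarith) (sq_nonneg b))
    rw [this]
    linarith
  -- the inequality of Cauchy, with weights `ν` and `1 - ν`
  have hpos : 0 < ν * (1 - ν) := mul_pos hν0 (sub_pos.2 hν1)
  have cauchy : ν * (1 - ν) * (a + b) ^ 2 ≤ (1 - ν) * a ^ 2 + ν * b ^ 2 := by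
    linarith [sq_nonneg ((1 - ν) * a - ν * b)]
  have e1 := mul_le_mul_of_nonneg_left ha (sub_pos.2 hν1).le
  have e2 := mul_le_mul_of_nonneg_left hb hν0.le
  refine le_of_mul_le_mul_left (a := ν * (1 - ν)) ?_ hpos
  linarith

/-- If `m` satisfies the inequality on the segment from `p` to `q`, and `x` on the part from
`p` to `m`, then `x` satisfies it on the whole segment. -/
theorem Stewart.trans {p q m x y : X} {μ s : ℝ} (hs : 0 ≤ s) (hm : Stewart p q μ m y)
    (hpm : μ * dist p q ≤ dist p m) (hμ : 0 ≤ μ) (hs1 : s ≤ 1)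
    (hx : Stewart p m s x y) : Stewart p q (s * μ) x y := by
  unfold Stewart at *
  have a := pow_le_pow_left₀ (by positivity) hpm 2
  have e1 := mul_le_mul_of_nonneg_left hm hs
  have e2 := mul_le_mul_of_nonneg_left a (mul_nonneg hs (sub_nonneg.2 hs1))
  nlinarith

/-- If `W` is contained in `A` and in `B`, and all three have the property, then the dividing points
in `W` serve for `A` and `B` as well, since dividing points are unique. -/
theorem CNOn.exists_common {A B W : Set X} (hA : CNOn A) (hB : CNOn B) (hW : CNOn W)
    (hWA : W ⊆ A) (hWB : W ⊆ B) {p q : X} (hp : p ∈ W) (hq : q ∈ W) {t : ℝ}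
    (ht : t ∈ Set.Icc (0 : ℝ) 1) :
    ∃ w ∈ W, (∀ y ∈ A, Stewart p q t w y) ∧ ∀ y ∈ B, Stewart p q t w y := by
  obtain ⟨w, hw, h⟩ := hW p hp q hq t ht
  have hl := (h p hp).dist_left ht.1
  have hr := (h q hq).dist_right ht.2
  obtain ⟨a, ha, h'⟩ := hA p (hWA hp) q (hWA hq) t ht
  obtain ⟨b, hb, h''⟩ := hB p (hWB hp) q (hWB hq) t ht
  exact ⟨w, hw, fun y hy => (h' y hy).congr_point ((h' w (hWA hw)).dist_eq_zero ht.1 ht.2 hl hr),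
    fun y hy => (h'' y hy).congr_point ((h'' w (hWB hw)).dist_eq_zero ht.1 ht.2 hl hr)⟩

theorem exists_ratio {p c q : X} (h : dist p q = dist p c + dist c q) :
    ∃ μ ∈ Set.Icc (0 : ℝ) 1, dist p c = μ * dist p q ∧ dist c q = (1 - μ) * dist p q := by
  have h1 := dist_nonneg (x := p) (y := c)
  have h2 := dist_nonneg (x := c) (y := q)
  rcases eq_or_lt_of_le (dist_nonneg (x := p) (y := q)) with h0 | h0
  · exact ⟨0, ⟨le_rfl, zero_le_one⟩, by linarith, by linarith⟩
  · refine ⟨dist p c / dist p q, ⟨by positivity, by rw [div_le_one h0]; linarith⟩, ?_, ?_⟩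
    · field_simp
    · rw [sub_mul, div_mul_cancel₀ _ h0.ne']; linarith

/-- The points of a segment from `W` to `A` satisfy the inequality with respect to `B`. -/
theorem stewart_of_glue_wall {A B W : Set X} (hA : CNOn A) (hB : CNOn B) (hW : CNOn W)
    (hWA : W ⊆ A) (hWB : W ⊆ B)
    (hAB : ∀ a ∈ A, ∀ b ∈ B, ∃ c ∈ W, dist a b = dist a c + dist c b)
    {e p z y : X} {t : ℝ} (he : e ∈ W) (hp : p ∈ A) (hy : y ∈ B) (ht : t ∈ Set.Icc (0 : ℝ) 1)
    (hz : ∀ x ∈ A, Stewart e p t z x) : Stewart e p t z y := by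
  obtain ⟨c, hc, hd⟩ := hAB p hp y hy
  rw [dist_comm p y, dist_comm p c, dist_comm c y, add_comm] at hd
  obtain ⟨μ, hμ, h1, h2⟩ := exists_ratio hd
  refine stewart_of_cut hμ.1 hμ.2 ht.1 ht.2 h1.le h2.le fun s hs => ?_
  obtain ⟨w, hw, hwA, hwB⟩ := hA.exists_common hB hW hWA hWB he hc hs
  exact ⟨w, hwB y hy, hwA p hp, hwA e (hWA he), hz w (hWA hw)⟩

/-- The points of a segment of `A` satisfy the inequality with respect to `B`. -/
theorem stewart_of_glue {A B W : Set X} (hA : CNOn A) (hB : CNOn B) (hW : CNOn W)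
    (hWA : W ⊆ A) (hWB : W ⊆ B)
    (hAB : ∀ a ∈ A, ∀ b ∈ B, ∃ c ∈ W, dist a b = dist a c + dist c b)
    {p q z y : X} {t : ℝ} (hp : p ∈ A) (hq : q ∈ A) (hy : y ∈ B) (ht : t ∈ Set.Icc (0 : ℝ) 1)
    (hz : ∀ x ∈ A, Stewart p q t z x) : Stewart p q t z y := by
  obtain ⟨c, hc, hd⟩ := hAB q hq y hy
  rw [dist_comm q y, dist_comm q c, dist_comm c y, add_comm] at hd
  obtain ⟨μ, hμ, h1, h2⟩ := exists_ratio hd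
  refine stewart_of_cut hμ.1 hμ.2 ht.1 ht.2 h1.le h2.le fun s hs => ?_
  obtain ⟨w, hw, h⟩ := hA p hp c (hWA hc) s hs
  refine ⟨w, ?_, h q hq, h p hp, hz w hw⟩
  have := (stewart_of_glue_wall hA hB hW hWA hWB hAB (t := 1 - s) (z := w) hc hp hy
    ⟨by linarith [hs.2], by linarith [hs.1]⟩ fun x hx => (h x hx).symm).symm
  rwa [sub_sub_cancel] at this

/-- The dividing points of a segment from `A` to `B`. The point `c` at which it crosses `W` satisfies
the inequality by a first variation argument, and the other points lie in one of its parts. -/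
theorem exists_stewart_of_glue {A B W : Set X} (hA : CNOn A) (hB : CNOn B) (hW : CNOn W)
    (hWA : W ⊆ A) (hWB : W ⊆ B)
    (hAB : ∀ a ∈ A, ∀ b ∈ B, ∃ c ∈ W, dist a b = dist a c + dist c b)
    {p q : X} (hp : p ∈ A) (hq : q ∈ B) {t : ℝ} (ht : t ∈ Set.Icc (0 : ℝ) 1) :
    ∃ x ∈ A ∪ B, ∀ y ∈ A ∪ B, Stewart p q t x y := by
  have hBA : ∀ b ∈ B, ∀ a ∈ A, ∃ c ∈ W, dist b a = dist b c + dist c a := by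
    intro b hb a ha
    obtain ⟨c, hc, h⟩ := hAB a ha b hb
    exact ⟨c, hc, by rw [dist_comm b a, h, dist_comm a c, dist_comm b c, add_comm]⟩
  obtain ⟨c, hc, hd⟩ := hAB p hp q hq
  obtain ⟨μ, hμ, h1, h2⟩ := exists_ratio hd
  have hcA : ∀ y ∈ A, Stewart p q μ c y := by
    intro y hy
    refine stewart_of_variation hμ.1 hμ.2 h1.le h2.le fun s hs => ?_
    obtain ⟨w, hw, h⟩ := hA c (hWA hc) y hy s hs
    exact ⟨w, h p hp, stewart_of_glue_wall hA hB hW hWA hWB hAB hc hy hq hs h⟩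
  have hcB : ∀ y ∈ B, Stewart p q μ c y := by
    intro y hy
    refine stewart_of_variation hμ.1 hμ.2 h1.le h2.le fun s hs => ?_
    obtain ⟨w, hw, h⟩ := hB c (hWB hc) y hy s hs
    exact ⟨w, stewart_of_glue_wall hB hA hW hWB hWA hBA hc hy hp hs h, h q hq⟩
  have hcAB : ∀ y ∈ A ∪ B, Stewart p q μ c y := fun y hy => hy.elim (hcA y) (hcB y)
  rcases le_or_gt t μ with htμ | htμ
  · obtain ⟨s, hs, rfl⟩ : ∃ s ∈ Set.Icc (0 : ℝ) 1, t = s * μ := by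
      rcases eq_or_lt_of_le hμ.1 with h | h
      · exact ⟨0, ⟨le_rfl, zero_le_one⟩, by rw [zero_mul]; linarith [ht.1]⟩
      · exact ⟨t / μ, ⟨div_nonneg ht.1 h.le, by rwa [div_le_one h]⟩, by field_simp⟩
    obtain ⟨x, hx, h⟩ := hA p hp c (hWA hc) s hs
    refine ⟨x, Or.inl hx, fun y hy => (hcAB y hy).trans hs.1 h1.ge hμ.1 hs.2 ?_⟩
    exact hy.elim (h y) fun hy => stewart_of_glue hA hB hW hWA hWB hAB hp (hWA hc) hy hs h
  · obtain ⟨s, hs, hts⟩ : ∃ s ∈ Set.Icc (0 : ℝ) 1, 1 - t = s * (1 - μ) := by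
      have h : 0 < 1 - μ := by linarith [ht.2]
      exact ⟨(1 - t) / (1 - μ), ⟨div_nonneg (by linarith [ht.2]) h.le,
        by rw [div_le_one h]; linarith⟩, by field_simp⟩
    obtain ⟨x, hx, h⟩ := hB q hq c (hWB hc) s hs
    refine ⟨x, Or.inr hx, fun y hy => ?_⟩
    have := ((hcAB y hy).symm.trans hs.1 (by rw [dist_comm q p, dist_comm q c, h2])
      (by linarith [hμ.2]) hs.2 (hy.elim (fun hy =>
        stewart_of_glue hB hA hW hWB hWA hBA hq (hWB hc) hy hs h) (h y))).symm
    rwa [← hts, sub_sub_cancel] at this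

/-- Reshetnyak's gluing theorem. -/
theorem CNOn.union {A B W : Set X} (hA : CNOn A) (hB : CNOn B) (hW : CNOn W)
    (hWA : W ⊆ A) (hWB : W ⊆ B)
    (hAB : ∀ a ∈ A, ∀ b ∈ B, ∃ c ∈ W, dist a b = dist a c + dist c b) : CNOn (A ∪ B) := by
  have hBA : ∀ b ∈ B, ∀ a ∈ A, ∃ c ∈ W, dist b a = dist b c + dist c a := by
    intro b hb a ha
    obtain ⟨c, hc, h⟩ := hAB a ha b hb
    exact ⟨c, hc, by rw [dist_comm b a, h, dist_comm a c, dist_comm b c, add_comm]⟩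
  rintro p (hp | hp) q (hq | hq) t ht
  · obtain ⟨x, hx, h⟩ := hA p hp q hq t ht
    exact ⟨x, Or.inl hx, fun y hy => hy.elim (h y) fun hy =>
      stewart_of_glue hA hB hW hWA hWB hAB hp hq hy ht h⟩
  · exact exists_stewart_of_glue hA hB hW hWA hWB hAB hp hq ht
  · rw [Set.union_comm]
    exact exists_stewart_of_glue hB hA hW hWB hWA hBA hp hq ht
  · obtain ⟨x, hx, h⟩ := hB p hp q hq t ht
    exact ⟨x, Or.inr hx, fun y hy => hy.elim (fun hy =>
      stewart_of_glue hB hA hW hWB hWA hBA hp hq hy ht h) (h y)⟩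

/-- Since dividing points are unique, it is enough to have sets with the property that contain
any given finite set. -/
theorem CNOn.univ_of_finite (h : ∀ F : Set X, F.Finite → ∃ U, F ⊆ U ∧ CNOn U) :
    CNOn (Set.univ : Set X) := by
  intro p _ q _ t ht
  obtain ⟨U, hFU, hU⟩ := h {p, q} (by simp)
  have hp : p ∈ U := hFU (by simp)
  have hq : q ∈ U := hFU (by simp)
  obtain ⟨x, hx, hxU⟩ := hU p hp q hq t ht
  refine ⟨x, trivial, fun y _ => ?_⟩
  obtain ⟨V, hFV, hV⟩ := h {p, q, x, y} (by simp)
  obtain ⟨x', hx', hxV⟩ := hV p (hFV (by simp)) q (hFV (by simp)) t ht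
  exact (hxV y (hFV (by simp))).congr_point ((hxV x (hFV (by simp))).dist_eq_zero ht.1 ht.2
    ((hxU p hp).dist_left ht.1) ((hxU q hq).dist_right ht.2))

end Stewart

/-! ### From the inequality of Stewart to `CAT(0)` spaces -/

/-- In the Euclidean plane the inequality of Stewart is an equality. -/
theorem dist_sq_of_ratio {E : Type*} [NormedAddCommGroup E] [InnerProductSpace ℝ E]
    {p q x : E} {t : ℝ}
    (hp : dist p x = t * dist p q) (hq : dist x q = (1 - t) * dist p q) (y : E) :
    dist y x ^ 2 = (1 - t) * dist y p ^ 2 + t * dist y q ^ 2 - t * (1 - t) * dist p q ^ 2 := by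
  have key : ∀ z : E, dist z (AffineMap.lineMap p q t) ^ 2 =
      (1 - t) * dist z p ^ 2 + t * dist z q ^ 2 - t * (1 - t) * dist p q ^ 2 := by
    intro z
    have e : z - AffineMap.lineMap p q t = (1 - t) • (z - p) + t • (z - q) := by
      rw [AffineMap.lineMap_apply]
      simp only [vsub_eq_sub, vadd_eq_add, smul_sub, sub_smul, one_smul]
      abel
    have e' : p - q = (z - q) - (z - p) := by abel
    rw [dist_eq_norm, dist_eq_norm, dist_eq_norm, dist_eq_norm, e, e', norm_add_sq_real,
      norm_sub_sq_real (z - q), norm_smul, norm_smul, inner_smul_left, inner_smul_right,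
      real_inner_comm (z - p) (z - q)]
    simp only [Real.norm_eq_abs, mul_pow, sq_abs, conj_trivial]
    ring
  have hx : dist x (AffineMap.lineMap p q t) = 0 := by
    have := key x
    rw [dist_comm x p, hp, hq] at this
    have h2 : dist x (AffineMap.lineMap p q t) ^ 2 = 0 := by rw [this]; ring
    exact pow_eq_zero_iff two_ne_zero |>.1 h2
  rw [dist_eq_of_dist_eq_zero hx, key]

/-- The inequality of Stewart, first for `x` on the side `[p, q]` and the opposite vertex `y` of the
triangle `p q y`, then for `y` on the side `[p, r]` and the vertex `q`, bounds `dist x y` by its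
value in the plane. -/
theorem isCAT0Space_of_CNOn_univ {X : Type*} [MetricSpace X]
    (h : CNOn (Set.univ : Set X)) : IsCAT0Space X := by
  have h' : ∀ p q : X, ∀ t ∈ Set.Icc (0 : ℝ) 1, ∃ x, ∀ y, Stewart p q t x y := by
    intro p q t ht
    obtain ⟨x, -, hx⟩ := h p trivial q trivial t ht
    exact ⟨x, fun y => hx y trivial⟩
  have stew : ∀ {p x q : X}, dist p x + dist x q = dist p q → ∃ t ∈ Set.Icc (0 : ℝ) 1,
      dist p x = t * dist p q ∧ dist x q = (1 - t) * dist p q ∧ ∀ y, Stewart p q t x y := by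
    intro p x q hx
    obtain ⟨t, ht, h1, h2⟩ := exists_ratio hx.symm
    obtain ⟨z, hz⟩ := h' p q t ht
    exact ⟨t, ht, h1, h2, fun y =>
      (hz y).congr_point ((hz x).dist_eq_zero ht.1 ht.2 h1.le h2.le)⟩
  constructor
  · intro p q
    have hd0 : 0 ≤ dist p q := dist_nonneg
    rcases eq_or_lt_of_le hd0 with hd | hd
    · have hpq : p = q := dist_eq_zero.1 hd.symm
      subst hpq
      refine ⟨fun _ => p, rfl, rfl, fun s hs t ht => ?_⟩
      rw [dist_self, Set.Icc_self, Set.mem_singleton_iff] at hs ht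
      simp [hs, ht]
    have : Nonempty X := ⟨p⟩
    choose! f hf using fun t ht => h' p q t ht
    have hmem : ∀ s ∈ Set.Icc (0 : ℝ) (dist p q), s / dist p q ∈ Set.Icc (0 : ℝ) 1 := fun s hs =>
      ⟨div_nonneg hs.1 hd0, by rw [div_le_one hd]; exact hs.2⟩
    have hl : ∀ t ∈ Set.Icc (0 : ℝ) 1, dist p (f t) ≤ t * dist p q := fun t ht =>
      (hf t ht p).dist_left ht.1
    have hr : ∀ t ∈ Set.Icc (0 : ℝ) 1, dist (f t) q ≤ (1 - t) * dist p q := fun t ht =>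
      (hf t ht q).dist_right ht.2
    have hle : ∀ s ∈ Set.Icc (0 : ℝ) 1, ∀ t ∈ Set.Icc (0 : ℝ) 1, s ≤ t →
        dist (f s) (f t) = (t - s) * dist p q := by
      intro s hs t ht hst
      apply le_antisymm
      · have e1 := hf t ht (f s)
        unfold Stewart at e1
        have e2 := pow_le_pow_left₀ dist_nonneg (hl s hs) 2
        have e3 := pow_le_pow_left₀ dist_nonneg (hr s hs) 2
        rw [dist_comm (f s) p] at e1
        refine le_of_sq_le_sq ?_ (mul_nonneg (sub_nonneg.2 hst) hd0)
        have e4 := mul_le_mul_of_nonneg_left e2 (sub_nonneg.2 ht.2)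
        have e5 := mul_le_mul_of_nonneg_left e3 ht.1
        linarith
      · have e1 := hl s hs
        have e2 := hr t ht
        have e3 := dist_triangle4 p (f s) (f t) q
        linarith
    have hdist : ∀ s ∈ Set.Icc (0 : ℝ) 1, ∀ t ∈ Set.Icc (0 : ℝ) 1,
        dist (f s) (f t) = |s - t| * dist p q := by
      intro s hs t ht
      rcases le_total s t with hst | hst
      · rw [hle s hs t ht hst, abs_of_nonpos (by linarith)]
        ring
      · rw [dist_comm, hle t ht s hs hst, abs_of_nonneg (by linarith)]
    refine ⟨fun s => f (s / dist p q), ?_, ?_, fun s hs t ht => ?_⟩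
    · have := hl 0 ⟨le_rfl, zero_le_one⟩
      rw [zero_mul] at this
      simpa using (dist_le_zero.1 this).symm
    · have := hr 1 ⟨zero_le_one, le_rfl⟩
      rw [sub_self, zero_mul] at this
      simpa [div_self hd.ne'] using dist_le_zero.1 this
    · rw [hdist _ (hmem s hs) _ (hmem t ht), ← sub_div, abs_div, abs_of_pos hd,
        div_mul_cancel₀ _ hd.ne']
  · intro p q r x y p' q' r' x' y' hpq hqr hpr hx hy hpx hxq hpy hyr
    obtain ⟨s, hs, s1, s2, hS⟩ := stew hx
    obtain ⟨t, ht, t1, t2, hT⟩ := stew hy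
    have E1 := dist_sq_of_ratio (p := p') (q := q') (x := x')
      (by rw [hpx, s1, hpq]) (by rw [hxq, s2, hpq])
    have E2 := dist_sq_of_ratio (p := p') (q := r') (x := y')
      (by rw [hpy, t1, hpr]) (by rw [hyr, t2, hpr])
    have a := hS y
    have b := hT q
    unfold Stewart at a b
    have a' := E1 y'
    have b' := E2 q'
    rw [dist_comm y' p', dist_comm y' q', hpy, hpq] at a'
    rw [dist_comm q' p', hpq, hqr, hpr] at b'
    rw [dist_comm y p, dist_comm y q] at a
    rw [dist_comm q p] at b
    rw [dist_comm x y, dist_comm x' y']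
    refine le_of_sq_le_sq ?_ dist_nonneg
    rw [a']
    have := mul_le_mul_of_nonneg_left (b.trans_eq b'.symm) hs.1
    linarith

/-! ### First letters of elements of free groups -/

section FirstLetter

variable {ι : Type*}

/-- A basis element of a free group or the inverse of one. -/
def IsLetter (x : FreeGroup ι) : Prop := ∃ a : ι × Bool, x = FreeGroup.mk [a]

theorem isLetter_of (i : ι) : IsLetter (FreeGroup.of i) := ⟨(i, true), rfl⟩

theorem isLetter_iff {x : FreeGroup ι} :
    IsLetter x ↔ ∃ i, x = FreeGroup.of i ∨ x = (FreeGroup.of i)⁻¹ := by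
  constructor
  · rintro ⟨⟨i, b⟩, rfl⟩
    refine ⟨i, ?_⟩
    cases b
    · exact Or.inr rfl
    · exact Or.inl rfl
  · rintro ⟨i, rfl | rfl⟩
    · exact ⟨(i, true), rfl⟩
    · exact ⟨(i, false), rfl⟩

theorem IsLetter.inv {x : FreeGroup ι} (h : IsLetter x) : IsLetter x⁻¹ := by
  obtain ⟨⟨i, b⟩, rfl⟩ := h
  exact ⟨(i, !b), by simp [FreeGroup.inv_mk, FreeGroup.invRev]⟩

variable [DecidableEq ι]

theorem IsLetter.ne_one {x : FreeGroup ι} (h : IsLetter x) : x ≠ 1 := by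
  obtain ⟨a, rfl⟩ := h
  intro h
  have := congrArg FreeGroup.toWord h
  simp [FreeGroup.toWord_mk] at this

/-- The reduced word of `u` begins with the letter `x`. -/
def StartsWith (x u : FreeGroup ι) : Prop := ∃ a, x = FreeGroup.mk [a] ∧ u.toWord.head? = some a

theorem not_startsWith_one (x : FreeGroup ι) : ¬ StartsWith x 1 := by
  rintro ⟨a, -, h⟩
  simp at h

theorem startsWith_self {x : FreeGroup ι} (h : IsLetter x) : StartsWith x x := by
  obtain ⟨a, rfl⟩ := h
  exact ⟨a, rfl, by simp [FreeGroup.toWord_mk]⟩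

theorem mk_singleton_injective : Function.Injective fun a : ι × Bool => FreeGroup.mk [a] := by
  intro a b h
  have := congrArg FreeGroup.toWord h
  simpa [FreeGroup.toWord_mk] using this

theorem StartsWith.unique {x y u : FreeGroup ι} (hx : StartsWith x u) (hy : StartsWith y u) :
    x = y := by
  obtain ⟨a, rfl, ha⟩ := hx
  obtain ⟨b, rfl, hb⟩ := hy
  rw [ha] at hb
  rw [Option.some.inj hb]

theorem startsWith_inv_mul {x u : FreeGroup ι} (hx : IsLetter x) (h : ¬ StartsWith x u) :
    StartsWith x⁻¹ (x⁻¹ * u) := by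
  obtain ⟨⟨i, b⟩, rfl⟩ := hx
  have e : (FreeGroup.mk [(i, b)])⁻¹ = FreeGroup.mk [(i, !b)] := by
    simp [FreeGroup.inv_mk, FreeGroup.invRev]
  rw [e]
  have hu : ¬ u ∈ FreeGroup.startsWith ((i, !b).1, !(i, !b).2) := by
    intro hu
    refine h ⟨(i, b), rfl, ?_⟩
    have hu' : u.toWord[0]? = some (i, !!b) := hu
    rw [List.head?_eq_getElem?, hu', Bool.not_not]
  have hu' : (FreeGroup.mk [(i, !b)] * u).toWord[0]? = some (i, !b) :=
    FreeGroup.startsWith_mk_mul u hu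
  exact ⟨_, rfl, by rw [List.head?_eq_getElem?, hu']⟩

theorem startsWith_mul_letter {x u μ : FreeGroup ι} (hμ : IsLetter μ) (hu : u ≠ 1)
    (h : StartsWith x (u * μ)) : StartsWith x u := by
  obtain ⟨a, rfl, ha⟩ := h
  obtain ⟨⟨i, b⟩, rfl⟩ := hμ
  refine ⟨a, rfl, ?_⟩
  have hL : FreeGroup.IsReduced u.toWord := FreeGroup.isReduced_toWord
  have hne : u.toWord ≠ [] := by simpa using hu
  have hw : (u * FreeGroup.mk [(i, b)]).toWord = FreeGroup.reduce (u.toWord ++ [(i, b)]) := by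
    rw [← FreeGroup.toWord_mk, ← FreeGroup.mul_mk, FreeGroup.mk_toWord]
  rw [hw] at ha
  by_cases hr : FreeGroup.IsReduced (u.toWord ++ [(i, b)])
  · rw [hr.reduce_eq, List.head?_append_of_ne_nil _ hne] at ha
    exact ha
  · -- the last letter of `u` cancels
    obtain ⟨M, c, hM⟩ := List.eq_nil_or_concat u.toWord |>.resolve_left hne
    rw [List.concat_eq_append] at hM
    have hc : c = (i, !b) := by
      rw [FreeGroup.IsReduced, List.isChain_append] at hr
      have hr' : ¬ (c.1 = i → c.2 = b) := by
        intro hcb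
        refine hr ⟨hL, List.isChain_singleton _, ?_⟩
        intro z hz y hy
        rw [hM] at hz
        simp only [List.getLast?_append, List.getLast?_singleton, Option.some_or,
          Option.mem_def, Option.some.injEq, List.head?_cons] at hz hy
        subst hz hy
        exact hcb
      push Not at hr'
      obtain ⟨h1, h2⟩ := hr'
      refine Prod.ext h1 ?_
      revert h2
      cases c.2 <;> cases b <;> simp
    have hMr : FreeGroup.IsReduced M := by
      rw [hM] at hL
      exact hL.infix ⟨[], [c], by simp⟩
    have e : FreeGroup.reduce (u.toWord ++ [(i, b)]) = M := by
      rw [hM, hc]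
      refine Eq.trans ?_ hMr.reduce_eq
      apply FreeGroup.reduce.Step.eq
      have := @FreeGroup.Red.Step.not ι M [] i (!b)
      simpa using this
    rw [e] at ha
    rw [hM]
    rw [List.head?_append, ha]
    rfl

theorem startsWith_letter_mul {x μ : FreeGroup ι} (hx : IsLetter x) (hμ : IsLetter μ)
    (h : μ ≠ x⁻¹) : StartsWith x (x * μ) := by
  have := startsWith_inv_mul (u := μ) hx.inv fun hs => h (startsWith_self hμ |>.unique hs)
  simpa using this

/-- Right multiplication by a letter does not change the first letter, except that of `1`. -/
theorem eq_one_of_startsWith_mul {x u μ : FreeGroup ι} (hμ : IsLetter μ)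
    (h : StartsWith x (u * μ)) (hn : ¬ StartsWith x u) : u = 1 ∧ μ = x := by
  by_cases hu : u = 1
  · subst hu
    rw [one_mul] at h
    exact ⟨rfl, startsWith_self hμ |>.unique h⟩
  · exact absurd (startsWith_mul_letter hμ hu h) hn

/-- A set of elements of a free group that spans a subtree of the Cayley graph. -/
def IsSubtree (S : Set (FreeGroup ι)) : Prop :=
  ∀ w ∈ S, ∀ v ∈ S, ∀ x, StartsWith x (w⁻¹ * v) → w * x ∈ S

theorem isSubtree_singleton : IsSubtree ({1} : Set (FreeGroup ι)) := by
  rintro w rfl v rfl x h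
  rw [inv_one, one_mul] at h
  exact absurd h (not_startsWith_one x)

theorem IsSubtree.insert {S : Set (FreeGroup ι)} (hS : IsSubtree S) {w x : FreeGroup ι}
    (hw : w ∈ S) (hx : IsLetter x) (hwx : w * x ∉ S) : IsSubtree (insert (w * x) S) := by
  rintro u (rfl | hu) v (rfl | hv) y h
  · rw [inv_mul_cancel] at h
    exact absurd h (not_startsWith_one y)
  · have h1 : ¬ StartsWith x (w⁻¹ * v) := fun h' => hwx (hS w hw v hv x h')
    have h2 := startsWith_inv_mul hx h1
    rw [mul_inv_rev, mul_assoc] at h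
    rw [h.unique h2]
    exact Or.inr (by simpa using hw)
  · by_cases huw : StartsWith y (u⁻¹ * w)
    · exact Or.inr (hS u hu w hw y huw)
    · rw [← mul_assoc] at h
      obtain ⟨h1, rfl⟩ := eq_one_of_startsWith_mul hx h huw
      rw [inv_mul_eq_one.1 h1]
      exact Or.inl rfl
  · exact Or.inr (hS u hu v hv y h)

end FirstLetter

/-! ### Trees of spaces -/

/-- Walls along which copies of the space `X`, one for each element of a free group, are joined by
strips: the copies at `w` and `w * x`, for a letter `x`, are joined along the wall of `x`, which is
a geodesic line. The parameter of the line is rescaled by an unspecified factor. -/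
structure WallSystem (ι X : Type) [PseudoMetricSpace X] where
  /-- The wall of a letter. -/
  wall : FreeGroup ι → Set X
  wall_inv : ∀ x, wall x⁻¹ = wall x
  line : ∀ x, IsLetter x → ∃ ℓ : ℝ, 0 < ℓ ∧ ∃ γ : ℝ → X,
    (∀ s t, dist (γ s) (γ t) = ℓ * |s - t|) ∧ Set.range γ = wall x

/-- The points of the tree of spaces: the copy of `X` at `base`, together with the half-strips
`[0, 1] × wall dir` that issue from it towards the copy at `base * dir`. At height `0` the letter
`dir` is irrelevant, and the points of height `1` of opposite half-strips coincide; these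
identifications are made by the pseudometric only. -/
structure TreeSpace {ι X : Type} [PseudoMetricSpace X] (W : WallSystem ι X) where
  /-- The vertex of the Cayley tree nearest to the point. -/
  base : FreeGroup ι
  /-- The direction in which the point lies. -/
  dir : FreeGroup ι
  isLetter : IsLetter dir
  /-- The distance from the copy of `X` at `base`. -/
  ht : ℝ
  ht_nonneg : 0 ≤ ht
  ht_le : ht ≤ 1
  /-- The projection to `X`. -/
  pt : X
  mem : ht = 0 ∨ pt ∈ W.wall dir

namespace TreeSpace

variable {ι X : Type} [PseudoMetricSpace X] {W : WallSystem ι X}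

/-- Two points in a common piece, and their distance in this piece: in a copy of `X`, in the same
half-strip, or in the two halves of a strip. -/
inductive Step : TreeSpace W → TreeSpace W → ℝ → Prop
  | vertex (z z' : TreeSpace W) : z'.base = z.base → z.ht = 0 → z'.ht = 0 →
      Step z z' (dist z.pt z'.pt)
  | half (z z' : TreeSpace W) : z'.base = z.base → z'.dir = z.dir → z.pt ∈ W.wall z.dir →
      z'.pt ∈ W.wall z.dir → Step z z' √((z.ht - z'.ht) ^ 2 + dist z.pt z'.pt ^ 2)
  | cross (z z' : TreeSpace W) : z'.base = z.base * z.dir → z'.dir = z.dir⁻¹ →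
      z.pt ∈ W.wall z.dir → z'.pt ∈ W.wall z.dir →
      Step z z' √((z.ht - (2 - z'.ht)) ^ 2 + dist z.pt z'.pt ^ 2)

/-- Chains of points, consecutive ones in a common piece, with their length. -/
inductive Chain : TreeSpace W → TreeSpace W → ℝ → Prop
  | nil (z : TreeSpace W) : Chain z z 0
  | cons {x y z : TreeSpace W} {r l : ℝ} : Step x y r → Chain y z l → Chain x z (r + l)

theorem Step.nonneg {x y : TreeSpace W} {r : ℝ} (h : Step x y r) : 0 ≤ r := by
  cases h <;> positivity

theorem Step.symm {x y : TreeSpace W} {r : ℝ} (h : Step x y r) : Step y x r := by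
  cases h with
  | vertex h1 h2 h3 =>
    rw [dist_comm]
    exact .vertex _ _ h1.symm h3 h2
  | half h1 h2 h3 h4 =>
    have := Step.half y x h1.symm h2.symm (by rwa [h2]) (by rwa [h2])
    rwa [dist_comm, ← neg_sub, neg_sq] at this
  | cross h1 h2 h3 h4 =>
    have := Step.cross y x (by rw [h1, h2, mul_inv_cancel_right]) (by rw [h2, inv_inv])
      (by rwa [h2, W.wall_inv]) (by rwa [h2, W.wall_inv])
    rw [dist_comm] at this
    convert this using 4
    ring

theorem Chain.nonneg {x y : TreeSpace W} {l : ℝ} (h : Chain x y l) : 0 ≤ l := by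
  induction h with
  | nil => exact le_rfl
  | cons h _ ih => exact add_nonneg h.nonneg ih

theorem Step.chain {x y : TreeSpace W} {r : ℝ} (h : Step x y r) : Chain x y r := by
  simpa using Chain.cons h (Chain.nil y)

theorem Chain.append {x y z : TreeSpace W} {l l' : ℝ} (h : Chain x y l) (h' : Chain y z l') :
    Chain x z (l + l') := by
  induction h with
  | nil => simpa using h'
  | cons h _ ih =>
    rw [add_assoc]
    exact .cons h (ih h')

theorem Chain.symm {x y : TreeSpace W} {l : ℝ} (h : Chain x y l) : Chain y x l := by
  induction h with
  | nil z => exact .nil z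
  | cons h _ ih =>
    rw [add_comm]
    exact ih.append h.symm.chain

/-- The point of the copy of `X` at `w` that lies over `p`. -/
@[simps] def vert (w x : FreeGroup ι) (hx : IsLetter x) (p : X) : TreeSpace W :=
  ⟨w, x, hx, 0, le_rfl, zero_le_one, p, Or.inl rfl⟩

theorem exists_mem_wall (W : WallSystem ι X) {x : FreeGroup ι} (hx : IsLetter x) :
    ∃ p, p ∈ W.wall x := by
  obtain ⟨ℓ, -, γ, -, h⟩ := W.line x hx
  exact ⟨γ 0, h ▸ Set.mem_range_self 0⟩

theorem exists_chain_base (z : TreeSpace W) (y : FreeGroup ι) (hy : IsLetter y) (p : X) :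
    ∃ l, Chain z (vert z.base y hy p) l := by
  have h1 : ∃ l, Chain z (vert z.base z.dir z.isLetter z.pt) l := by
    rcases z.mem with h | h
    · exact ⟨_, (Step.vertex z (vert z.base z.dir z.isLetter z.pt) rfl h rfl).chain⟩
    · exact ⟨_, (Step.half z (vert z.base z.dir z.isLetter z.pt) rfl rfl h h).chain⟩
  obtain ⟨l, h1⟩ := h1
  exact ⟨_, h1.append (Step.vertex (W := W) (vert z.base z.dir z.isLetter z.pt)
    (vert z.base y hy p) rfl rfl rfl).chain⟩

theorem exists_chain_letter (w x y : FreeGroup ι) (hx : IsLetter x) (hy : IsLetter y) (p : X) :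
    ∃ l, Chain (W := W) (vert w y hy p) (vert (w * x) y hy p) l := by
  obtain ⟨q, hq⟩ := exists_mem_wall W hx
  have h2 := (Step.cross (W := W) (vert w x hx q) (vert (w * x) x⁻¹ hx.inv q) rfl rfl hq hq).chain
  have h1 := (Step.vertex (W := W) (vert w y hy p) (vert w x hx q) rfl rfl rfl).chain
  have h3 := (Step.vertex (W := W) (vert (w * x) x⁻¹ hx.inv q) (vert (w * x) y hy p)
    rfl rfl rfl).chain
  exact ⟨_, (h1.append h2).append h3⟩

theorem exists_chain_vert (w v y : FreeGroup ι) (hy : IsLetter y) (p : X) :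
    ∃ l, Chain (W := W) (vert w y hy p) (vert (w * v) y hy p) l := by
  induction v using FreeGroup.induction_on generalizing w with
  | C1 => exact ⟨0, by rw [mul_one]; exact .nil _⟩
  | of i => exact exists_chain_letter w _ y (isLetter_of i) hy p
  | inv_of i _ => exact exists_chain_letter w _ y (isLetter_of i).inv hy p
  | mul u v hu hv =>
    obtain ⟨l, h⟩ := hu w
    obtain ⟨l', h'⟩ := hv (w * u)
    rw [mul_assoc] at h'
    exact ⟨_, h.append h'⟩

theorem exists_chain (z z' : TreeSpace W) : ∃ l, Chain z z' l := by
  obtain ⟨l, h⟩ := exists_chain_base z z.dir z.isLetter z.pt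
  obtain ⟨l', h'⟩ := exists_chain_base z' z.dir z.isLetter z.pt
  obtain ⟨l'', h''⟩ :=
    exists_chain_vert (W := W) z.base (z.base⁻¹ * z'.base) z.dir z.isLetter z.pt
  rw [mul_inv_cancel_left] at h''
  exact ⟨_, (h.append h'').append h'.symm⟩

theorem bddBelow_chain (z z' : TreeSpace W) : BddBelow {l | Chain z z' l} :=
  ⟨0, fun _ h => h.nonneg⟩

/-- The distance of two points is the infimum of the lengths of the chains between them. -/
noncomputable instance : PseudoMetricSpace (TreeSpace W) where
  dist z z' := sInf {l | Chain z z' l}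
  dist_self z := le_antisymm (csInf_le (bddBelow_chain z z) (.nil z))
    (le_csInf ⟨0, .nil z⟩ fun _ h => h.nonneg)
  dist_comm z z' := congrArg sInf (Set.ext fun _ => ⟨Chain.symm, Chain.symm⟩)
  dist_triangle x y z := by
    refine le_of_forall_pos_le_add fun ε hε => ?_
    obtain ⟨l, hl, hl'⟩ := Real.lt_sInf_add_pos (exists_chain x y) (half_pos hε)
    obtain ⟨r, hr, hr'⟩ := Real.lt_sInf_add_pos (exists_chain y z) (half_pos hε)
    have h : sInf {l | Chain x z l} ≤ l + r := csInf_le (bddBelow_chain x z) (hl.append hr)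
    refine h.trans ((add_le_add hl'.le hr'.le).trans_eq ?_)
    change _ = sInf (x.Chain y) + sInf (y.Chain z) + ε
    ring

theorem dist_le_of_chain {z z' : TreeSpace W} {l : ℝ} (h : Chain z z' l) : dist z z' ≤ l :=
  csInf_le (bddBelow_chain z z') h

theorem dist_le_of_step {z z' : TreeSpace W} {r : ℝ} (h : Step z z' r) : dist z z' ≤ r :=
  dist_le_of_chain h.chain

theorem le_dist_of_chain {z z' : TreeSpace W} {a : ℝ} (h : ∀ l, Chain z z' l → a ≤ l) :
    a ≤ dist z z' :=
  le_csInf (exists_chain z z') h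

open Classical in
/-- The distance, in the tree, from a point to the vertex `w`, truncated at `2`. -/
noncomputable def toVertex (w : FreeGroup ι) (z : TreeSpace W) : ℝ :=
  if z.base = w then z.ht else if z.base * z.dir = w then 2 - z.ht else 2

theorem mul_dir_ne (z : TreeSpace W) (w : FreeGroup ι) : w * z.dir ≠ w := by
  classical
  exact fun h => z.isLetter.ne_one (mul_eq_left.1 h)

/-- Distances in a product of a real line and `X` bound lengths of steps from below; with `w` one of
the vertices of a piece, they show that the piece is embedded isometrically. -/
theorem sqrt_le_of_step {z z' : TreeSpace W} {r : ℝ} (w : FreeGroup ι) (h : Step z z' r) :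
    √((toVertex w z - toVertex w z') ^ 2 + dist z.pt z'.pt ^ 2) ≤ r := by
  cases h with
  | vertex h1 h2 h3 =>
    have : toVertex w z = toVertex w z' := by
      unfold toVertex
      rw [h1, h2, h3]
      simp
    rw [this, sub_self]
    simp [Real.sqrt_sq dist_nonneg]
  | half h1 h2 h3 h4 =>
    apply Real.sqrt_le_sqrt
    gcongr ?_ + _
    unfold toVertex
    rw [h1, h2]
    split_ifs
    · exact le_rfl
    · nlinarith
    · nlinarith [sq_nonneg (z.ht - z'.ht)]
  | cross h1 h2 h3 h4 =>
    apply Real.sqrt_le_sqrt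
    gcongr ?_ + _
    have hb : z'.base * z'.dir = z.base := by rw [h1, h2, mul_inv_cancel_right]
    unfold toVertex
    rw [hb]
    have hne : z.base ≠ z'.base := by
      rw [h1]
      exact (mul_dir_ne z z.base).symm
    rw [← h1]
    split_ifs with a b b
    · exact absurd (a.trans b.symm) hne
    · exact le_rfl
    · nlinarith
    · nlinarith [sq_nonneg (z.ht - (2 - z'.ht))]

theorem sqrt_add_sq_le (a b c d : ℝ) :
    √((a + b) ^ 2 + (c + d) ^ 2) ≤ √(a ^ 2 + c ^ 2) + √(b ^ 2 + d ^ 2) := by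
  have hA : 0 ≤ a ^ 2 + c ^ 2 := by positivity
  have hB : 0 ≤ b ^ 2 + d ^ 2 := by positivity
  rw [Real.sqrt_le_left (by positivity), add_sq (√(a ^ 2 + c ^ 2)), Real.sq_sqrt hA, Real.sq_sqrt hB]
  have h : a * b + c * d ≤ √(a ^ 2 + c ^ 2) * √(b ^ 2 + d ^ 2) := by
    rw [← Real.sqrt_mul hA]
    apply Real.le_sqrt_of_sq_le
    nlinarith [sq_nonneg (a * d - b * c)]
  linarith

/-- The map to the product of a line and `X` given by `toVertex w` and the projection does not
increase distances. -/
theorem sqrt_le_dist (w : FreeGroup ι) (z z' : TreeSpace W) :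
    √((toVertex w z - toVertex w z') ^ 2 + dist z.pt z'.pt ^ 2) ≤ dist z z' := by
  refine le_dist_of_chain fun l h => ?_
  induction h with
  | nil => simp
  | @cons x y z r l h _ ih =>
    refine le_trans ?_ (add_le_add (sqrt_le_of_step w h) ih)
    refine le_trans ?_ (sqrt_add_sq_le _ _ _ _)
    apply Real.sqrt_le_sqrt
    have := dist_triangle x.pt y.pt z.pt
    rw [sub_add_sub_cancel]
    gcongr

theorem dist_pt_le (z z' : TreeSpace W) : dist z.pt z'.pt ≤ dist z z' :=
  (Real.le_sqrt_of_sq_le (by nlinarith)).trans (sqrt_le_dist 1 z z')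

theorem abs_toVertex_sub_le (w : FreeGroup ι) (z z' : TreeSpace W) :
    |toVertex w z - toVertex w z'| ≤ dist z z' :=
  (Real.le_sqrt_of_sq_le (by rw [sq_abs]; nlinarith)).trans (sqrt_le_dist w z z')

/-! ### Pieces and walls of a tree of spaces -/

/-- The copy of `X` at `w`. -/
def vertexPiece (W : WallSystem ι X) (w : FreeGroup ι) : Set (TreeSpace W) :=
  {z | z.base = w ∧ z.ht = 0}

/-- The strip between the copies of `X` at `w` and `w * x`. -/
def edgePiece (W : WallSystem ι X) (w x : FreeGroup ι) : Set (TreeSpace W) :=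
  {z | (z.base = w ∧ z.dir = x ∨ z.base = w * x ∧ z.dir = x⁻¹) ∧ z.pt ∈ W.wall x}

/-- The line at which the strip between the copies of `X` at `w` and `w * x` starts. -/
def wallPiece (W : WallSystem ι X) (w x : FreeGroup ι) : Set (TreeSpace W) :=
  {z | z.base = w ∧ z.dir = x ∧ z.ht = 0 ∧ z.pt ∈ W.wall x}

theorem dist_vertexPiece {w : FreeGroup ι} {z z' : TreeSpace W} (h : z ∈ vertexPiece W w)
    (h' : z' ∈ vertexPiece W w) : dist z z' = dist z.pt z'.pt :=
  le_antisymm (dist_le_of_step (.vertex z z' (h'.1.trans h.1.symm) h.2 h'.2)) (dist_pt_le z z')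

theorem toVertex_of_base {w : FreeGroup ι} {z : TreeSpace W} (h : z.base = w) :
    toVertex w z = z.ht := if_pos h

theorem toVertex_of_dir {w : FreeGroup ι} {z : TreeSpace W} (h : z.base * z.dir = w) :
    toVertex w z = 2 - z.ht := by
  unfold toVertex
  rw [if_neg, if_pos h]
  rintro rfl
  exact mul_dir_ne z _ h

theorem dist_edgePiece {w x : FreeGroup ι} {z z' : TreeSpace W} (h : z ∈ edgePiece W w x)
    (h' : z' ∈ edgePiece W w x) :
    dist z z' = √((toVertex w z - toVertex w z') ^ 2 + dist z.pt z'.pt ^ 2) := by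
  refine le_antisymm ?_ (sqrt_le_dist w z z')
  obtain ⟨h, hp⟩ := h
  obtain ⟨h', hp'⟩ := h'
  have hwi := W.wall_inv x
  rcases h with ⟨h1, h2⟩ | ⟨h1, h2⟩ <;> rcases h' with ⟨h1', h2'⟩ | ⟨h1', h2'⟩
  · rw [toVertex_of_base h1, toVertex_of_base h1']
    exact dist_le_of_step (.half z z' (h1'.trans h1.symm) (h2'.trans h2.symm)
      (by rwa [h2]) (by rwa [h2]))
  · rw [toVertex_of_base h1, toVertex_of_dir (z := z') (by rw [h1', h2', mul_inv_cancel_right])]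
    exact dist_le_of_step (.cross z z' (by rw [h1', h1, h2]) (by rw [h2', h2])
      (by rwa [h2]) (by rwa [h2]))
  · rw [toVertex_of_base h1', toVertex_of_dir (z := z) (by rw [h1, h2, mul_inv_cancel_right])]
    have := dist_le_of_step (.cross z z' (by rw [h1', h1, h2, mul_inv_cancel_right])
      (by rw [h2', h2, inv_inv]) (by rwa [h2, hwi]) (by rwa [h2, hwi]))
    refine this.trans_eq ?_
    congr 2
    ring
  · rw [toVertex_of_dir (z := z) (by rw [h1, h2, mul_inv_cancel_right]),
      toVertex_of_dir (z := z') (by rw [h1', h2', mul_inv_cancel_right])]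
    have := dist_le_of_step (.half z z' (h1'.trans h1.symm) (h2'.trans h2.symm)
      (by rwa [h2, hwi]) (by rwa [h2, hwi]))
    refine this.trans_eq ?_
    congr 2
    ring

theorem CNOn_vertexPiece (hX : CNOn (Set.univ : Set X)) (w : FreeGroup ι) :
    CNOn (vertexPiece W w) := by
  intro p hp q hq t ht
  obtain ⟨x, -, hx⟩ := hX p.pt trivial q.pt trivial t ht
  have hx' : vert w p.dir p.isLetter x ∈ vertexPiece W w := ⟨rfl, rfl⟩
  refine ⟨_, hx', fun y hy => ?_⟩
  unfold Stewart
  rw [dist_vertexPiece hy hx', dist_vertexPiece hy hp, dist_vertexPiece hy hq,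
    dist_vertexPiece hp hq]
  exact hx y.pt trivial

/-- Walls are flat. -/
theorem exists_mem_wall_dist_sq {x : FreeGroup ι} (hx : IsLetter x) {p q : X}
    (hp : p ∈ W.wall x) (hq : q ∈ W.wall x) (t : ℝ) :
    ∃ r ∈ W.wall x, ∀ y ∈ W.wall x, dist y r ^ 2 =
      (1 - t) * dist y p ^ 2 + t * dist y q ^ 2 - t * (1 - t) * dist p q ^ 2 := by
  obtain ⟨ℓ, -, γ, h, hr⟩ := W.line x hx
  rw [← hr] at hp hq ⊢
  obtain ⟨a, rfl⟩ := hp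
  obtain ⟨b, rfl⟩ := hq
  refine ⟨γ ((1 - t) * a + t * b), Set.mem_range_self _, ?_⟩
  rintro - ⟨c, rfl⟩
  simp only [h, mul_pow, sq_abs]
  ring

theorem CNOn_wallPiece (w : FreeGroup ι) {x : FreeGroup ι} (hx : IsLetter x) :
    CNOn (wallPiece W w x) := by
  have hs : wallPiece W w x ⊆ vertexPiece W w := fun z hz => ⟨hz.1, hz.2.2.1⟩
  intro p hp q hq t ht
  obtain ⟨r, hr, h⟩ := exists_mem_wall_dist_sq hx hp.2.2.2 hq.2.2.2 t
  have hz : vert w x hx r ∈ wallPiece W w x := ⟨rfl, rfl, rfl, hr⟩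
  refine ⟨_, hz, fun y hy => ?_⟩
  unfold Stewart
  rw [dist_vertexPiece (hs hy) (hs hz), dist_vertexPiece (hs hy) (hs hp),
    dist_vertexPiece (hs hy) (hs hq), dist_vertexPiece (hs hp) (hs hq)]
  exact (h y.pt hy.2.2.2).le

theorem toVertex_mem_Icc (w : FreeGroup ι) (z : TreeSpace W) :
    toVertex w z ∈ Set.Icc (0 : ℝ) 2 := by
  have h1 := z.ht_nonneg
  have h2 := z.ht_le
  unfold toVertex
  split_ifs <;> constructor <;> linarith

theorem exists_mem_edgePiece (w : FreeGroup ι) {x : FreeGroup ι} (hx : IsLetter x) {r : X}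
    (hr : r ∈ W.wall x) {u : ℝ} (hu : u ∈ Set.Icc (0 : ℝ) 2) :
    ∃ z ∈ edgePiece W w x, toVertex w z = u ∧ z.pt = r := by
  rcases le_total u 1 with h | h
  · refine ⟨⟨w, x, hx, u, hu.1, h, r, Or.inr hr⟩, ⟨Or.inl ⟨rfl, rfl⟩, hr⟩, ?_, rfl⟩
    exact toVertex_of_base rfl
  · refine ⟨⟨w * x, x⁻¹, hx.inv, 2 - u, by linarith [hu.2], by linarith, r,
      Or.inr (by rwa [W.wall_inv])⟩, ⟨Or.inr ⟨rfl, rfl⟩, hr⟩, ?_, rfl⟩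
    rw [toVertex_of_dir (mul_inv_cancel_right w x)]
    ring

theorem CNOn_edgePiece (w : FreeGroup ι) {x : FreeGroup ι} (hx : IsLetter x) :
    CNOn (edgePiece W w x) := by
  intro p hp q hq t ht
  obtain ⟨r, hr, h⟩ := exists_mem_wall_dist_sq hx hp.2 hq.2 t
  have hu : (1 - t) * toVertex w p + t * toVertex w q ∈ Set.Icc (0 : ℝ) 2 :=
    (convex_Icc (0 : ℝ) 2) (toVertex_mem_Icc w p) (toVertex_mem_Icc w q)
      (sub_nonneg.2 ht.2) ht.1 (by ring)
  obtain ⟨z, hz, hzu, hzr⟩ := exists_mem_edgePiece w hx hr hu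
  refine ⟨z, hz, fun y hy => ?_⟩
  have := h y.pt hy.2
  unfold Stewart
  rw [dist_edgePiece hy hz, dist_edgePiece hy hp, dist_edgePiece hy hq, dist_edgePiece hp hq,
    Real.sq_sqrt (by positivity), Real.sq_sqrt (by positivity), Real.sq_sqrt (by positivity),
    Real.sq_sqrt (by positivity), hzu, hzr, this]
  apply le_of_eq
  ring

/-! ### Walls separate a tree of spaces -/

section Separation

variable [DecidableEq ι]

/-- The points that lie on the same side as `w` of the line at which the strip from `w` to `w * x`
starts; the line itself is included. -/
def nearSide (W : WallSystem ι X) (w x : FreeGroup ι) : Set (TreeSpace W) :=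
  {z | ¬ StartsWith x (w⁻¹ * z.base) ∧ (z.base = w → z.dir = x → z.ht = 0)}

/-- The near side can be left only through the wall. -/
theorem Step.mem_wallPiece {w x : FreeGroup ι} {z z' : TreeSpace W} {r : ℝ} (h : Step z z' r)
    (hz : z ∈ nearSide W w x) (hz' : z' ∉ nearSide W w x) : z ∈ wallPiece W w x := by
  have hz'2 : ¬ StartsWith x (w⁻¹ * z'.base) → z'.base = w ∧ z'.dir = x ∧ z'.ht ≠ 0 := by
    intro h1
    by_contra h2
    exact hz' ⟨h1, fun a b => by_contra fun c => h2 ⟨a, b, c⟩⟩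
  cases h with
  | vertex h1 h2 h3 =>
    obtain ⟨-, -, h⟩ := hz'2 (by rw [h1]; exact hz.1)
    exact absurd h3 h
  | half h1 h2 h3 h4 =>
    obtain ⟨hb, hd, -⟩ := hz'2 (by rw [h1]; exact hz.1)
    rw [h1] at hb
    rw [h2] at hd
    exact ⟨hb, hd, hz.2 hb hd, hd ▸ h3⟩
  | cross h1 h2 h3 h4 =>
    by_cases hs : StartsWith x (w⁻¹ * z'.base)
    · rw [h1, ← mul_assoc] at hs
      obtain ⟨hb, hd⟩ := eq_one_of_startsWith_mul z.isLetter hs hz.1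
      have hb := (inv_mul_eq_one.1 hb).symm
      exact ⟨hb, hd, hz.2 hb hd, hd ▸ h3⟩
    · obtain ⟨hb, hd, -⟩ := hz'2 hs
      -- here `z` would lie at `w * x`
      refine absurd ?_ hz.1
      have hd' : z.dir = x⁻¹ := by rw [← hd, h2, inv_inv]
      have : z.base = w * x := by rw [← hb, h1, hd', inv_mul_cancel_right]
      rw [this, inv_mul_cancel_left]
      exact startsWith_self (by rw [← inv_inv x, ← hd']; exact z.isLetter.inv)

theorem Chain.exists_wallPiece {w x : FreeGroup ι} {a b : TreeSpace W} {l : ℝ}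
    (h : Chain a b l) (ha : a ∈ nearSide W w x) (hb : b ∉ nearSide W w x) :
    ∃ c ∈ wallPiece W w x, dist a c + dist c b ≤ l := by
  induction h with
  | nil => exact absurd ha hb
  | @cons z z' b r l h h' ih =>
    by_cases hz' : z' ∈ nearSide W w x
    · obtain ⟨c, hc, hl⟩ := ih hz' hb
      refine ⟨c, hc, ?_⟩
      have := dist_triangle z z' c
      have := dist_le_of_step h
      linarith
    · refine ⟨z, h.mem_wallPiece ha hz', ?_⟩
      rw [dist_self, zero_add]
      exact dist_le_of_chain (.cons h h')

/-- Points on different sides of a wall are joined by a shortest path through the wall, so that the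
gluing theorem applies to the two sides. -/
theorem exists_wallPiece_dist {w x : FreeGroup ι} (hx : IsLetter x) {a b : TreeSpace W}
    (ha : a ∈ nearSide W w x) (hb : b ∉ nearSide W w x) :
    ∃ c ∈ wallPiece W w x, dist a b = dist a c + dist c b := by
  obtain ⟨ℓ, hℓ, γ, hγ, hr⟩ := W.line x hx
  let c : ℝ → TreeSpace W := fun s => vert w x hx (γ s)
  have hc : ∀ s, c s ∈ wallPiece W w x := fun s => ⟨rfl, rfl, rfl, hr ▸ Set.mem_range_self s⟩
  have hcv : ∀ s, c s ∈ vertexPiece W w := fun s => ⟨rfl, rfl⟩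
  have hcd : ∀ s t, dist (c s) (c t) = ℓ * |s - t| := fun s t => by
    rw [dist_vertexPiece (hcv s) (hcv t)]
    exact hγ s t
  have hcont : Continuous c := by
    refine (LipschitzWith.of_dist_le_mul (K := ⟨ℓ, hℓ.le⟩) fun s t => ?_).continuous
    rw [hcd, Real.dist_eq]
    rfl
  -- the detour over the wall is shortest at some point, as it is long far away
  obtain ⟨s, hs⟩ := (show Continuous fun s => dist a (c s) + dist (c s) b by fun_prop)
    |>.exists_forall_le (by
      refine Filter.tendsto_atTop_mono (f := fun s => ℓ * |s| - dist a (c 0)) (fun s => ?_) ?_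
      · have h1 := dist_triangle (c 0) a (c s)
        rw [hcd, zero_sub, abs_neg, dist_comm (c 0)] at h1
        have h2 := dist_nonneg (x := c s) (y := b)
        linarith
      · apply Filter.tendsto_atTop_add_const_right
        exact (tendsto_norm_cocompact_atTop (E := ℝ)).const_mul_atTop hℓ)
  refine ⟨c s, hc s, le_antisymm (dist_triangle _ _ _) (le_dist_of_chain fun l hl => ?_)⟩
  obtain ⟨d, hd, hdl⟩ := hl.exists_wallPiece ha hb
  obtain ⟨t, ht⟩ : ∃ t, γ t = d.pt := by
    have := hd.2.2.2
    rwa [← hr] at this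
  have hdt : dist d (c t) = 0 := by
    rw [dist_vertexPiece ⟨hd.1, hd.2.2.1⟩ (hcv t)]
    change dist d.pt (γ t) = 0
    rw [ht, dist_self]
  refine (hs t).trans (le_trans (le_of_eq ?_) hdl)
  rw [dist_eq_of_dist_eq_zero hdt a, dist_comm d b, dist_eq_of_dist_eq_zero hdt b, dist_comm b]

/-- The part of the tree of spaces over a set of vertices and the edges between them. -/
def overSubtree (W : WallSystem ι X) (S : Set (FreeGroup ι)) : Set (TreeSpace W) :=
  {z | z.base ∈ S ∧ (z.ht = 0 ∨ z.base * z.dir ∈ S)}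

omit [DecidableEq ι] in
theorem overSubtree_singleton : overSubtree W {1} = vertexPiece W 1 := by
  ext z
  constructor
  · rintro ⟨h1, h | h⟩
    · exact ⟨h1, h⟩
    · rw [Set.mem_singleton_iff] at h1 h
      exact absurd (h.trans h1.symm) (mul_dir_ne z _)
  · rintro ⟨h1, h2⟩
    exact ⟨h1, Or.inl h2⟩

theorem overSubtree_insert {S : Set (FreeGroup ι)} (hS : IsSubtree S) {w x : FreeGroup ι}
    (hw : w ∈ S) (hx : IsLetter x) (hwx : w * x ∉ S) :
    overSubtree W (insert (w * x) S) =
      (overSubtree W S ∪ edgePiece W w x) ∪ vertexPiece W (w * x) := by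
  -- the only edge between `w * x` and `S` is the one from `w`
  have key : ∀ (y : FreeGroup ι), IsLetter y → w * x * y ∈ S → y = x⁻¹ := by
    intro y hy h
    by_contra hne
    refine hwx (hS w hw _ h x ?_)
    rw [mul_assoc, inv_mul_cancel_left]
    exact startsWith_letter_mul hx hy hne
  ext z
  constructor
  · rintro ⟨h1 | h1, h⟩
    · by_cases h0 : z.ht = 0
      · exact Or.inr ⟨h1, h0⟩
      · have hpt := z.mem.resolve_left h0
        rcases h.resolve_left h0 with h | h
        · rw [← h1] at h
          exact absurd h (mul_dir_ne z _)
        · rw [h1] at h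
          have hd := key _ z.isLetter h
          exact Or.inl (Or.inr ⟨Or.inr ⟨h1, hd⟩, by rwa [hd, W.wall_inv] at hpt⟩)
    · by_cases h0 : z.ht = 0
      · exact Or.inl (Or.inl ⟨h1, Or.inl h0⟩)
      · have hpt := z.mem.resolve_left h0
        rcases h.resolve_left h0 with h | h
        · have hd := key z.dir⁻¹ z.isLetter.inv (by rwa [← h, mul_inv_cancel_right])
          rw [inv_inj] at hd
          rw [hd] at h hpt
          exact Or.inl (Or.inr ⟨Or.inl ⟨mul_right_cancel h, hd⟩, hpt⟩)
        · exact Or.inl (Or.inl ⟨h1, Or.inr h⟩)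
  · rintro ((⟨h1, h⟩ | ⟨⟨h1, h2⟩ | ⟨h1, h2⟩, -⟩) | ⟨h1, h⟩)
    · exact ⟨Or.inr h1, h.imp_right Or.inr⟩
    · exact ⟨Or.inr (h1 ▸ hw), Or.inr (Or.inl (by rw [h1, h2]))⟩
    · exact ⟨Or.inl h1, Or.inr (Or.inr (by rwa [h1, h2, mul_inv_cancel_right]))⟩
    · exact ⟨Or.inl h1, Or.inl h⟩

/-- To adjoin a vertex to a subtree, glue the strip over the new edge to the part over the subtree,
and then the copy of `X` at the new vertex to the result. -/
theorem CNOn_overSubtree_insert (hX : CNOn (Set.univ : Set X)) {S : Set (FreeGroup ι)}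
    (hS : IsSubtree S) (h : CNOn (overSubtree W S)) {w x : FreeGroup ι}
    (hw : w ∈ S) (hx : IsLetter x) (hwx : w * x ∉ S) :
    CNOn (overSubtree W (insert (w * x) S)) := by
  rw [overSubtree_insert hS hw hx hwx]
  have hnear : ∀ a ∈ overSubtree W S, a ∈ nearSide W w x := by
    intro a ha
    refine ⟨fun hs => hwx (hS w hw _ ha.1 x hs), fun hb hd => ?_⟩
    refine ha.2.resolve_right fun h => hwx ?_
    rwa [hb, hd] at h
  have h1 : CNOn (overSubtree W S ∪ edgePiece W w x) := by
    refine h.union (CNOn_edgePiece w hx) (CNOn_wallPiece w hx)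
      (fun z hz => ⟨hz.1 ▸ hw, Or.inl hz.2.2.1⟩)
      (fun z hz => ⟨Or.inl ⟨hz.1, hz.2.1⟩, hz.2.2.2⟩) fun a ha b hb => ?_
    by_cases hbn : b ∈ nearSide W w x
    · refine ⟨b, ?_, by rw [dist_self, add_zero]⟩
      obtain ⟨⟨h1, h2⟩ | ⟨h1, h2⟩, h3⟩ := hb
      · exact ⟨h1, h2, hbn.2 h1 h2, h3⟩
      · refine absurd ?_ hbn.1
        rw [h1, inv_mul_cancel_left]
        exact startsWith_self hx
    · exact exists_wallPiece_dist hx (hnear a ha) hbn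
  refine h1.union (CNOn_vertexPiece hX (w * x)) (CNOn_wallPiece (w * x) hx.inv)
    (fun z hz => Or.inr ⟨Or.inr ⟨hz.1, hz.2.1⟩, by simpa [W.wall_inv] using hz.2.2.2⟩)
    (fun z hz => ⟨hz.1, hz.2.2.1⟩) fun a ha b hb => ?_
  have hbn : b ∈ nearSide W (w * x) x⁻¹ := by
    refine ⟨?_, fun _ _ => hb.2⟩
    rw [hb.1, inv_mul_cancel]
    exact not_startsWith_one _
  by_cases han : a ∈ nearSide W (w * x) x⁻¹
  · refine ⟨a, ?_, by rw [dist_self, zero_add]⟩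
    rcases ha with ha | ⟨⟨h1, h2⟩ | ⟨h1, h2⟩, h3⟩
    · refine absurd ?_ han.1
      rw [mul_inv_rev, mul_assoc]
      exact startsWith_inv_mul hx (hnear a ha).1
    · refine absurd ?_ han.1
      rw [h1, mul_inv_rev, inv_mul_cancel_right]
      exact startsWith_self hx.inv
    · exact ⟨h1, h2, han.2 h1 h2, by rwa [W.wall_inv]⟩
  · obtain ⟨c, hc, hd⟩ := exists_wallPiece_dist hx.inv hbn han
    exact ⟨c, hc, by rw [dist_comm a b, hd, dist_comm a c, dist_comm b c, add_comm]⟩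

/-- Subtrees over which the inequality of Stewart holds can be enlarged by any vertex. -/
theorem exists_subtree_mem (hX : CNOn (Set.univ : Set X)) (v : FreeGroup ι) :
    ∀ S : Set (FreeGroup ι), ∀ w ∈ S, IsSubtree S → CNOn (overSubtree W S) →
      ∃ S', S ⊆ S' ∧ w * v ∈ S' ∧ IsSubtree S' ∧ CNOn (overSubtree W S') := by
  have letter : ∀ x : FreeGroup ι, IsLetter x →
      ∀ S : Set (FreeGroup ι), ∀ w ∈ S, IsSubtree S → CNOn (overSubtree W S) →
      ∃ S', S ⊆ S' ∧ w * x ∈ S' ∧ IsSubtree S' ∧ CNOn (overSubtree W S') := by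
    intro x hx S w hw hS h
    by_cases hwx : w * x ∈ S
    · exact ⟨S, subset_rfl, hwx, hS, h⟩
    · exact ⟨_, Set.subset_insert _ _, Set.mem_insert _ _, hS.insert hw hx hwx,
        CNOn_overSubtree_insert hX hS h hw hx hwx⟩
  induction v using FreeGroup.induction_on with
  | C1 => exact fun S w hw hS h => ⟨S, subset_rfl, by rwa [mul_one], hS, h⟩
  | of i => exact letter _ (isLetter_of i)
  | inv_of i _ => exact letter _ (isLetter_of i).inv
  | mul u v hu hv =>
    intro S w hw hS h
    obtain ⟨S', h1, h2, h3, h4⟩ := hu S w hw hS h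
    obtain ⟨S'', h1', h2', h3', h4'⟩ := hv S' _ h2 h3 h4
    exact ⟨S'', h1.trans h1', by rwa [← mul_assoc], h3', h4'⟩

theorem exists_subtree_superset (hX : CNOn (Set.univ : Set X)) {F : Set (FreeGroup ι)}
    (hF : F.Finite) :
    ∃ S, F ⊆ S ∧ 1 ∈ S ∧ IsSubtree S ∧ CNOn (overSubtree W S) := by
  induction F, hF using Set.Finite.induction_on with
  | empty =>
    exact ⟨{1}, Set.empty_subset _, rfl, isSubtree_singleton,
      by rw [overSubtree_singleton]; exact CNOn_vertexPiece hX 1⟩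
  | @insert v F _ _ ih =>
    obtain ⟨S, h1, h2, h3, h4⟩ := ih
    obtain ⟨S', h1', h2', h3', h4'⟩ := exists_subtree_mem hX v S 1 h2 h3 h4
    rw [one_mul] at h2'
    exact ⟨S', Set.insert_subset h2' (h1.trans h1'), h1' h2, h3', h4'⟩

end Separation

/-- A tree of spaces is the union of the parts over finite subtrees, which are obtained from a copy
of `X` by gluing strips and copies of `X` along geodesic lines. -/
theorem CNOn_univ (hX : CNOn (Set.univ : Set X)) : CNOn (Set.univ : Set (TreeSpace W)) := by
  classical
  refine CNOn.univ_of_finite fun F hF => ?_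
  obtain ⟨S, h1, -, -, h4⟩ := exists_subtree_superset (W := W) hX
    ((hF.image fun z => z.base).union (hF.image fun z => z.base * z.dir))
  exact ⟨overSubtree W S, fun z hz => ⟨h1 (Or.inl ⟨z, hz, rfl⟩), Or.inr (h1 (Or.inr ⟨z, hz, rfl⟩))⟩,
    h4⟩

end TreeSpace

/-! ### Geometric actions -/

/-- A proper and cocompact action by isometries on a non-empty space in which the inequality of
Stewart holds. -/
structure ActsGeometrically (G X : Type) [Group G] [PseudoMetricSpace X] [MulAction G X] :
    Prop where
  nonempty : Nonempty X
  stewart : CNOn (Set.univ : Set X)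
  dist_smul : ∀ (g : G) (x y : X), dist (g • x) (g • y) = dist x y
  proper : ∀ x : X, ∃ r : ℝ, 0 < r ∧
    {g : G | ((fun z : X => g • z) '' Metric.ball x r ∩ Metric.ball x r).Nonempty}.Finite
  cocompact : ∃ C : Set X, IsCompact C ∧ ∀ x : X, ∃ g : G, ∃ c ∈ C, dist (g • c) x = 0

/-- A group with a geometric action on a metric space that satisfies the inequality of
Stewart. -/
def IsStewartGroup (G : Type) [Group G] : Prop :=
  ∃ (X : Type) (_ : MetricSpace X) (_ : MulAction G X), ActsGeometrically G X

theorem IsStewartGroup.isCAT0Group {G : Type} [Group G] (h : IsStewartGroup G) :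
    IsCAT0Group G := by
  obtain ⟨X, i1, i2, h⟩ := h
  obtain ⟨C, hC, hCX⟩ := h.cocompact
  refine ⟨X, i1, i2, h.nonempty, isCAT0Space_of_CNOn_univ h.stewart, h.dist_smul, h.proper,
    C, hC, fun x => ?_⟩
  obtain ⟨g, c, hc, hd⟩ := hCX x
  exact ⟨g, c, hc, dist_eq_zero.1 hd⟩

theorem IsStewartGroup.congr {G H : Type} [Group G] [Group H] (e : G ≃* H)
    (h : IsStewartGroup G) : IsStewartGroup H := by
  obtain ⟨X, i1, i2, h⟩ := h
  let _ : MulAction H X := MulAction.compHom X e.symm.toMonoidHom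
  have hs : ∀ (g : H) (x : X), g • x = e.symm g • x := fun _ _ => rfl
  refine ⟨X, i1, ‹_›, h.nonempty, h.stewart, fun g => h.dist_smul (e.symm g), fun x => ?_, ?_⟩
  · obtain ⟨r, hr, hf⟩ := h.proper x
    refine ⟨r, hr, (hf.image e).subset ?_⟩
    intro g hg
    exact ⟨e.symm g, hg, e.apply_symm_apply g⟩
  · obtain ⟨C, hC, h⟩ := h.cocompact
    refine ⟨C, hC, fun x => ?_⟩
    obtain ⟨g, c, hc, hg⟩ := h x
    exact ⟨e g, c, hc, by rw [hs, e.symm_apply_apply, hg]⟩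

/-- A geometric action on a pseudometric space descends to its metric quotient. -/
theorem ActsGeometrically.isStewartGroup {G X : Type} [Group G] [PseudoMetricSpace X]
    [MulAction G X] (h : ActsGeometrically G X) : IsStewartGroup G := by
  have : ContinuousConstSMul G X :=
    ⟨fun g => (Isometry.of_dist_eq (h.dist_smul g)).continuous⟩
  let _ : MulAction G (SeparationQuotient X) :=
    Function.Surjective.mulAction SeparationQuotient.mk SeparationQuotient.surjective_mk
      SeparationQuotient.mk_smul
  have hs : ∀ (g : G) (x : X), g • SeparationQuotient.mk x = SeparationQuotient.mk (g • x) :=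
    fun _ _ => rfl
  refine ⟨SeparationQuotient X, inferInstance, ‹_›, ?_, ?_, ?_, ?_, ?_⟩
  · exact h.nonempty.map SeparationQuotient.mk
  · intro p _ q _ t ht
    obtain ⟨p, rfl⟩ := SeparationQuotient.surjective_mk p
    obtain ⟨q, rfl⟩ := SeparationQuotient.surjective_mk q
    obtain ⟨x, -, hx⟩ := h.stewart p trivial q trivial t ht
    refine ⟨SeparationQuotient.mk x, trivial, fun y _ => ?_⟩
    obtain ⟨y, rfl⟩ := SeparationQuotient.surjective_mk y
    have := hx y trivial
    unfold Stewart at *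
    simpa only [SeparationQuotient.dist_mk] using this
  · intro g x y
    obtain ⟨x, rfl⟩ := SeparationQuotient.surjective_mk x
    obtain ⟨y, rfl⟩ := SeparationQuotient.surjective_mk y
    rw [hs, hs, SeparationQuotient.dist_mk, SeparationQuotient.dist_mk, h.dist_smul]
  · intro x
    obtain ⟨x, rfl⟩ := SeparationQuotient.surjective_mk x
    obtain ⟨r, hr, hf⟩ := h.proper x
    refine ⟨r, hr, hf.subset ?_⟩
    rintro g ⟨-, ⟨y, hy, rfl⟩, hy'⟩
    obtain ⟨y, rfl⟩ := SeparationQuotient.surjective_mk y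
    exact ⟨g • y, ⟨y, hy, rfl⟩, hy'⟩
  · obtain ⟨C, hC, h⟩ := h.cocompact
    refine ⟨SeparationQuotient.mk '' C, hC.image SeparationQuotient.continuous_mk, fun x => ?_⟩
    obtain ⟨x, rfl⟩ := SeparationQuotient.surjective_mk x
    obtain ⟨g, c, hc, hd⟩ := h x
    exact ⟨g, _, ⟨c, hc, rfl⟩, by rwa [hs, SeparationQuotient.dist_mk]⟩

namespace TreeSpace

variable {ι X G : Type} [PseudoMetricSpace X] [Group G] [MulAction G X] (W : WallSystem ι X)
  (ψ : G →* MulAut (FreeGroup ι))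

/-- The action on a tree of spaces of the semidirect product of the free group with a group that
permutes the walls. -/
@[reducible]
def mulAction (hψ : ∀ g x, IsLetter x → IsLetter (ψ g x))
    (hW : ∀ (g : G) x p, p ∈ W.wall x → g • p ∈ W.wall (ψ g x)) :
    MulAction (FreeGroup ι ⋊[ψ] G) (TreeSpace W) where
  smul k z := ⟨k.left * ψ k.right z.base, ψ k.right z.dir, hψ _ _ z.isLetter, z.ht, z.ht_nonneg,
    z.ht_le, k.right • z.pt, z.mem.imp_right (hW _ _ _)⟩
  one_smul z := by
    change TreeSpace.mk _ _ _ _ _ _ _ _ = z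
    obtain ⟨b, d, hd, s, h0, h1, p, hp⟩ := z
    congr 1
    · simp
    · simp
    · exact one_smul G p
  mul_smul k l z := by
    change TreeSpace.mk _ _ _ _ _ _ _ _ = TreeSpace.mk _ _ _ _ _ _ _ _
    congr 1
    · change k.left * ψ k.right l.left * ψ (k.right * l.right) z.base =
        k.left * ψ k.right (l.left * ψ l.right z.base)
      simp [mul_assoc]
    · change ψ (k.right * l.right) z.dir = ψ k.right (ψ l.right z.dir)
      simp
    · exact mul_smul k.right l.right z.pt

/-- A tree of spaces inherits a geometric action, if there are compact parts of finitely many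
walls whose translates cover all walls. -/
theorem isStewartGroup [Nonempty ι] (hG : ActsGeometrically G X)
    (hψ : ∀ g x, IsLetter x → IsLetter (ψ g x))
    (hW : ∀ (g : G) x p, p ∈ W.wall x → g • p ∈ W.wall (ψ g x))
    {Λ : Set (FreeGroup ι)} (hΛ : Λ.Finite) (hΛl : ∀ x ∈ Λ, IsLetter x)
    (D : FreeGroup ι → Set X) (hD : ∀ x ∈ Λ, IsCompact (D x)) (hDW : ∀ x ∈ Λ, D x ⊆ W.wall x)
    (hcov : ∀ x, IsLetter x → ∀ p ∈ W.wall x, ∃ g : G, ∃ y ∈ Λ, ∃ q ∈ D y,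
      ψ g y = x ∧ g • q = p) :
    IsStewartGroup (FreeGroup ι ⋊[ψ] G) := by
  let _ := mulAction W ψ hψ hW
  have sb : ∀ (k : FreeGroup ι ⋊[ψ] G) (z : TreeSpace W),
    (k • z).base = k.left * ψ k.right z.base := fun _ _ => rfl
  have sd : ∀ (k : FreeGroup ι ⋊[ψ] G) (z : TreeSpace W),
    (k • z).dir = ψ k.right z.dir := fun _ _ => rfl
  have sh : ∀ (k : FreeGroup ι ⋊[ψ] G) (z : TreeSpace W), (k • z).ht = z.ht := fun _ _ => rfl
  have sp : ∀ (k : FreeGroup ι ⋊[ψ] G) (z : TreeSpace W),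
    (k • z).pt = k.right • z.pt := fun _ _ => rfl
  obtain ⟨i⟩ := ‹Nonempty ι›
  have hstep : ∀ (k : FreeGroup ι ⋊[ψ] G) (z z' : TreeSpace W) r, Step z z' r →
      Step (k • z) (k • z') r := by
    intro k z z' r h
    cases h with
    | vertex h1 h2 h3 =>
      rw [← hG.dist_smul k.right]
      exact .vertex (k • z) (k • z') (by rw [sb, sb, h1]) h2 h3
    | half h1 h2 h3 h4 =>
      rw [← hG.dist_smul k.right]
      exact .half (k • z) (k • z') (by rw [sb, sb, h1]) (by rw [sd, sd, h2])
        (hW _ _ _ h3) (hW _ _ _ h4)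
    | cross h1 h2 h3 h4 =>
      rw [← hG.dist_smul k.right]
      exact .cross (k • z) (k • z') (by rw [sb, sb, sd, h1, map_mul, mul_assoc])
        (by rw [sd, sd, h2, map_inv]) (hW _ _ _ h3) (hW _ _ _ h4)
  have hchain : ∀ (k : FreeGroup ι ⋊[ψ] G) (z z' : TreeSpace W) l, Chain z z' l →
      Chain (k • z) (k • z') l := by
    intro k z z' l h
    induction h with
    | nil z => exact .nil _
    | cons h _ ih => exact .cons (hstep k _ _ _ h) ih
  have hle : ∀ (k : FreeGroup ι ⋊[ψ] G) (z z' : TreeSpace W), dist (k • z) (k • z') ≤ dist z z' :=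
    fun k z z' => le_dist_of_chain fun l h => dist_le_of_chain (hchain k z z' l h)
  refine ActsGeometrically.isStewartGroup (X := TreeSpace W) ⟨?_, CNOn_univ hG.stewart, ?_, ?_, ?_⟩
  · obtain ⟨p⟩ := hG.nonempty
    exact ⟨vert 1 _ (isLetter_of i) p⟩
  · intro k z z'
    refine le_antisymm (hle k z z') ?_
    have := hle k⁻¹ (k • z) (k • z')
    rwa [inv_smul_smul, inv_smul_smul] at this
  · intro z
    obtain ⟨r, hr, hf⟩ := hG.proper z.pt
    -- a small ball meets at most two of the stars of vertices
    have hbase : ∀ z', dist z z' < 1 / 2 → z'.base = z.base ∨ z'.base = z.base * z.dir := by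
      intro z' hz'
      by_contra! hne
      have h1 := (abs_toVertex_sub_le z.base z z').trans_lt hz'
      have h2 := (abs_toVertex_sub_le (z.base * z.dir) z z').trans_lt hz'
      rw [toVertex_of_base rfl, abs_lt] at h1
      rw [toVertex_of_dir rfl, abs_lt] at h2
      have e1 := z.ht_nonneg
      have e2 := z.ht_le
      have e3 := z'.ht_le
      by_cases hd : z'.base * z'.dir = z.base
      · rw [toVertex_of_dir hd] at h1
        have : toVertex (z.base * z.dir) z' = 2 := by
          unfold toVertex
          rw [if_neg hne.2, if_neg]
          rw [hd]
          exact (mul_dir_ne z z.base).symm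
        rw [this] at h2
        linarith [h1.1, h2.1]
      · have : toVertex z.base z' = 2 := by
          unfold toVertex
          rw [if_neg hne.1, if_neg hd]
        rw [this] at h1
        linarith [h1.1]
    refine ⟨min r (1 / 2), lt_min hr (by norm_num), ?_⟩
    set V : Set (FreeGroup ι) := {z.base, z.base * z.dir} with hV
    have hVf : V.Finite := by simp [hV]
    refine ((hf.prod (hVf.prod hVf)).image fun t : G × FreeGroup ι × FreeGroup ι =>
      (⟨t.2.2 * (ψ t.1 t.2.1)⁻¹, t.1⟩ : FreeGroup ι ⋊[ψ] G)).subset ?_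
    rintro k ⟨-, ⟨z', hz', rfl⟩, hkz'⟩
    simp only [Metric.mem_ball, lt_min_iff] at hz' hkz'
    refine ⟨(k.right, z'.base, (k • z').base), ⟨?_, ?_, ?_⟩, ?_⟩
    · exact ⟨k.right • z'.pt, ⟨z'.pt, (dist_pt_le z' z).trans_lt hz'.1, rfl⟩,
        (dist_pt_le (k • z') z).trans_lt hkz'.1⟩
    · rw [dist_comm] at hz'
      exact hbase z' hz'.2
    · rw [dist_comm _ z] at hkz'
      exact hbase _ hkz'.2
    · ext
      · change (k • z').base * (ψ k.right z'.base)⁻¹ = k.left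
        rw [sb, mul_inv_cancel_right]
      · rfl
  · obtain ⟨C, hC, hCX⟩ := hG.cocompact
    -- the half-strip over a compact part of a wall is compact
    have hstrip : ∀ x ∈ Λ, ∃ K : Set (TreeSpace W), IsCompact K ∧
        ∀ z : TreeSpace W, z.base = 1 → z.dir = x → z.pt ∈ D x → z ∈ K := by
      intro x hx
      have : CompactSpace (D x) := isCompact_iff_compactSpace.1 (hD x hx)
      let f : Set.Icc (0 : ℝ) 1 × D x → TreeSpace W := fun t =>
        ⟨1, x, hΛl x hx, t.1, t.1.2.1, t.1.2.2, t.2, Or.inr (hDW x hx t.2.2)⟩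
      have hf : Continuous f := by
        refine (LipschitzWith.of_dist_le_mul (K := 2) fun a b => ?_).continuous
        have h := dist_le_of_step (.half (f a) (f b) rfl rfl (hDW x hx a.2.2) (hDW x hx b.2.2))
        refine h.trans (Real.sqrt_le_left (by positivity) |>.2 ?_)
        change ((a.1 : ℝ) - b.1) ^ 2 + dist (a.2 : X) b.2 ^ 2 ≤ (2 * dist a b) ^ 2
        have e1 : |(a.1 : ℝ) - b.1| ≤ dist a b := le_max_left (dist a.1 b.1) (dist a.2 b.2)
        have e2 : dist (a.2 : X) b.2 ≤ dist a b := le_max_right (dist a.1 b.1) (dist a.2 b.2)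
        have e3 := pow_le_pow_left₀ (abs_nonneg _) e1 2
        have e4 := pow_le_pow_left₀ dist_nonneg e2 2
        rw [sq_abs] at e3
        nlinarith [sq_nonneg (dist a b)]
      refine ⟨Set.range f, isCompact_range hf, ?_⟩
      rintro ⟨b, d, hd, s, h0, h1, p, hp⟩ rfl rfl hq
      exact ⟨(⟨s, h0, h1⟩, ⟨p, hq⟩), rfl⟩
    choose! K hK hKm using hstrip
    have hvert : Continuous fun p : X => vert (W := W) 1 _ (isLetter_of i) p :=
      (Isometry.of_dist_eq fun p q => dist_vertexPiece (w := 1) ⟨rfl, rfl⟩ ⟨rfl, rfl⟩).continuous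
    refine ⟨(fun p : X => vert (W := W) 1 _ (isLetter_of i) p) '' C ∪ ⋃ x ∈ Λ, K x,
      (hC.image hvert).union (hΛ.isCompact_biUnion hK), fun z => ?_⟩
    by_cases h0 : z.ht = 0
    · obtain ⟨g, c, hc, hd⟩ := hCX z.pt
      refine ⟨⟨z.base, g⟩, _, Or.inl ⟨c, hc, rfl⟩, ?_⟩
      have hb : ((⟨z.base, g⟩ : FreeGroup ι ⋊[ψ] G) •
          vert (W := W) 1 _ (isLetter_of i) c).base = z.base := by
        rw [sb]
        simp
      rw [dist_vertexPiece (w := z.base) ⟨hb, rfl⟩ ⟨rfl, h0⟩]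
      exact hd
    · obtain ⟨g, y, hy, q, hq, hgy, hgq⟩ := hcov z.dir z.isLetter z.pt (z.mem.resolve_left h0)
      refine ⟨⟨z.base, g⟩, ⟨1, y, hΛl y hy, z.ht, z.ht_nonneg, z.ht_le, q, Or.inr (hDW y hy hq)⟩,
        Or.inr (Set.mem_biUnion hy (hKm y hy _ rfl rfl hq)), ?_⟩
      have e : (⟨z.base, g⟩ : FreeGroup ι ⋊[ψ] G) • (⟨1, y, hΛl y hy, z.ht, z.ht_nonneg, z.ht_le, q,
          Or.inr (hDW y hy hq)⟩ : TreeSpace W) = z := by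
        obtain ⟨b, d, hd, s, _, _, p, hp⟩ := z
        subst hgy hgq
        change TreeSpace.mk _ _ _ _ _ _ _ _ = TreeSpace.mk _ _ _ _ _ _ _ _
        congr 1
        simp
      rw [e, dist_self]

end TreeSpace

/-! ### Axes -/

namespace ActsGeometrically

variable {G X : Type} [Group G] [MetricSpace X] [MulAction G X] (hG : ActsGeometrically G X)

include hG

theorem exists_div (p q : X) {t : ℝ} (ht : t ∈ Set.Icc (0 : ℝ) 1) :
    ∃ x, (∀ y, Stewart p q t x y) ∧ dist p x = t * dist p q ∧ dist x q = (1 - t) * dist p q := by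
  obtain ⟨x, -, hx⟩ := hG.stewart p trivial q trivial t ht
  have h1 := (hx p trivial).dist_left ht.1
  have h2 := (hx q trivial).dist_right ht.2
  have h3 := dist_triangle p x q
  exact ⟨x, fun y => hx y trivial, by linarith, by linarith⟩

/-- Proper and cocompact actions are metrically proper. -/
theorem finite_dist_le (x : X) (R : ℝ) : {g : G | dist x (g • x) ≤ R}.Finite := by
  obtain ⟨C, hC, hCX⟩ := hG.cocompact
  replace hCX : ∀ x : X, ∃ g : G, ∃ c ∈ C, x = g • c := fun x => by
    obtain ⟨g, c, hc, h⟩ := hCX x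
    exact ⟨g, c, hc, (dist_eq_zero.1 h).symm⟩
  choose r hr hrf using hG.proper
  obtain ⟨δ, hδ, hδC⟩ := lebesgue_number_lemma_of_metric hC (c := fun x : X => Metric.ball x (r x))
    (fun _ => Metric.isOpen_ball) fun x _ => Set.mem_iUnion.2 ⟨x, Metric.mem_ball_self (hr x)⟩
  have hfin : ∀ b ∈ C, {g : G | dist b (g • b) < δ}.Finite := by
    intro b hb
    obtain ⟨i, hi⟩ := hδC b hb
    refine (hrf i).subset fun g hg => ⟨g • b, ⟨b, hi (Metric.mem_ball_self hδ), rfl⟩, hi ?_⟩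
    rw [Metric.mem_ball, dist_comm]
    exact hg
  set ε := δ / 8 with hε
  have hε0 : 0 < ε := by positivity
  have hpair : ∀ a, ∀ b ∈ C, {g : G | dist a (g • b) < 3 * ε}.Finite := by
    intro a b hb
    rcases Set.eq_empty_or_nonempty {g : G | dist a (g • b) < 3 * ε} with h | ⟨g₀, hg₀⟩
    · rw [h]
      exact Set.finite_empty
    · refine ((hfin b hb).image fun k => g₀ * k).subset fun g hg => ⟨g₀⁻¹ * g, ?_, by simp⟩
      simp only [Set.mem_ofPred_eq] at hg₀ hg ⊢
      rw [← hG.dist_smul g₀, smul_smul, mul_inv_cancel_left]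
      have := dist_triangle (g₀ • b) a (g • b)
      rw [dist_comm (g₀ • b) a] at this
      linarith
  have hN : {g : G | ∃ c ∈ C, ∃ c' ∈ C, dist c (g • c') ≤ ε}.Finite := by
    obtain ⟨t, htC, htf, ht⟩ := hC.finite_cover_balls hε0
    refine (htf.biUnion fun a _ => htf.biUnion fun b hb => hpair a b (htC hb)).subset ?_
    rintro g ⟨c, hc, c', hc', h⟩
    obtain ⟨a, ha, hca⟩ := Set.mem_iUnion₂.1 (ht hc)
    obtain ⟨b, hb, hcb⟩ := Set.mem_iUnion₂.1 (ht hc')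
    refine Set.mem_biUnion ha (Set.mem_biUnion hb ?_)
    rw [Metric.mem_ball] at hca hcb
    have h1 := dist_triangle4 a c (g • c') (g • b)
    rw [hG.dist_smul, dist_comm a c] at h1
    rw [Set.mem_ofPred_eq]
    linarith
  -- points at distance at most `n * ε` are reached in `n` small steps
  have hA : ∀ n : ℕ, {g : G | ∃ c ∈ C, dist x (g • c) ≤ n * ε}.Finite := by
    intro n
    induction n with
    | zero =>
      obtain ⟨g₀, c₀, hc₀, rfl⟩ := hCX x
      refine (hN.image fun k => g₀ * k).subset ?_
      rintro g ⟨c, hc, h⟩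
      refine ⟨g₀⁻¹ * g, ⟨c₀, hc₀, c, hc, ?_⟩, by simp⟩
      rw [← hG.dist_smul g₀, smul_smul, mul_inv_cancel_left]
      refine h.trans ?_
      simp [hε0.le]
    | succ n ih =>
      refine ((ih.prod hN).image fun k : G × G => k.1 * k.2).subset ?_
      rintro g ⟨c, hc, h⟩
      obtain ⟨y, -, h1, h2⟩ := hG.exists_div x (g • c) (t := n / (n + 1))
        ⟨by positivity, by rw [div_le_one (by positivity)]; linarith⟩
      obtain ⟨g', c', hc', rfl⟩ := hCX y
      push_cast at h
      refine ⟨(g', g'⁻¹ * g), ⟨⟨c', hc', ?_⟩, ⟨c', hc', c, hc, ?_⟩⟩, by simp⟩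
      · rw [h1]
        calc _ ≤ (n / (n + 1) : ℝ) * ((n + 1) * ε) := by gcongr
          _ = _ := by field_simp
      · rw [← hG.dist_smul g', smul_smul, mul_inv_cancel_left, h2]
        have e : (1 - n / (n + 1) : ℝ) = 1 / (n + 1) := by field_simp; ring
        rw [e]
        calc _ ≤ (1 / (n + 1) : ℝ) * ((n + 1) * ε) := by gcongr
          _ = _ := by field_simp
  obtain ⟨n, hn⟩ := exists_nat_ge (R / ε)
  rw [div_le_iff₀ hε0] at hn
  obtain ⟨g₀, c₀, hc₀, rfl⟩ := hCX x
  refine ((hA n).image fun k => k * g₀⁻¹).subset fun g hg => ⟨g * g₀, ⟨c₀, hc₀, ?_⟩, by simp⟩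
  rw [mul_smul]
  exact hg.trans hn

omit [Group G] [MulAction G X] hG in
/-- The midpoints of two sides of a triangle are at most half as far apart as the ends of the third
side. -/
theorem dist_div_div_le {a b c m m' : X} (hm : ∀ y, Stewart a b (1 / 2) m y)
    (hm' : ∀ y, Stewart b c (1 / 2) m' y) : dist m m' ≤ dist a c / 2 := by
  have h1 := hm m'
  have h2 := hm' a
  have h3 := (hm' b).dist_left (by norm_num)
  unfold Stewart at h1 h2
  have h4 := pow_le_pow_left₀ dist_nonneg h3 2
  rw [dist_comm b m'] at h4
  rw [dist_comm m' a] at h1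
  rw [dist_comm m m']
  refine le_of_sq_le_sq ?_ (by positivity)
  nlinarith

theorem div_smul {p q x : X} {t : ℝ} (hx : ∀ y, Stewart p q t x y) (g : G) (y : X) :
    Stewart (g • p) (g • q) t (g • x) y := by
  have := hx (g⁻¹ • y)
  unfold Stewart at *
  rwa [← hG.dist_smul g, ← hG.dist_smul g (g⁻¹ • y), ← hG.dist_smul g (g⁻¹ • y),
    ← hG.dist_smul g p, smul_inv_smul] at this

omit hG in
theorem div_unique {p q x y : X} {t : ℝ} (ht : t ∈ Set.Icc (0 : ℝ) 1)
    (hx : ∀ y, Stewart p q t x y) (hy : ∀ x, Stewart p q t y x) : x = y :=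
  dist_eq_zero.1 ((hx y).dist_eq_zero ht.1 ht.2 ((hy p).dist_left ht.1) ((hy q).dist_right ht.2))

/-- The midpoint of `p` and `t • p` is fixed by an involution `t`. -/
theorem exists_fixed {t : G} (ht : t * t = 1) : ∃ x : X, t • x = x := by
  obtain ⟨p⟩ := hG.nonempty
  have h2 : (1 / 2 : ℝ) ∈ Set.Icc (0 : ℝ) 1 := ⟨by norm_num, by norm_num⟩
  obtain ⟨x, hx, -, -⟩ := hG.exists_div p (t • p) h2
  refine ⟨x, div_unique (p := t • p) (q := p) h2 ?_ fun y => ?_⟩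
  · have := hG.div_smul hx t
    rwa [smul_smul, ht, one_smul] at this
  · have := (hx y).symm
    norm_num at this ⊢
    exact this

/-- The displacement of `h` attains its minimum on the fixed points of `t`: translate a minimizing
sequence into a compact set, and pass to a limit point `c`. The conjugates of `h` and `t` by the
translating elements displace `c` by a bounded amount, so that they are constant on a subsequence,
and `c` can be translated back. -/
theorem exists_min_displacement (h : G) {t : G} (ht : t * t = 1) :
    ∃ x : X, t • x = x ∧ ∀ y : X, t • y = y → dist x (h • x) ≤ dist y (h • y) := by
  obtain ⟨C, hC, hCX⟩ := hG.cocompact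
  replace hCX : ∀ x : X, ∃ g : G, g • x ∈ C := fun x => by
    obtain ⟨g, c, hc, h⟩ := hCX x
    refine ⟨g⁻¹, ?_⟩
    rwa [← dist_eq_zero.1 h, inv_smul_smul]
  set D : Set ℝ := (fun y : X => dist y (h • y)) '' {y | t • y = y} with hD
  have hDne : D.Nonempty := by
    obtain ⟨x, hx⟩ := hG.exists_fixed ht
    exact ⟨_, x, hx, rfl⟩
  have hDb : BddBelow D := ⟨0, by rintro - ⟨y, -, rfl⟩; exact dist_nonneg⟩
  have hy : ∀ n : ℕ, ∃ y : X, t • y = y ∧ dist y (h • y) < sInf D + 1 / (n + 1) := fun n => by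
    obtain ⟨-, ⟨y, hy, rfl⟩, hlt⟩ := Real.lt_sInf_add_pos hDne (Nat.one_div_pos_of_nat (n := n))
    exact ⟨y, hy, hlt⟩
  choose y hyt hyd using hy
  choose g hg using fun n => hCX (y n)
  obtain ⟨c, -, φ, hφ, hc⟩ := hC.tendsto_subseq hg
  -- the conjugates of `h` and `t` that move the translates take finitely many values
  set N : Set G := {k | dist c (k • c) ≤ sInf D + 3} with hN
  have hNf : N.Finite := hG.finite_dist_le c _
  set u : ℕ → G × G := fun n => (g (φ n) * h * (g (φ n))⁻¹, g (φ n) * t * (g (φ n))⁻¹) with hu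
  set z : ℕ → X := fun n => g (φ n) • y (φ n) with hz
  have hzc : Filter.Tendsto (fun n => dist c (z n)) Filter.atTop (nhds 0) := by
    have := tendsto_iff_dist_tendsto_zero.1 hc
    simpa only [dist_comm c, hz, Function.comp_def] using this
  have huz1 : ∀ n, dist (z n) ((u n).1 • z n) < sInf D + 1 / (φ n + 1) := fun n => by
    have : (u n).1 • z n = g (φ n) • h • y (φ n) := by simp [hu, hz, mul_smul]
    rw [this, hG.dist_smul]
    exact hyd (φ n)
  have huz2 : ∀ n, (u n).2 • z n = z n := fun n => by
    simp [hu, hz, mul_smul, hyt]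
  have hmove : ∀ (k : G) (n : ℕ), dist c (k • c) ≤ dist (z n) (k • z n) + 2 * dist c (z n) := by
    intro k n
    have := dist_triangle4 c (z n) (k • z n) (k • c)
    rw [hG.dist_smul, dist_comm (z n) c] at this
    linarith
  have hD0 : 0 ≤ sInf D := le_csInf hDne (by rintro - ⟨y, -, rfl⟩; exact dist_nonneg)
  have huN : ∀ᶠ n in Filter.atTop, u n ∈ N ×ˢ N := by
    filter_upwards [hzc.eventually_le_const (show (0 : ℝ) < 1 by norm_num)] with n hn
    have h1 : 1 / ((φ n : ℝ) + 1) ≤ 1 := by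
      rw [div_le_one (by positivity)]
      linarith [Nat.cast_nonneg (α := ℝ) (φ n)]
    refine ⟨?_, ?_⟩
    · have := hmove (u n).1 n
      have := huz1 n
      rw [hN, Set.mem_ofPred_eq]
      linarith
    · have := hmove (u n).2 n
      rw [huz2, dist_self] at this
      rw [hN, Set.mem_ofPred_eq]
      linarith
  obtain ⟨v, -, hv⟩ : ∃ v ∈ N ×ˢ N, ∃ᶠ n in Filter.atTop, u n = v := by
    by_contra! hcon
    have := (Filter.eventually_all_finite (hNf.prod hNf)).2 hcon
    obtain ⟨n, h1, h2⟩ := (this.and huN).exists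
    exact h1 _ h2 rfl
  have hv1 : dist c (v.1 • c) ≤ sInf D := by
    have hlim : Filter.Tendsto (fun n : ℕ => sInf D + 1 / ((φ n : ℝ) + 1) + 2 * dist c (z n))
        Filter.atTop (nhds (sInf D + 0 + 2 * 0)) :=
      (tendsto_const_nhds.add ((tendsto_one_div_add_atTop_nhds_zero_nat (𝕜 := ℝ)).comp
        hφ.tendsto_atTop)).add (hzc.const_mul 2)
    rw [add_zero, mul_zero, add_zero] at hlim
    refine ge_of_tendsto_of_frequently hlim (hv.mono fun n hn => ?_)
    rw [← hn]
    have := hmove (u n).1 n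
    have := huz1 n
    linarith
  have hv2 : v.2 • c = c := by
    have hlim := hzc.const_mul 2
    rw [mul_zero] at hlim
    have : dist c (v.2 • c) ≤ 0 := by
      refine ge_of_tendsto_of_frequently hlim (hv.mono fun n hn => ?_)
      have := hmove (u n).2 n
      rwa [huz2, dist_self, zero_add, hn] at this
    exact (dist_le_zero.1 this).symm
  obtain ⟨n, hn⟩ := hv.exists
  have e1 : v.1 • c = g (φ n) • h • (g (φ n))⁻¹ • c := by
    rw [← hn]
    simp [hu, mul_smul]
  have e2 : v.2 • c = g (φ n) • t • (g (φ n))⁻¹ • c := by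
    rw [← hn]
    simp [hu, mul_smul]
  refine ⟨(g (φ n))⁻¹ • c, ?_, fun y hy => ?_⟩
  · rw [hv2] at e2
    nth_rw 2 [e2]
    rw [inv_smul_smul]
  · rw [← hG.dist_smul (g (φ n)), smul_inv_smul, ← e1]
    exact hv1.trans (csInf_le hDb ⟨y, hy, rfl⟩)

/-- An element of infinite order that commutes with an involution `t` acts as a translation on a
geodesic line of fixed points of `t`. -/
theorem exists_axis (h : G) {t : G} (ht : t * t = 1) (hth : t * h = h * t)
    (hinf : Function.Injective fun n : ℤ => h ^ n) :
    ∃ ℓ : ℝ, 0 < ℓ ∧ ∃ γ : ℝ → X, (∀ s u, dist (γ s) (γ u) = ℓ * |s - u|) ∧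
      (∀ s, h • γ s = γ (s + 1)) ∧ ∀ s, t • γ s = γ s := by
  obtain ⟨x, hxt, hmin⟩ := hG.exists_min_displacement h ht
  set ℓ := dist x (h • x) with hℓ
  have hthn : ∀ n : ℤ, t * h ^ n = h ^ n * t := fun n => (show Commute t h from hth).zpow_right n
  have half : (1 / 2 : ℝ) ∈ Set.Icc (0 : ℝ) 1 := ⟨by norm_num, by norm_num⟩
  -- `h ^ (2 ^ n)` displaces the points fixed by `t` at least as far as on an axis of `h`: if `m` is
  -- the midpoint of `y` and `k • y`, then `m` and `k • m` are midpoints of sides of a triangle with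
  -- third side from `y` to `k • k • y`
  have hpow : ∀ n : ℕ, ∀ y : X, t • y = y → 2 ^ n * ℓ ≤ dist y (h ^ (2 ^ n : ℤ) • y) := by
    intro n
    induction n with
    | zero =>
      intro y hy
      simpa using hmin y hy
    | succ n ih =>
      intro y hy
      set k := h ^ (2 ^ n : ℤ) with hk
      have hkk : h ^ (2 ^ (n + 1) : ℤ) = k * k := by rw [hk, ← zpow_add, pow_succ, mul_two]
      obtain ⟨m, hm, -, -⟩ := hG.exists_div y (k • y) half
      have hmt : t • m = m := by
        refine div_unique half ?_ hm
        have := hG.div_smul hm t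
        rwa [smul_smul, hthn, mul_smul, hy] at this
      have h1 := dist_div_div_le hm (hG.div_smul hm k)
      have h2 := ih m hmt
      rw [hkk, mul_smul, pow_succ]
      linarith
  have hℓ0 : 0 ≤ ℓ := dist_nonneg
  have : Nonempty X := ⟨x⟩
  choose! d hd hdl hdr using fun s : ℝ => fun hs : s ∈ Set.Icc (0 : ℝ) 1 =>
    hG.exists_div x (h • x) hs
  set γ : ℝ → X := fun s => h ^ ⌊s⌋ • d (Int.fract s) with hγ
  have hfr : ∀ s : ℝ, Int.fract s ∈ Set.Icc (0 : ℝ) 1 := fun s =>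
    ⟨Int.fract_nonneg s, (Int.fract_lt_one s).le⟩
  have hd0 : d 0 = x := by
    have := hdl 0 ⟨le_rfl, zero_le_one⟩
    rw [zero_mul] at this
    exact (dist_eq_zero.1 this).symm
  have hγn : ∀ n : ℤ, γ n = h ^ n • x := fun n => by simp [hγ, hd0]
  have hh : ∀ s, h • γ s = γ (s + 1) := fun s => by
    simp only [hγ, Int.floor_add_one, Int.fract_add_one, smul_smul]
    rw [add_comm, zpow_add, zpow_one]
  have htγ : ∀ s, t • γ s = γ s := fun s => by
    have : t • d (Int.fract s) = d (Int.fract s) := by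
      refine div_unique (hfr s) ?_ (hd _ (hfr s))
      have := hG.div_smul (hd _ (hfr s)) t
      rwa [smul_smul, hth, mul_smul, hxt] at this
    simp only [hγ, smul_smul, hthn]
    rw [mul_smul, this]
  have hd1 : d 1 = h • x := by
    have := hdr 1 ⟨zero_le_one, le_rfl⟩
    rw [sub_self, zero_mul] at this
    exact dist_eq_zero.1 this
  have hdd : ∀ a ∈ Set.Icc (0 : ℝ) 1, ∀ b ∈ Set.Icc (0 : ℝ) 1, a ≤ b →
      dist (d a) (d b) ≤ ℓ * (b - a) := by
    intro a ha b hb hab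
    have h1 := hd b hb (d a)
    unfold Stewart at h1
    rw [dist_comm (d a) x, hdl a ha, hdr a ha, ← hℓ] at h1
    refine le_of_sq_le_sq (h1.trans_eq ?_) (mul_nonneg hℓ0 (sub_nonneg.2 hab))
    ring
  have hxn : ∀ n : ℕ, dist x (h ^ n • x) ≤ ℓ * n := by
    intro n
    induction n with
    | zero => simp
    | succ n ih =>
      have h1 := dist_triangle x (h ^ n • x) (h ^ (n + 1) • x)
      have h2 : dist (h ^ n • x) (h ^ (n + 1) • x) = ℓ := by
        rw [pow_succ, mul_smul, hG.dist_smul]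
      push_cast
      linarith
  have hle : ∀ s u : ℝ, s ≤ u → dist (γ s) (γ u) ≤ ℓ * (u - s) := by
    intro s u hsu
    have es := Int.floor_add_fract s
    have eu := Int.floor_add_fract u
    rcases eq_or_lt_of_le (Int.floor_le_floor hsu) with hf | hf
    · have : Int.fract s ≤ Int.fract u := by
        rw [← hf] at eu
        linarith
      refine le_trans ?_ ((hdd _ (hfr s) _ (hfr u) this).trans_eq ?_)
      · simp only [hγ, ← hf, hG.dist_smul]
        exact le_rfl
      · rw [← hf] at eu
        congr 1
        linarith
    · obtain ⟨k, hk⟩ := Int.le.dest (Int.add_one_le_of_lt hf)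
      have e1 : dist (γ s) (h ^ (⌊s⌋ + 1) • x) ≤ ℓ * (1 - Int.fract s) := by
        rw [zpow_add, zpow_one, mul_smul, ← hd1]
        simp only [hγ, hG.dist_smul]
        exact hdd _ (hfr s) _ ⟨zero_le_one, le_rfl⟩ (hfr s).2
      have e2 : dist (h ^ (⌊s⌋ + 1) • x) (h ^ ⌊u⌋ • x) ≤ ℓ * k := by
        rw [← hk, zpow_add h (⌊s⌋ + 1), mul_smul, hG.dist_smul, zpow_natCast]
        exact hxn k
      have e3 : dist (h ^ ⌊u⌋ • x) (γ u) ≤ ℓ * Int.fract u := by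
        simp only [hγ, hG.dist_smul]
        rw [← hd0]
        simpa using hdd 0 ⟨le_rfl, zero_le_one⟩ _ (hfr u) (hfr u).1
      have e4 := dist_triangle4 (γ s) (h ^ (⌊s⌋ + 1) • x) (h ^ ⌊u⌋ • x) (γ u)
      have e5 : (⌊u⌋ : ℝ) = ⌊s⌋ + 1 + k := by exact_mod_cast hk.symm
      have e6 : u - s = (1 - Int.fract s) + k + Int.fract u := by linarith
      rw [e6]
      linarith
  have hone : ∀ s u : ℝ, s ≤ u → dist (γ s) (γ u) = ℓ * (u - s) := by
    intro s u hsu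
    refine le_antisymm (hle s u hsu) ?_
    obtain ⟨n, hn⟩ := exists_nat_ge (max (-s) u)
    have hn2 : (n : ℝ) ≤ 2 ^ n := by exact_mod_cast Nat.lt_two_pow_self.le
    have h1 : -(2 : ℝ) ^ n ≤ s := by linarith [le_max_left (-s) u]
    have h2 : u ≤ (2 : ℝ) ^ n := by linarith [le_max_right (-s) u]
    have e1 := hle _ _ h1
    have e2 := hle _ _ h2
    have e3 : 2 * 2 ^ n * ℓ ≤ dist (γ (-(2 : ℝ) ^ n)) (γ ((2 : ℝ) ^ n)) := by
      have a := hpow (n + 1) x hxt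
      have b1 := hγn (-2 ^ n)
      have b2 := hγn (2 ^ n)
      push_cast at b1 b2
      rw [b1, b2, ← hG.dist_smul (h ^ (2 ^ n : ℤ)), smul_smul, smul_smul, ← zpow_add, ← zpow_add,
        add_neg_cancel, zpow_zero, one_smul, ← two_mul]
      rwa [pow_succ' (2 : ℤ), pow_succ' (2 : ℝ)] at a
    have e4 := dist_triangle4 (γ (-(2 : ℝ) ^ n)) (γ s) (γ u) (γ ((2 : ℝ) ^ n))
    linarith
  have hdist : ∀ s u, dist (γ s) (γ u) = ℓ * |s - u| := by
    intro s u
    rcases le_total s u with hsu | hsu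
    · rw [hone s u hsu, abs_of_nonpos (by linarith), neg_sub]
    · rw [dist_comm, hone u s hsu, abs_of_nonneg (by linarith)]
  refine ⟨ℓ, lt_of_le_of_ne hℓ0 fun h0 => ?_, γ, hdist, hh, htγ⟩
  -- otherwise all powers of `h` fix `x`
  refine Set.infinite_range_of_injective hinf ((hG.finite_dist_le x 0).subset ?_)
  rintro - ⟨n, rfl⟩
  have := hdist 0 n
  have h00 := hγn 0
  rw [Int.cast_zero, zpow_zero, one_smul] at h00
  rw [← h0, zero_mul, hγn, h00] at this
  exact this.le

end ActsGeometrically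

/-! ### Homomorphisms from `ℤ × ℤ/2` -/

theorem zxz2_eq (q : ZxZ2) :
    q = t2 ^ (Multiplicative.toAdd q.1) * t1 ^ (Multiplicative.toAdd q.2).val := by
  obtain ⟨a, b⟩ := q
  refine Prod.ext ?_ ?_
  · simp [t1, t2, ← ofAdd_zsmul]
  · simp [t1, t2, ← ofAdd_nsmul]

theorem t1_mul_t1 : t1 * t1 = 1 := by
  ext
  · rfl
  · change Multiplicative.ofAdd ((1 : ZMod 2) + 1) = 1
    rfl

theorem closure_t1_t2 : Subgroup.closure {t1, t2} = (⊤ : Subgroup ZxZ2) := by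
  rw [eq_top_iff]
  intro q _
  rw [zxz2_eq q]
  exact mul_mem (zpow_mem (Subgroup.subset_closure (by simp)) _)
    (pow_mem (Subgroup.subset_closure (by simp)) _)

theorem zxz2_hom_ext {M : Type*} [Monoid M] {f g : ZxZ2 →* M} (h1 : f t1 = g t1)
    (h2 : f t2 = g t2) : f = g := by
  refine MonoidHom.eq_of_eqOn_dense closure_t1_t2 ?_
  rintro x (rfl | rfl)
  · exact h1
  · exact h2

theorem t2_zpow_injective : Function.Injective fun n : ℤ => t2 ^ n := by
  intro a b h
  have := congrArg (fun q : ZxZ2 => Multiplicative.toAdd q.1) h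
  simpa [t2] using this

/-- The homomorphism from `ℤ × ℤ/2` given by an involution `a` and a commuting element `b`. -/
def zxz2Lift {M : Type*} [Group M] (a b : M) (ha : a * a = 1) (hab : Commute a b) : ZxZ2 →* M where
  toFun q := b ^ (Multiplicative.toAdd q.1) * a ^ (Multiplicative.toAdd q.2).val
  map_one' := by simp
  map_mul' q r := by
    have hpow : ∀ x y : ZMod 2, a ^ (x + y).val = a ^ x.val * a ^ y.val := by
      intro x y
      rw [← pow_add, ZMod.val_add, ← pow_mod_orderOf, ← pow_mod_orderOf a (x.val + y.val)]
      have : orderOf a ∣ 2 := orderOf_dvd_of_pow_eq_one (by rw [pow_two, ha])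
      rw [Nat.mod_mod_of_dvd _ this]
    have hc : ∀ (m : ℕ) (n : ℤ), a ^ m * b ^ n = b ^ n * a ^ m := fun m n =>
      (hab.pow_left m).zpow_right n
    simp only [Prod.fst_mul, Prod.snd_mul, toAdd_mul, zpow_add, hpow]
    rw [mul_assoc, mul_assoc, ← mul_assoc (a ^ _) (b ^ _), hc, mul_assoc]

@[simp] theorem zxz2Lift_t1 {M : Type*} [Group M] (a b : M) (ha : a * a = 1) (hab : Commute a b) :
    zxz2Lift a b ha hab t1 = a := by
  change b ^ (0 : ℤ) * a ^ (1 : ZMod 2).val = a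
  rw [ZMod.val_one]
  simp

@[simp] theorem zxz2Lift_t2 {M : Type*} [Group M] (a b : M) (ha : a * a = 1) (hab : Commute a b) :
    zxz2Lift a b ha hab t2 = b := by
  change b ^ (1 : ℤ) * a ^ (0 : ZMod 2).val = b
  simp

/-! ### Free products with centralizing letters -/

section Perm

variable {G : Type} [Group G]

/-- The action of `G` on the free group on `G ⧸ H` that permutes the basis. -/
def permAut (H : Subgroup G) : G →* MulAut (FreeGroup (G ⧸ H)) where
  toFun g := FreeGroup.freeGroupCongr (MulAction.toPerm g)
  map_one' := by
    ext x
    induction x using FreeGroup.induction_on <;> simp_all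
  map_mul' g h := by
    ext x
    induction x using FreeGroup.induction_on <;> simp_all [mul_smul]

theorem permAut_of (H : Subgroup G) (g : G) (c : G ⧸ H) :
    permAut H g (FreeGroup.of c) = FreeGroup.of (g • c) := by
  simp [permAut]

theorem of_ne_inv_of {ι : Type*} (i j : ι) : FreeGroup.of i ≠ (FreeGroup.of j)⁻¹ := by
  classical
  intro h
  have := mk_singleton_injective (a₁ := (i, true)) (a₂ := (j, false)) h
  simp at this

/-- The group obtained by adding to `G` a new letter that centralizes a subgroup isomorphic to
`ℤ × ℤ/2` acts on a tree of spaces: copies of the space of `G`, joined by strips along the axes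
of the conjugates of the subgroup. -/
theorem IsStewartGroup.semidirectProduct_permAut (hG : IsStewartGroup G) (σ : ZxZ2 →* G)
    (hσ : Function.Injective σ) :
    IsStewartGroup (FreeGroup (G ⧸ σ.range) ⋊[permAut σ.range] G) := by
  obtain ⟨X, i1, i2, hG⟩ := hG
  set H := σ.range with hH
  have ht : σ t1 * σ t1 = 1 := by rw [← map_mul, t1_mul_t1, map_one]
  have hth : σ t1 * σ t2 = σ t2 * σ t1 := by rw [← map_mul, mul_comm, map_mul]
  have hinf : Function.Injective fun n : ℤ => σ t2 ^ n := by
    intro a b h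
    simp only [← map_zpow] at h
    exact t2_zpow_injective (hσ h)
  obtain ⟨ℓ, hℓ, γ, hγ, h1, h2⟩ := hG.exists_axis (σ t2) ht hth hinf
  have h1n : ∀ (n : ℤ) s, σ t2 ^ n • γ s = γ (s + n) := by
    intro n s
    induction n using Int.induction_on with
    | zero => simp
    | succ n ih =>
      rw [add_comm (n : ℤ), zpow_add, zpow_one, mul_smul, ih, h1]
      push_cast
      congr 1
      ring
    | pred n ih =>
      rw [sub_eq_neg_add, zpow_add, zpow_neg_one, mul_smul, ih, inv_smul_eq_iff, h1]
      push_cast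
      congr 1
      ring
  have h2n : ∀ (n : ℕ) s, σ t1 ^ n • γ s = γ s := by
    intro n s
    induction n with
    | zero => simp
    | succ n ih => rw [pow_succ, mul_smul, h2, ih]
  have hHγ : ∀ g ∈ H, ∀ s, ∃ s', g • γ s = γ s' := by
    rintro - ⟨q, rfl⟩ s
    rw [zxz2_eq q, map_mul, map_zpow, map_pow, mul_smul, h2n, h1n]
    exact ⟨_, rfl⟩
  let W : WallSystem (G ⧸ H) X :=
    { wall := fun x => {p | ∃ (g : G) (s : ℝ), p = g • γ s ∧
        (x = FreeGroup.of (g : G ⧸ H) ∨ x = (FreeGroup.of (g : G ⧸ H))⁻¹)}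
      wall_inv := fun x => by
        ext p
        change (∃ (g : G) (s : ℝ), _) ↔ ∃ (g : G) (s : ℝ), _
        refine exists_congr fun g => exists_congr fun s => and_congr_right fun _ => ?_
        rw [inv_eq_iff_eq_inv, inv_inj, or_comm]
      line := fun x hx => by
        obtain ⟨c, hc⟩ := isLetter_iff.1 hx
        obtain ⟨g, rfl⟩ := QuotientGroup.mk_surjective c
        refine ⟨ℓ, hℓ, fun s => g • γ s, fun s t => by rw [hG.dist_smul, hγ], ?_⟩
        ext p
        constructor
        · rintro ⟨s, rfl⟩
          exact ⟨g, s, rfl, hc⟩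
        · rintro ⟨g', s, rfl, hg'⟩
          have hgg : (g : G ⧸ H) = (g' : G ⧸ H) := by
            rcases hc with rfl | rfl <;> rcases hg' with h | h
            · exact FreeGroup.of_injective h
            · exact absurd h (of_ne_inv_of _ _)
            · exact absurd h.symm (of_ne_inv_of _ _)
            · exact FreeGroup.of_injective (inv_inj.1 h)
          obtain ⟨s', hs'⟩ := hHγ _ (QuotientGroup.eq.1 hgg) s
          refine ⟨s', ?_⟩
          change g • γ s' = g' • γ s
          rw [← hs', smul_smul, mul_inv_cancel_left] }
  have hletter : ∀ (g : G) (x : FreeGroup (G ⧸ H)), IsLetter x →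
      IsLetter (permAut H g x) := by
    intro g x hx
    obtain ⟨c, rfl | rfl⟩ := isLetter_iff.1 hx
    · rw [permAut_of]
      exact isLetter_of _
    · rw [map_inv, permAut_of]
      exact (isLetter_of _).inv
  have hcont : Continuous γ :=
    (LipschitzWith.of_dist_le_mul (K := ⟨ℓ, hℓ.le⟩) fun s t => (hγ s t).le).continuous
  have : Nonempty (G ⧸ H) := ⟨((1 : G) : G ⧸ H)⟩
  refine TreeSpace.isStewartGroup W (permAut H) hG hletter ?_
    (Λ := {FreeGroup.of ((1 : G) : G ⧸ H), (FreeGroup.of ((1 : G) : G ⧸ H))⁻¹})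
    (by simp) ?_ (fun _ => γ '' Set.Icc 0 1) (fun _ _ => isCompact_Icc.image hcont) ?_ ?_
  · rintro g x - ⟨g', s, rfl, h⟩
    refine ⟨g * g', s, by rw [mul_smul], ?_⟩
    rcases h with rfl | rfl
    · exact Or.inl (permAut_of H g _)
    · exact Or.inr (by rw [map_inv, permAut_of]; rfl)
  · rintro x (rfl | rfl)
    · exact isLetter_of _
    · exact (isLetter_of _).inv
  · rintro x hx - ⟨s, -, rfl⟩
    exact ⟨1, s, by rw [one_smul], hx⟩
  · rintro x - - ⟨g, s, rfl, h⟩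
    have hcoset : (g * σ t2 ^ ⌊s⌋) • ((1 : G) : G ⧸ H) = (g : G ⧸ H) := by
      change ((g * σ t2 ^ ⌊s⌋ * 1 : G) : G ⧸ H) = g
      rw [mul_one, QuotientGroup.mk_mul_of_mem _ (show σ t2 ^ ⌊s⌋ ∈ H from
        zpow_mem (MonoidHom.mem_range.2 ⟨t2, rfl⟩) _)]
    have hpt : (g * σ t2 ^ ⌊s⌋) • γ (Int.fract s) = g • γ s := by
      rw [mul_smul, h1n, Int.fract_add_floor]
    rcases h with rfl | rfl
    · exact ⟨_, _, Or.inl rfl, _, ⟨_, ⟨Int.fract_nonneg s, (Int.fract_lt_one s).le⟩, rfl⟩,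
        by rw [permAut_of, hcoset], hpt⟩
    · exact ⟨_, _, Or.inr rfl, _, ⟨_, ⟨Int.fract_nonneg s, (Int.fract_lt_one s).le⟩, rfl⟩,
        by rw [map_inv, permAut_of, hcoset], hpt⟩

end Perm

/-! ### Adding the last letter -/

theorem inr_mul_inl_mul_inv {N Q : Type*} [Group N] [Group Q] {φ : Q →* MulAut N} (q : Q) (x : N) :
    (SemidirectProduct.inr q * SemidirectProduct.inl x * (SemidirectProduct.inr q)⁻¹ : N ⋊[φ] Q) =
      SemidirectProduct.inl (φ q x) := by
  rw [← map_inv, ← SemidirectProduct.inl_aut]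

section LastLetter

variable {n : ℕ} (η : ZxZ2 →* Hol (FreeGp n))

/-- The action on `F_n` that underlies a homomorphism to `Hol(F_n)`. -/
def holAct : ZxZ2 →* MulAut (FreeGp n) := SemidirectProduct.rightHom.comp η

/-- The section `q ↦ (c, q)` of `F_n ⋊ (ℤ × ℤ/2)` given by a homomorphism to `Hol(F_n)`. Its image
is the subgroup that the last letter of `F_{n+1}` centralizes. -/
def holSection : ZxZ2 →* FreeGp n ⋊[holAct η] ZxZ2 where
  toFun q := ⟨(η q).left, q⟩
  map_one' := by
    refine SemidirectProduct.ext ?_ rfl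
    rw [map_one]
    rfl
  map_mul' q r := by
    refine SemidirectProduct.ext ?_ rfl
    rw [map_mul]
    rfl

theorem holSection_injective : Function.Injective (holSection η) := fun _ _ h =>
  congrArg SemidirectProduct.right h

/-- The inclusion of `F_n ⋊ (ℤ × ℤ/2)` in `F_{n+1} ⋊ (ℤ × ℤ/2)`. -/
def lastLetterIncl : FreeGp n ⋊[holAct η] ZxZ2 →* FreeGp (n + 1) ⋊[(holEmb n).comp η] ZxZ2 :=
  SemidirectProduct.map (freeIncl n) (MonoidHom.id _) fun q =>
    MonoidHom.ext fun w => (holEnd_incl (η q) w).symm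

theorem lastLetterIncl_comm (q : ZxZ2) :
    Commute (lastLetterIncl η (holSection η q)) (SemidirectProduct.inl (gen (Fin.last n))) := by
  refine SemidirectProduct.ext ?_ ?_
  · change freeIncl n (η q).left * holEnd (η q) (gen (Fin.last n)) =
      gen (Fin.last n) * (holEmb n (η 1)) (freeIncl n (η q).left)
    rw [holEnd_last, map_one, map_one]
    simp [mul_assoc]
  · change q * 1 = 1 * q
    rw [mul_one, one_mul]

/-- The conjugates of the last letter by the elements of `F_n ⋊ (ℤ × ℤ/2)`. -/
def lastLetterConj :
    (FreeGp n ⋊[holAct η] ZxZ2) ⧸ (holSection η).range → FreeGp (n + 1) ⋊[(holEmb n).comp η] ZxZ2 :=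
  Quotient.lift (fun g => lastLetterIncl η g * SemidirectProduct.inl (gen (Fin.last n)) *
    (lastLetterIncl η g)⁻¹) fun a b hab => by
      obtain ⟨q, hq⟩ := QuotientGroup.leftRel_apply.1 hab
      have hb : b = a * holSection η q := by rw [hq, mul_inv_cancel_left]
      simp only [hb, map_mul, mul_inv_rev]
      rw [mul_assoc (lastLetterIncl η a) (lastLetterIncl η _), (lastLetterIncl_comm η q).eq]
      group

/-- The last letter and its conjugates generate a free group with a basis permuted by
`F_n ⋊ (ℤ × ℤ/2)`; this is the homomorphism to `F_{n+1} ⋊ (ℤ × ℤ/2)`. -/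
def ofTree : FreeGroup ((FreeGp n ⋊[holAct η] ZxZ2) ⧸ (holSection η).range)
    ⋊[permAut (holSection η).range] (FreeGp n ⋊[holAct η] ZxZ2) →*
    FreeGp (n + 1) ⋊[(holEmb n).comp η] ZxZ2 :=
  SemidirectProduct.lift (FreeGroup.lift (lastLetterConj η)) (lastLetterIncl η) fun g => by
    ext c : 1
    obtain ⟨a, rfl⟩ := QuotientGroup.mk_surjective c
    change FreeGroup.lift _ (permAut _ g (FreeGroup.of _)) =
      lastLetterIncl η g * FreeGroup.lift _ (FreeGroup.of _) * (lastLetterIncl η g)⁻¹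
    rw [permAut_of, FreeGroup.lift_apply_of, FreeGroup.lift_apply_of]
    change lastLetterIncl η (g * a) * _ * (lastLetterIncl η (g * a))⁻¹ =
      lastLetterIncl η g * (lastLetterIncl η a * _ * (lastLetterIncl η a)⁻¹) *
        (lastLetterIncl η g)⁻¹
    rw [map_mul]
    group

/-- The restriction to `F_{n+1}` of the inverse of `ofTree`. -/
def toTreeFree : FreeGp (n + 1) →* FreeGroup ((FreeGp n ⋊[holAct η] ZxZ2) ⧸ (holSection η).range)
    ⋊[permAut (holSection η).range] (FreeGp n ⋊[holAct η] ZxZ2) :=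
  FreeGroup.lift (Fin.lastCases
    (SemidirectProduct.inl (FreeGroup.of ((1 : FreeGp n ⋊[holAct η] ZxZ2) : _ ⧸ _)))
    fun l => SemidirectProduct.inr (SemidirectProduct.inl (gen l)))

theorem toTreeFree_last : toTreeFree η (gen (Fin.last n)) =
    SemidirectProduct.inl (FreeGroup.of ((1 : FreeGp n ⋊[holAct η] ZxZ2) : _ ⧸ _)) := by
  simp [toTreeFree, gen]

theorem toTreeFree_incl (w : FreeGp n) : toTreeFree η (freeIncl n w) =
    SemidirectProduct.inr (SemidirectProduct.inl w) := by
  have : (toTreeFree η).comp (freeIncl n) =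
      SemidirectProduct.inr.comp SemidirectProduct.inl := by
    ext l : 1
    simp [toTreeFree, freeIncl, gen]
  exact DFunLike.congr_fun this w

theorem freeGp_succ_hom_ext' {M : Type*} [Group M] {f g : FreeGp (n + 1) →* M}
    (h1 : ∀ w : FreeGp n, f (freeIncl n w) = g (freeIncl n w))
    (h2 : f (gen (Fin.last n)) = g (gen (Fin.last n))) : f = g := by
  ext l
  refine Fin.lastCases ?_ (fun l => ?_) l
  · exact h2
  · simpa [freeIncl] using h1 (FreeGroup.of l)

/-- The inverse of `ofTree`. -/
def toTree : FreeGp (n + 1) ⋊[(holEmb n).comp η] ZxZ2 →*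
    FreeGroup ((FreeGp n ⋊[holAct η] ZxZ2) ⧸ (holSection η).range)
    ⋊[permAut (holSection η).range] (FreeGp n ⋊[holAct η] ZxZ2) :=
  SemidirectProduct.lift (toTreeFree η) (SemidirectProduct.inr.comp SemidirectProduct.inr)
    fun q => by
      apply freeGp_succ_hom_ext'
      · intro w
        change toTreeFree η (holEnd (η q) (freeIncl n w)) =
          SemidirectProduct.inr (SemidirectProduct.inr q) * toTreeFree η (freeIncl n w) *
            (SemidirectProduct.inr (SemidirectProduct.inr q))⁻¹
        rw [holEnd_incl, toTreeFree_incl, toTreeFree_incl, ← map_inv, ← map_mul, ← map_mul,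
          inr_mul_inl_mul_inv]
        rfl
      · change toTreeFree η (holEnd (η q) (gen (Fin.last n))) =
          SemidirectProduct.inr (SemidirectProduct.inr q) * toTreeFree η (gen (Fin.last n)) *
            (SemidirectProduct.inr (SemidirectProduct.inr q))⁻¹
        rw [holEnd_last, map_mul, map_mul, map_inv, toTreeFree_incl, toTreeFree_last,
          inr_mul_inl_mul_inv, permAut_of]
        nth_rw 2 [← inv_inv (SemidirectProduct.inr (SemidirectProduct.inl (η q).left))]
        rw [← map_inv, ← map_inv, inr_mul_inl_mul_inv, permAut_of]
        congr 2
        refine QuotientGroup.eq.2 ⟨q, ?_⟩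
        refine SemidirectProduct.ext ?_ ?_ <;> simp [holSection]

theorem toTree_comp_ofTree : (toTree η).comp (ofTree η) = MonoidHom.id _ := by
  have h : (toTree η).comp (lastLetterIncl η) = SemidirectProduct.inr := by
    apply SemidirectProduct.hom_ext
    · ext w : 1
      simp [toTree, lastLetterIncl, toTreeFree, gen, freeIncl]
    · ext q : 1
      simp [toTree, lastLetterIncl]
  have h' : ∀ g, toTree η (lastLetterIncl η g) = SemidirectProduct.inr g := DFunLike.congr_fun h
  apply SemidirectProduct.hom_ext
  · ext c : 1
    obtain ⟨a, rfl⟩ := QuotientGroup.mk_surjective c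
    change toTree η (ofTree η (SemidirectProduct.inl (FreeGroup.of _))) = _
    rw [ofTree, SemidirectProduct.lift_inl, FreeGroup.lift_apply_of]
    change toTree η (lastLetterIncl η a * _ * (lastLetterIncl η a)⁻¹) = _
    rw [map_mul, map_mul, map_inv, h', toTree, SemidirectProduct.lift_inl, toTreeFree_last,
      inr_mul_inl_mul_inv, permAut_of]
    change SemidirectProduct.inl (FreeGroup.of ((a * 1 : FreeGp n ⋊[holAct η] ZxZ2) :
      (FreeGp n ⋊[holAct η] ZxZ2) ⧸ (holSection η).range)) = _
    rw [mul_one]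
    rfl
  · ext g : 1
    change toTree η (ofTree η (SemidirectProduct.inr g)) = _
    rw [ofTree, SemidirectProduct.lift_inr, h']
    rfl

theorem ofTree_comp_toTree : (ofTree η).comp (toTree η) = MonoidHom.id _ := by
  apply SemidirectProduct.hom_ext
  · apply freeGp_succ_hom_ext'
    · intro w
      simp [toTree, ofTree, toTreeFree_incl, lastLetterIncl]
    · change ofTree η (toTree η (SemidirectProduct.inl _)) = _
      rw [toTree, SemidirectProduct.lift_inl, toTreeFree_last, ofTree, SemidirectProduct.lift_inl,
        FreeGroup.lift_apply_of]
      change lastLetterIncl η 1 * _ * (lastLetterIncl η 1)⁻¹ = _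
      rw [map_one, one_mul, inv_one, mul_one]
      rfl
  · ext q : 1
    simp [toTree, ofTree, lastLetterIncl]

/-- The inductive step: the last letter of `F_{n+1}` centralizes a subgroup of
`F_n ⋊ (ℤ × ℤ/2)` that is isomorphic to `ℤ × ℤ/2`. -/
theorem isStewartGroup_holEmb (h : IsStewartGroup (FreeGp n ⋊[holAct η] ZxZ2)) :
    IsStewartGroup (FreeGp (n + 1) ⋊[(holEmb n).comp η] ZxZ2) :=
  (h.semidirectProduct_permAut (holSection η) (holSection_injective η)).congr
    (MonoidHom.toMulEquiv (ofTree η) (toTree η) (toTree_comp_ofTree η) (ofTree_comp_toTree η))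

end LastLetter

/-! ### Automorphisms of `F_2` that commute with the inversion of a basis element -/

section Inversion

variable {ι : Type*}

theorem mk_cons (a : ι × Bool) (L : List (ι × Bool)) :
    FreeGroup.mk (a :: L) = FreeGroup.mk [a] * FreeGroup.mk L := by
  rw [FreeGroup.mul_mk]
  rfl

/-- The letter inverse to a given one. -/
def invLetter (a : ι × Bool) : ι × Bool := (a.1, !a.2)

theorem inv_mk_singleton (a : ι × Bool) :
    (FreeGroup.mk [a])⁻¹ = FreeGroup.mk [invLetter a] := by
  simp [FreeGroup.inv_mk, FreeGroup.invRev, invLetter]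

theorem mk_mem_zpowers {j : ι} {L : List (ι × Bool)} (h : ∀ a ∈ L, a.1 = j) :
    FreeGroup.mk L ∈ Subgroup.zpowers (FreeGroup.of j) := by
  induction L with
  | nil => exact one_mem _
  | cons a L ih =>
    rw [mk_cons]
    refine mul_mem ?_ (ih fun b hb => h b (List.mem_cons_of_mem _ hb))
    obtain ⟨l, b⟩ := a
    obtain rfl : l = j := h _ List.mem_cons_self
    cases b
    · exact inv_mem (Subgroup.mem_zpowers (FreeGroup.of l))
    · exact Subgroup.mem_zpowers _

theorem zpow_of_injective (j : ι) : Function.Injective fun n : ℤ => FreeGroup.of j ^ n := by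
  intro a b h
  have := congrArg (FreeGroup.lift fun _ => Multiplicative.ofAdd (1 : ℤ)) h
  simpa [← ofAdd_zsmul] using this

variable [DecidableEq ι]

/-- The letter `a` with its sign changed if it is the letter `i` or its inverse. -/
def flipAt (i : ι) (a : ι × Bool) : ι × Bool := if a.1 = i then (a.1, !a.2) else a

theorem flipAt_fst (i : ι) (a : ι × Bool) : (flipAt i a).1 = a.1 := by
  unfold flipAt
  split_ifs <;> rfl

theorem flipAt_eq_self {i : ι} {a : ι × Bool} (h : a.1 ≠ i) : flipAt i a = a := if_neg h

theorem flipAt_eq_invLetter {i : ι} {a : ι × Bool} (h : a.1 = i) : flipAt i a = invLetter a :=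
  if_pos h

variable {i : ι} {τ : FreeGroup ι →* FreeGroup ι}

theorem map_mk_flipAt (h1 : τ (FreeGroup.of i) = (FreeGroup.of i)⁻¹)
    (h2 : ∀ l, l ≠ i → τ (FreeGroup.of l) = FreeGroup.of l) (L : List (ι × Bool)) :
    τ (FreeGroup.mk L) = FreeGroup.mk (L.map (flipAt i)) := by
  have h : ∀ a : ι × Bool, τ (FreeGroup.mk [a]) = FreeGroup.mk [flipAt i a] := by
    rintro ⟨l, b⟩
    have hl : τ (FreeGroup.mk [(l, true)]) = FreeGroup.mk [flipAt i (l, true)] := by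
      by_cases hl : l = i
      · subst hl
        rw [flipAt_eq_invLetter (i := l) (a := (l, true)) rfl]
        exact h1
      · rw [flipAt_eq_self hl]
        exact h2 l hl
    cases b
    · have := congrArg (·⁻¹) hl
      simp only [← map_inv, inv_mk_singleton] at this
      change τ (FreeGroup.mk [(l, false)]) = _ at this
      rw [this]
      by_cases hl : l = i
      · rw [flipAt_eq_invLetter hl, flipAt_eq_invLetter hl]
        rfl
      · rw [flipAt_eq_self hl, flipAt_eq_self hl]
        rfl
    · exact hl
  induction L with
  | nil => exact map_one τ
  | cons a L ih => rw [mk_cons, map_mul, ih, h, List.map_cons, ← mk_cons]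

theorem isReduced_map_flipAt {L : List (ι × Bool)} (hL : FreeGroup.IsReduced L) :
    FreeGroup.IsReduced (L.map (flipAt i)) := by
  unfold FreeGroup.IsReduced at *
  rw [List.isChain_map]
  refine hL.imp fun a b hab h => ?_
  rw [flipAt_fst, flipAt_fst] at h
  have := Prod.ext h (hab h)
  rw [this]

/-- An element fixed by the inversion of `x_i` does not involve `x_i`. -/
theorem mem_zpowers_of_fixed {j : ι} (hj : ∀ l, l ≠ i → l = j)
    (h1 : τ (FreeGroup.of i) = (FreeGroup.of i)⁻¹)
    (h2 : ∀ l, l ≠ i → τ (FreeGroup.of l) = FreeGroup.of l) {x : FreeGroup ι} (hx : τ x = x) :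
    x ∈ Subgroup.zpowers (FreeGroup.of j) := by
  have h := congrArg FreeGroup.toWord hx
  rw [← FreeGroup.mk_toWord (x := x), map_mk_flipAt h1 h2, FreeGroup.toWord_mk,
    (isReduced_map_flipAt FreeGroup.isReduced_toWord).reduce_eq, FreeGroup.mk_toWord] at h
  rw [← FreeGroup.mk_toWord (x := x)]
  refine mk_mem_zpowers fun a ha => hj _ fun hai => ?_
  have := List.map_inj_left.1 (h.trans (List.map_id _).symm) a ha
  rw [flipAt_eq_invLetter hai] at this
  have := congrArg Prod.snd this
  simp [invLetter] at this

/-- An element that the inversion of `x_i` maps to its inverse is a conjugate of one whose reduced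
word begins and ends with the same power of `x_i`: as long as the first letter is another one,
the last letter is its inverse, and the two can be cancelled by a conjugation. -/
theorem exists_conj_of_inverted {j : ι} (hj : ∀ l, l ≠ i → l = j) (L : List (ι × Bool))
    (hL : FreeGroup.IsReduced L) (h : L.map (flipAt i) = (L.map invLetter).reverse) :
    FreeGroup.mk L = 1 ∨ ∃ (p : ℤ) (a : ι × Bool) (L' : List (ι × Bool)), a.1 = i ∧
      FreeGroup.IsReduced L' ∧ L'.head? = some a ∧ L'.getLast? = some a ∧
      FreeGroup.mk L = FreeGroup.of j ^ p * FreeGroup.mk L' * FreeGroup.of j ^ (-p) := by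
  induction hn : L.length using Nat.strong_induction_on generalizing L with
  | _ n ih =>
  subst hn
  rcases L with _ | ⟨x, L⟩
  · exact Or.inl rfl
  rcases L.eq_nil_or_concat with rfl | ⟨M, y, rfl⟩
  · right
    refine ⟨0, x, [x], ?_, hL, rfl, rfl, by simp⟩
    by_contra hx
    simp [flipAt_eq_self hx, invLetter, Prod.ext_iff] at h
  have hxy : flipAt i x = invLetter y := by
    have := congrArg List.head? h
    simpa using this
  have hM : M.map (flipAt i) = (M.map invLetter).reverse := by
    have := congrArg (fun l => l.tail.dropLast) h
    simpa using this
  have hfst : x.1 = y.1 := by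
    have := congrArg Prod.fst hxy
    rwa [flipAt_fst] at this
  by_cases hx : x.1 = i
  · right
    have : x = y := by
      rw [flipAt_eq_invLetter hx] at hxy
      refine Prod.ext hfst ?_
      simpa [invLetter] using congrArg Prod.snd hxy
    subst this
    refine ⟨0, x, _, hx, hL, rfl, ?_, by simp⟩
    simp [List.getLast?_cons]
  · rw [flipAt_eq_self hx] at hxy
    have hy : FreeGroup.mk [y] = (FreeGroup.mk [x])⁻¹ := by
      rw [hxy, ← inv_mk_singleton, inv_inv]
    have hmk : FreeGroup.mk (x :: M.concat y) =
        FreeGroup.mk [x] * FreeGroup.mk M * (FreeGroup.mk [x])⁻¹ := by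
      rw [← hy, FreeGroup.mul_mk, FreeGroup.mul_mk]
      simp
    have hMr : FreeGroup.IsReduced M := hL.infix ⟨[x], [y], by simp⟩
    rcases ih M.length (by simp) M hMr hM rfl with h0 | ⟨p, a, L', ha, hr, hd, hl, hp⟩
    · left
      rw [hmk, h0, mul_one, mul_inv_cancel]
    · right
      obtain ⟨q, hq⟩ := Subgroup.mem_zpowers_iff.1
        (mk_mem_zpowers (L := [x]) (j := j) fun a ha => by
          rw [List.mem_singleton.1 ha]
          exact hj _ hx)
      refine ⟨q + p, a, L', ha, hr, hd, hl, ?_⟩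
      rw [hmk, hp, ← hq]
      group

/-- If `x_i ↦ u`, `x_j ↦ x_j` is a surjective endomorphism and the reduced word of `u` begins and
ends with the same power `x_i ^ {±1}`, then `u` is that power: the endomorphism maps reduced words
to reduced words, so that it does not decrease the length. -/
theorem eq_singleton_of_surjective {j : ι} (hj : ∀ l, l ≠ i → l = j) {a : ι × Bool} (ha : a.1 = i)
    {L' : List (ι × Bool)} (hr : FreeGroup.IsReduced L') (hd : L'.head? = some a)
    (hl : L'.getLast? = some a) {β : FreeGroup ι →* FreeGroup ι}
    (h1 : β (FreeGroup.of i) = FreeGroup.mk L') (h2 : i ≠ j)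
    (h3 : β (FreeGroup.of j) = FreeGroup.of j) (hs : ∃ g, β g = FreeGroup.of i) :
    L' = [a] := by
  let B : ι × Bool → List (ι × Bool) := fun x =>
    if x.1 = i then (if x.2 then L' else FreeGroup.invRev L') else [x]
  let e : ι × Bool → ι × Bool := fun x =>
    if x.1 = i then (if x.2 then a else invLetter a) else x
  have hL' : L' ≠ [] := by
    rintro rfl
    simp at hd
  have hBmk : ∀ x, β (FreeGroup.mk [x]) = FreeGroup.mk (B x) := by
    rintro ⟨l, b⟩
    by_cases hx : l = i
    · subst hx
      cases b
      · have : FreeGroup.mk [(l, false)] = (FreeGroup.of l)⁻¹ := rfl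
        simp [B, this, h1, FreeGroup.inv_mk]
      · simp only [B, if_true]
        exact h1
    · obtain rfl := hj l hx
      cases b
      · have : FreeGroup.mk [(l, false)] = (FreeGroup.of l)⁻¹ := rfl
        simp [B, this, h3, hx]
      · simp only [B, if_neg hx]
        exact h3
  have hBmk' : ∀ L, β (FreeGroup.mk L) = FreeGroup.mk (L.map B).flatten := by
    intro L
    induction L with
    | nil => exact map_one β
    | cons x L ih =>
      rw [mk_cons, map_mul, ih, hBmk, FreeGroup.mul_mk]
      rfl
  have hB0 : ∀ x, B x ≠ [] := by
    intro x
    simp only [B]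
    split_ifs
    · exact hL'
    · intro h
      have := congrArg List.length h
      rw [FreeGroup.invRev_length] at this
      exact hL' (List.length_eq_zero_iff.1 this)
    · simp
  have hBr : ∀ x, FreeGroup.IsReduced (B x) := by
    intro x
    simp only [B]
    split_ifs
    · exact hr
    · rw [FreeGroup.isReduced_iff_reduce_eq, FreeGroup.reduce_invRev, hr.reduce_eq]
    · exact FreeGroup.IsReduced.singleton
  have hBd : ∀ x, (B x).head? = some (e x) := by
    intro x
    simp only [B, e]
    split_ifs
    · exact hd
    · simp [FreeGroup.invRev, hl, invLetter]
    · rfl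
  have hBl : ∀ x, (B x).getLast? = some (e x) := by
    intro x
    simp only [B, e]
    split_ifs
    · exact hl
    · simp [FreeGroup.invRev, hd, invLetter]
    · rfl
  have hefst : ∀ x, (e x).1 = x.1 := by
    intro x
    simp only [e]
    split_ifs with h
    · rw [ha, h]
    · rw [h]
      exact ha
    · rfl
  have hflat : ∀ L, FreeGroup.IsReduced L → FreeGroup.IsReduced (L.map B).flatten := by
    intro L hL
    refine (List.isChain_flatten ?_).2 ⟨?_, ?_⟩
    · intro h
      obtain ⟨x, -, hx⟩ := List.mem_map.1 h
      exact hB0 x hx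
    · intro l hl
      obtain ⟨x, -, rfl⟩ := List.mem_map.1 hl
      exact hBr x
    · rw [List.isChain_map]
      refine List.IsChain.imp (fun x y hxy => ?_) hL
      rw [hBd, hBl]
      rintro _ ⟨⟩ _ ⟨⟩ h
      rw [hefst, hefst] at h
      rw [Prod.ext h (hxy h)]
  obtain ⟨g, hg⟩ := hs
  have hg1 := congrArg FreeGroup.toWord hg
  rw [← FreeGroup.mk_toWord (x := g), hBmk', FreeGroup.toWord_mk,
    (hflat _ FreeGroup.isReduced_toWord).reduce_eq, FreeGroup.toWord_of] at hg1
  rcases hw : g.toWord with _ | ⟨x, M⟩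
  · simp [hw] at hg1
  · rw [hw, List.map_cons, List.flatten_cons] at hg1
    have hlen := congrArg List.length hg1
    have hx0 : 0 < (B x).length := List.length_pos_iff.2 (hB0 x)
    simp only [List.length_append, List.length_singleton] at hlen
    have hBx : B x = [e x] := by
      obtain ⟨c, hc⟩ := List.length_eq_one_iff.1 (show (B x).length = 1 by omega)
      have := hBd x
      rw [hc] at this ⊢
      simpa using this
    have hex : e x = (i, true) := by
      rw [hBx] at hg1
      simpa using (List.cons.inj hg1).1
    have hxi : x.1 = i := by rw [← hefst, hex]
    have hlen' : L'.length = 1 := by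
      have := congrArg List.length hBx
      simp only [B, if_pos hxi] at this
      split_ifs at this
      · exact this
      · rwa [FreeGroup.invRev_length] at this
    obtain ⟨c, hc⟩ := List.length_eq_one_iff.1 hlen'
    rw [hc] at hd ⊢
    simpa using hd

end Inversion

/-- Automorphisms of `F_2` that commute with the inversion of `x_i` are
`x_i ↦ x_j ^ k * x_i ^ ε * x_j ^ (-k)`, `x_j ↦ x_j ^ δ`. -/
theorem exists_type_of_commute {i j : Fin 2} (hij : i ≠ j) {τ α : MulAut (FreeGp 2)}
    (h1 : τ (gen i) = (gen i)⁻¹) (h2 : ∀ l, l ≠ i → τ (gen l) = gen l) (hc : Commute τ α) :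
    ∃ (k : ℤ) (ε δ : ℤˣ), α (gen i) = gen j ^ k * gen i ^ (ε : ℤ) * gen j ^ (-k) ∧
      α (gen j) = gen j ^ (δ : ℤ) := by
  have hj : ∀ l, l ≠ i → l = j := by omega
  have hcx : ∀ x, τ (α x) = α (τ x) := fun x => DFunLike.congr_fun hc.eq x
  have hcx' : ∀ x, τ (α⁻¹ x) = α⁻¹ (τ x) := fun x => DFunLike.congr_fun hc.inv_right.eq x
  have hfix : ∀ x, τ x = x → x ∈ Subgroup.zpowers (gen j) := fun x hx =>
    mem_zpowers_of_fixed (τ := τ.toMonoidHom) hj h1 h2 hx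
  obtain ⟨p, hp⟩ := Subgroup.mem_zpowers_iff.1
    (hfix (α (gen j)) (by rw [hcx, h2 j hij.symm]))
  obtain ⟨q, hq⟩ := Subgroup.mem_zpowers_iff.1
    (hfix (α⁻¹ (gen j)) (by rw [hcx', h2 j hij.symm]))
  have hpq : p * q = 1 := by
    apply zpow_of_injective j
    change gen j ^ (p * q) = gen j ^ (1 : ℤ)
    rw [zpow_mul, hp, ← map_zpow, hq, MulAut.apply_inv_self, zpow_one]
  let δ : ℤˣ := Units.mkOfMulEqOne p q hpq
  have hδ : α (gen j) = gen j ^ (δ : ℤ) := hp.symm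
  set u := α (gen i) with hu
  have hτu : τ u = u⁻¹ := by rw [hu, hcx, h1, map_inv]
  have hw : u.toWord.map (flipAt i) = (u.toWord.map invLetter).reverse := by
    have h := congrArg FreeGroup.toWord hτu
    have e : τ u = τ.toMonoidHom (FreeGroup.mk u.toWord) := by
      rw [FreeGroup.mk_toWord]
      rfl
    rw [e, map_mk_flipAt (τ := τ.toMonoidHom) h1 h2, FreeGroup.toWord_mk,
      (isReduced_map_flipAt FreeGroup.isReduced_toWord).reduce_eq, FreeGroup.toWord_inv] at h
    exact h
  rcases exists_conj_of_inverted hj _ FreeGroup.isReduced_toWord hw with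
    h0 | ⟨k, a, L', ha, hr, hd, hl, hk⟩
  · rw [FreeGroup.mk_toWord, hu, map_eq_one_iff _ α.injective] at h0
    exact absurd h0 (isLetter_of i).ne_one
  rw [FreeGroup.mk_toWord] at hk
  let ρ : FreeGp 2 →* FreeGp 2 :=
    FreeGroup.lift fun l => if l = i then gen i else gen j ^ (δ : ℤ)
  have hρi : ρ (gen i) = gen i := by simp [ρ, gen]
  have hρj : ρ (gen j) = gen j ^ (δ : ℤ) := by simp [ρ, gen, hij.symm]
  have hρρ : ∀ x, ρ (ρ x) = x := by
    intro x
    have : ρ.comp ρ = MonoidHom.id _ := by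
      ext l : 1
      change ρ (ρ (gen l)) = gen l
      by_cases hli : l = i
      · rw [hli, hρi, hρi]
      · rw [hj l hli, hρj, map_zpow, hρj, ← zpow_mul, Int.units_coe_mul_self, zpow_one]
    exact DFunLike.congr_fun this x
  have hu1 : L' = [a] := by
    refine eq_singleton_of_surjective hj ha hr hd hl
      (β := ((MulAut.conj (gen j ^ (-k))).toMonoidHom.comp α.toMonoidHom).comp ρ) ?_ hij ?_
      ⟨ρ (α⁻¹ (gen j ^ k * gen i * gen j ^ (-k))), ?_⟩
    · change gen j ^ (-k) * α (ρ (gen i)) * (gen j ^ (-k))⁻¹ = _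
      rw [hρi, ← hu, hk]
      change gen j ^ (-k) * (gen j ^ k * _ * gen j ^ (-k)) * _ = _
      group
    · change gen j ^ (-k) * α (ρ (gen j)) * (gen j ^ (-k))⁻¹ = gen j
      rw [hρj, map_zpow, hδ, ← zpow_mul, Int.units_coe_mul_self]
      group
    · change gen j ^ (-k) * α (ρ (ρ _)) * (gen j ^ (-k))⁻¹ = gen i
      rw [hρρ, MulAut.apply_inv_self]
      group
  obtain ⟨l, b⟩ := a
  obtain rfl : l = i := ha
  refine ⟨k, if b then 1 else -1, δ, ?_, hδ⟩
  rw [hk, hu1]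
  cases b
  · simp only [Bool.false_eq_true, if_false, Units.val_neg, Units.val_one, zpow_neg_one]
    rfl
  · simp only [if_true, Units.val_one, zpow_one]
    rfl

/-! ### Changing the complement in a semidirect product -/

section Resplit

variable {N Q : Type*} [Group N] [Group Q] {φ : Q →* MulAut N}

/-- The action on `N` by conjugation with the elements of another complement of `N`, the image of
a section `σ`. -/
def resplitAct (σ : Q →* N ⋊[φ] Q) (hσ : ∀ q, (σ q).right = q) : Q →* MulAut N where
  toFun q := MulAut.conj (σ q).left * φ q
  map_one' := by simp
  map_mul' q r := by
    ext x
    simp [hσ, mul_assoc]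

/-- A semidirect product, split by means of another complement. -/
def resplit (σ : Q →* N ⋊[φ] Q) (hσ : ∀ q, (σ q).right = q) :
    N ⋊[resplitAct σ hσ] Q ≃* N ⋊[φ] Q where
  toFun g := ⟨g.left * (σ g.right).left, g.right⟩
  invFun g := ⟨g.left * (σ g.right).left⁻¹, g.right⟩
  left_inv g := by simp
  right_inv g := by simp
  map_mul' g h := by
    refine SemidirectProduct.ext ?_ rfl
    change g.left * ((σ g.right).left * φ g.right h.left * (σ g.right).left⁻¹) *
      (σ (g.right * h.right)).left =
        g.left * (σ g.right).left * φ g.right (h.left * (σ h.right).left)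
    rw [map_mul σ]
    simp [hσ, mul_assoc]

theorem resplit_inl (σ : Q →* N ⋊[φ] Q) (hσ : ∀ q, (σ q).right = q) (x : N) :
    resplit σ hσ (SemidirectProduct.inl x) = SemidirectProduct.inl x := by
  refine SemidirectProduct.ext ?_ rfl
  simp [resplit]

theorem resplit_inr (σ : Q →* N ⋊[φ] Q) (hσ : ∀ q, (σ q).right = q) (q : Q) :
    resplit σ hσ (SemidirectProduct.inr q) = σ q := by
  refine SemidirectProduct.ext ?_ (hσ q).symm
  simp [resplit]

end Resplit

section TwistedSection

variable {n : ℕ} {φ : ZxZ2 →* MulAut (FreeGp n)} {c : FreeGp n}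

/-- The section of `F_n ⋊ (ℤ × ℤ/2)` with `t₁ ↦ t₁`, `t₂ ↦ c * t₂`, where `t₁` fixes `c`. -/
def twistSection (φ : ZxZ2 →* MulAut (FreeGp n)) (c : FreeGp n) (hc : φ t1 c = c) :
    ZxZ2 →* FreeGp n ⋊[φ] ZxZ2 :=
  zxz2Lift (SemidirectProduct.inr t1) (SemidirectProduct.inl c * SemidirectProduct.inr t2)
    (by rw [← map_mul, t1_mul_t1, map_one])
    (by
      refine SemidirectProduct.ext ?_ ?_
      · simp [hc]
      · simp [mul_comm])

theorem twistSection_t1 (hc : φ t1 c = c) :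
    twistSection φ c hc t1 = SemidirectProduct.inr t1 := zxz2Lift_t1 ..

theorem twistSection_t2 (hc : φ t1 c = c) :
    twistSection φ c hc t2 = SemidirectProduct.inl c * SemidirectProduct.inr t2 := zxz2Lift_t2 ..

theorem twistSection_right (hc : φ t1 c = c) (q : ZxZ2) : (twistSection φ c hc q).right = q := by
  have : SemidirectProduct.rightHom.comp (twistSection φ c hc) = MonoidHom.id _ := by
    apply zxz2_hom_ext <;> simp [twistSection_t1, twistSection_t2]
  exact DFunLike.congr_fun this q

theorem resplitAct_t1 (hc : φ t1 c = c) (x : FreeGp n) :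
    resplitAct (twistSection φ c hc) (twistSection_right hc) t1 x = φ t1 x := by
  simp [resplitAct, twistSection_t1]

theorem resplitAct_t2 (hc : φ t1 c = c) (x : FreeGp n) :
    resplitAct (twistSection φ c hc) (twistSection_right hc) t2 x = c * φ t2 x * c⁻¹ := by
  simp [resplitAct, twistSection_t2]

end TwistedSection

/-! ### The groups `F_2 ⋊ (ℤ × ℤ/2)` -/

/-- The action of `ℤ × ℤ/2` on the line by integer translations. -/
@[reducible]
def translationAction : MulAction ZxZ2 ℝ where
  smul q x := ((Multiplicative.toAdd q.1 : ℤ) : ℝ) + x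
  one_smul x := by
    change (((0 : ℤ)) : ℝ) + x = x
    simp
  mul_smul q r x := by
    change ((Multiplicative.toAdd q.1 + Multiplicative.toAdd r.1 : ℤ) : ℝ) + x = _ + (_ + x)
    push_cast
    ring

theorem translationAction_actsGeometrically :
    let _ := translationAction
    ActsGeometrically ZxZ2 ℝ := by
  intro _
  have hs : ∀ (q : ZxZ2) (x : ℝ), q • x = ((Multiplicative.toAdd q.1 : ℤ) : ℝ) + x :=
    fun _ _ => rfl
  refine ⟨⟨0⟩, ?_, ?_, ?_, ?_⟩
  · intro p _ q _ t _
    refine ⟨(1 - t) * p + t * q, trivial, fun y _ => le_of_eq ?_⟩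
    simp only [Real.dist_eq, sq_abs]
    ring
  · intro g x y
    rw [hs, hs, dist_add_left]
  · intro x
    refine ⟨1, one_pos, ?_⟩
    refine (((Set.finite_Icc (-2 : ℤ) 2).prod (Set.finite_univ (α := ZMod 2))).image
      fun a => ((Multiplicative.ofAdd a.1, Multiplicative.ofAdd a.2) : ZxZ2)).subset ?_
    rintro q ⟨-, ⟨z, hz, rfl⟩, hz'⟩
    have h : |((Multiplicative.toAdd q.1 : ℤ) : ℝ)| ≤ 2 := by
      rw [Metric.mem_ball, Real.dist_eq, abs_lt] at hz hz'
      simp only [hs] at hz'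
      rw [abs_le]
      constructor <;> linarith
    rw [← Int.cast_abs] at h
    exact ⟨(Multiplicative.toAdd q.1, Multiplicative.toAdd q.2),
      ⟨abs_le.1 (by exact_mod_cast h), trivial⟩, rfl⟩
  · refine ⟨Set.Icc 0 1, isCompact_Icc, fun x => ⟨t2 ^ ⌊x⌋, Int.fract x,
      ⟨Int.fract_nonneg x, (Int.fract_lt_one x).le⟩, ?_⟩⟩
    rw [hs]
    simp [t2]

theorem isLetter_zpow_units {ι : Type*} (l : ι) (ε : ℤˣ) :
    IsLetter (FreeGroup.of l ^ (ε : ℤ)) := by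
  rcases Int.units_eq_one_or ε with rfl | rfl
  · simpa using isLetter_of l
  · simpa using (isLetter_of l).inv

/-- If `ℤ × ℤ/2` permutes the letters of a free group of finite rank, then the semidirect product
acts on the product of the Cayley tree with a line. -/
theorem isStewartGroup_of_letters {n : ℕ} (ψ : ZxZ2 →* MulAut (FreeGp (n + 1)))
    (h1 : ∀ l, IsLetter (ψ t1 (gen l))) (h2 : ∀ l, IsLetter (ψ t2 (gen l)))
    (h2' : ∀ l, IsLetter (ψ t2⁻¹ (gen l))) :
    IsStewartGroup (FreeGp (n + 1) ⋊[ψ] ZxZ2) := by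
  have key : ∀ q : ZxZ2, (∀ l, IsLetter (ψ q (gen l))) →
      ∀ x, IsLetter x → IsLetter (ψ q x) := by
    intro q hq x hx
    obtain ⟨l, rfl | rfl⟩ := isLetter_iff.1 hx
    · exact hq l
    · rw [map_inv]
      exact (hq l).inv
  have h1i : t1⁻¹ = t1 := inv_eq_of_mul_eq_one_left t1_mul_t1
  have hψ : ∀ q x, IsLetter x → IsLetter (ψ q x) := by
    intro q
    have hq : q ∈ Subgroup.closure {t1, t2} := by
      rw [closure_t1_t2]
      trivial
    have : (∀ x, IsLetter x → IsLetter (ψ q x)) ∧ ∀ x, IsLetter x → IsLetter (ψ q⁻¹ x) := by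
      induction hq using Subgroup.closure_induction with
      | mem q hq =>
        rcases hq with rfl | rfl
        · rw [h1i]
          exact ⟨key _ h1, key _ h1⟩
        · exact ⟨key _ h2, key _ h2'⟩
      | one => simp
      | mul q r _ _ hq hr =>
        refine ⟨fun x hx => ?_, fun x hx => ?_⟩
        · rw [map_mul]
          exact hq.1 _ (hr.1 _ hx)
        · rw [mul_inv_rev, map_mul]
          exact hr.2 _ (hq.2 _ hx)
      | inv q _ hq => exact ⟨hq.2, by rw [inv_inv]; exact hq.1⟩
    exact this.1
  let _ := translationAction
  have hs : ∀ (q : ZxZ2) (x : ℝ), q • x = ((Multiplicative.toAdd q.1 : ℤ) : ℝ) + x :=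
    fun _ _ => rfl
  let W : WallSystem (Fin (n + 1)) ℝ :=
    { wall := fun _ => Set.univ
      wall_inv := fun _ => rfl
      line := fun _ _ => ⟨1, one_pos, id, fun s t => by simp [Real.dist_eq], Set.range_id⟩ }
  have hfin : {x : FreeGp (n + 1) | IsLetter x}.Finite := by
    refine (Set.finite_range fun a : Fin (n + 1) × Bool => FreeGroup.mk [a]).subset ?_
    rintro x ⟨a, rfl⟩
    exact ⟨a, rfl⟩
  refine TreeSpace.isStewartGroup W ψ translationAction_actsGeometrically hψ
    (fun _ _ _ _ => trivial) hfin (fun _ h => h) (fun _ => Set.Icc 0 1)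
    (fun _ _ => isCompact_Icc) (fun _ _ => Set.subset_univ _) ?_
  intro x hx p _
  refine ⟨t2 ^ ⌊p⌋, ψ (t2 ^ ⌊p⌋)⁻¹ x, hψ _ _ hx, Int.fract p,
      ⟨Int.fract_nonneg p, (Int.fract_lt_one p).le⟩, ?_, ?_⟩
  · rw [map_inv, MulAut.apply_inv_self]
  · rw [hs]
    simp [t2]

/-- The base of the induction. Another complement, generated by `t₁` and `x_j ^ (-k) * t₂`,
permutes the letters. -/
theorem isStewartGroup_two (φ : ZxZ2 →* MulAut (FreeGp 2)) {i : Fin 2} (hφ : InvertsOne φ i) :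
    IsStewartGroup (FreeGp 2 ⋊[φ] ZxZ2) := by
  obtain ⟨j, hij⟩ : ∃ j, i ≠ j := ⟨1 - i, by omega⟩
  have hj : ∀ l, l ≠ i → l = j := by omega
  obtain ⟨k, ε, δ, h1, h2⟩ := exists_type_of_commute hij hφ.1 hφ.2
    (show Commute (φ t1) (φ t2) from (Commute.all t1 t2).map φ)
  have hc : φ t1 (gen j ^ (-k)) = gen j ^ (-k) := by rw [map_zpow, hφ.2 j hij.symm]
  refine IsStewartGroup.congr (resplit _ (twistSection_right hc))
    (isStewartGroup_of_letters (n := 1) _ ?_ ?_ ?_)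
  · intro l
    rw [resplitAct_t1]
    by_cases hl : l = i
    · rw [hl, hφ.1]
      exact (isLetter_of i).inv
    · rw [hφ.2 l hl]
      exact isLetter_of l
  all_goals
    set ψ := resplitAct (twistSection φ _ hc) (twistSection_right hc) with hψ
    have hi : ψ t2 (gen i) = gen i ^ (ε : ℤ) := by
      rw [hψ, resplitAct_t2, h1]
      group
    have hj' : ψ t2 (gen j) = gen j ^ (δ : ℤ) := by
      rw [hψ, resplitAct_t2, h2]
      group
    intro l
  · by_cases hl : l = i
    · rw [hl, hi]
      exact isLetter_zpow_units i ε
    · rw [hj l hl, hj']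
      exact isLetter_zpow_units j δ
  · have hinv : ∀ (l : Fin 2) (u : ℤˣ), ψ t2 (gen l) = gen l ^ (u : ℤ) →
        ψ t2⁻¹ (gen l) = gen l ^ (u : ℤ) := by
      intro l u h
      rw [map_inv]
      apply (ψ t2).injective
      rw [MulAut.apply_inv_self, map_zpow, h, ← zpow_mul, Int.units_coe_mul_self, zpow_one]
    by_cases hl : l = i
    · rw [hl, hinv i ε hi]
      exact isLetter_zpow_units i ε
    · rw [hj l hl, hinv j δ hj']
      exact isLetter_zpow_units j δ

/-! ### Induction along the tower -/

theorem freeIncl_injective (n : ℕ) : Function.Injective (freeIncl n) :=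
  FreeGroup.map_injective (Fin.castSucc_injective n)

theorem freeIncl_gen {n : ℕ} (l : Fin n) : freeIncl n (gen l) = gen l.castSucc := by
  simp [freeIncl, gen]

/-- In `F_{n+1} = F_n * ℤ` only the trivial element of `F_n` commutes with the last letter. To see
this, let `F_n` act on two copies of itself, by translations on the first one and trivially on the
second one, and let the last letter exchange the copies. -/
theorem eq_one_of_commute_last {n : ℕ} {w : FreeGp n}
    (h : Commute (freeIncl n w) (gen (Fin.last n))) : w = 1 := by
  let ρ : FreeGp n →* Equiv.Perm (FreeGp n ⊕ FreeGp n) :=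
    (Equiv.Perm.sumCongrHom (FreeGp n) (FreeGp n)).comp
      ((MonoidHom.inl _ _).comp (MulAction.toPermHom (FreeGp n) (FreeGp n)))
  let Φ : FreeGp (n + 1) →* Equiv.Perm (FreeGp n ⊕ FreeGp n) :=
    FreeGroup.lift (Fin.lastCases (Equiv.sumComm _ _) fun l => ρ (gen l))
  have h1 : Φ (gen (Fin.last n)) = Equiv.sumComm _ _ := by simp [Φ, gen]
  have h2 : ∀ v, Φ (freeIncl n v) = ρ v := by
    intro v
    have : Φ.comp (freeIncl n) = ρ := by
      ext l : 1
      simp [Φ, freeIncl, gen]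
    exact DFunLike.congr_fun this v
  have h3 := DFunLike.congr_fun (h.map Φ).eq (Sum.inr 1)
  rw [h1, h2] at h3
  simpa [ρ] using h3

theorem holEmb_injective (n : ℕ) : Function.Injective (holEmb n) := by
  refine (injective_iff_map_eq_one _).2 fun h hh => ?_
  have he : ∀ x, holEnd h x = x := fun x => DFunLike.congr_fun hh x
  refine SemidirectProduct.ext ?_ ?_
  · refine eq_one_of_commute_last ?_
    have := he (gen (Fin.last n))
    rw [holEnd_last, mul_assoc, inv_mul_eq_iff_eq_mul] at this
    exact this.symm
  · ext x : 1
    exact freeIncl_injective n (by rw [← holEnd_incl, he]; rfl)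

theorem InvertsOne.of_holEmb {n : ℕ} {η : ZxZ2 →* Hol (FreeGp n)} {i : Fin n}
    (h : InvertsOne ((holEmb n).comp η) i.castSucc) : InvertsOne (holAct η) i := by
  have e : ∀ l, (holEmb n).comp η t1 (gen l.castSucc) =
      freeIncl n (holAct η t1 (gen l)) := by
    intro l
    rw [← freeIncl_gen]
    exact holEnd_incl (η t1) (gen l)
  refine ⟨freeIncl_injective n ?_, fun l hl => freeIncl_injective n ?_⟩
  · rw [← e, h.1, map_inv, freeIncl_gen]
  · rw [← e, h.2 _ fun h' => hl (Fin.castSucc_injective n h'), freeIncl_gen]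

/-- Membership in a group of the tower depends on the automorphism only. -/
theorem mem_holTower_of_right_eq {m : ℕ} {h h' : Hol (FreeGp (m + 2))} (e : h.right = h'.right)
    (hm : h ∈ holTower m) : h' ∈ holTower m := by
  cases m with
  | zero => trivial
  | succ m =>
    obtain ⟨x, hx, hxe⟩ := hm
    exact ⟨x, hx, hxe.trans e⟩

/-- A homomorphism into a group of the tower comes from one into the preceding group. -/
theorem exists_holEmb_comp_eq {m : ℕ} {φ : ZxZ2 →* MulAut (FreeGp (m + 1 + 2))}
    (h : (toHol φ).range ≤ holTower (m + 1)) :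
    ∃ η : ZxZ2 →* Hol (FreeGp (m + 2)), (holEmb (m + 2)).comp η = φ ∧
      (toHol (holAct η)).range ≤ holTower m := by
  have hq : ∀ q, ∃ x ∈ holTower m, holEmb (m + 2) x = φ q := fun q =>
    h ⟨SemidirectProduct.inr q, rfl⟩
  choose f hf hfe using hq
  have hinj := holEmb_injective (m + 2)
  let η : ZxZ2 →* Hol (FreeGp (m + 2)) :=
    { toFun := f
      map_one' := hinj (by rw [hfe, map_one, map_one])
      map_mul' := fun q r => hinj (by rw [hfe, map_mul, map_mul, hfe, hfe]) }
  refine ⟨η, MonoidHom.ext hfe, ?_⟩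
  rintro - ⟨g, rfl⟩
  exact mem_holTower_of_right_eq (h := f g.right) rfl (hf g.right)

theorem isStewartGroup_of_range_le (m : ℕ) (φ : ZxZ2 →* MulAut (FreeGp (m + 2)))
    (i : Fin (m + 2)) (hi : (i : ℕ) < 2) (hφ : InvertsOne φ i)
    (h : (toHol φ).range ≤ holTower m) : IsStewartGroup (FreeGp (m + 2) ⋊[φ] ZxZ2) := by
  induction m with
  | zero => exact isStewartGroup_two φ hφ
  | succ m ih =>
    obtain ⟨η, rfl, hη⟩ := exists_holEmb_comp_eq h
    obtain ⟨i, rfl⟩ : ∃ i' : Fin (m + 2), i = i'.castSucc := ⟨⟨i, by omega⟩, rfl⟩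
    exact isStewartGroup_holEmb η (ih (holAct η) i hi hφ.of_holEmb hη)

theorem toHol_injective {n : ℕ} {φ : ZxZ2 →* MulAut (FreeGp n)} (h : Function.Injective φ) :
    Function.Injective (toHol φ) := fun _ _ hab =>
  SemidirectProduct.ext (congrArg (fun x : Hol (FreeGp n) => x.left) hab)
    (h (congrArg (fun x : Hol (FreeGp n) => x.right) hab))

/-! ### Automorphisms of prescribed type -/

section OfType

variable {n : ℕ}

/-- The automorphism `α` acts on the basis of `F_n` by
`x_i ↦ x_j ^ k * x_i ^ ε * x_j ^ (-k)`, `x_j ↦ x_j ^ δ`, and by conjugation by `x_j ^ r` on the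
other basis elements. -/
def IsOfType (α : MulAut (FreeGp n)) (i j : Fin n) (k r : ℤ) (ε δ : ℤˣ) : Prop :=
  α (gen i) = gen j ^ k * gen i ^ (ε : ℤ) * gen j ^ (-k) ∧
  α (gen j) = gen j ^ (δ : ℤ) ∧
  ∀ l, l ≠ i → l ≠ j → α (gen l) = gen j ^ r * gen l * gen j ^ (-r)

/-- The endomorphism that acts on the basis as in `IsOfType`. -/
def typeEnd (i j : Fin n) (k r : ℤ) (ε δ : ℤˣ) : FreeGp n →* FreeGp n :=
  FreeGroup.lift fun l =>
    if l = i then gen j ^ k * gen i ^ (ε : ℤ) * gen j ^ (-k)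
    else if l = j then gen j ^ (δ : ℤ)
    else gen j ^ r * gen l * gen j ^ (-r)

variable {i j : Fin n} (k r : ℤ) (ε δ : ℤˣ)

theorem typeEnd_left : typeEnd i j k r ε δ (gen i) =
    gen j ^ k * gen i ^ (ε : ℤ) * gen j ^ (-k) := by
  simp [typeEnd, gen]

theorem typeEnd_other {l : Fin n} (hi : l ≠ i) (hj : l ≠ j) :
    typeEnd i j k r ε δ (gen l) = gen j ^ r * gen l * gen j ^ (-r) := by
  simp [typeEnd, gen, hi, hj]

theorem typeEnd_right (hij : i ≠ j) : typeEnd i j k r ε δ (gen j) = gen j ^ (δ : ℤ) := by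
  simp [typeEnd, gen, hij.symm]

theorem typeEnd_comp (hij : i ≠ j) {k' r' : ℤ} (hk : k' = -(δ * k)) (hr : r' = -(δ * r)) :
    (typeEnd i j k r ε δ).comp (typeEnd i j k' r' ε δ) = MonoidHom.id _ := by
  have hb : ∀ x : ℤ, typeEnd i j k r ε δ (gen j ^ (-(δ * x))) = gen j ^ (-x) := fun x => by
    rw [map_zpow, typeEnd_right _ _ _ _ hij, ← zpow_mul, mul_neg, ← mul_assoc,
      Int.units_coe_mul_self, one_mul]
  subst hk hr
  ext l : 1
  change typeEnd i j k r ε δ (typeEnd i j _ _ ε δ (gen l)) = gen l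
  by_cases hi : l = i
  · have ha : typeEnd i j k r ε δ (gen i ^ (ε : ℤ)) = gen j ^ k * gen i * gen j ^ (-k) := by
      rw [map_zpow, typeEnd_left, zpow_neg, ← MulAut.conj_apply, ← map_zpow, ← zpow_mul,
        Int.units_coe_mul_self, zpow_one, MulAut.conj_apply]
    rw [hi, typeEnd_left, map_mul, map_mul, hb, ha, ← mul_neg, hb]
    group
  · by_cases hj : l = j
    · rw [hj, typeEnd_right _ _ _ _ hij, map_zpow, typeEnd_right _ _ _ _ hij, ← zpow_mul,
        Int.units_coe_mul_self, zpow_one]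
    · rw [typeEnd_other _ _ _ _ hi hj, map_mul, map_mul, hb, typeEnd_other _ _ _ _ hi hj,
        ← mul_neg, hb]
      group

/-- The automorphism of a given type. -/
def typeAut (hij : i ≠ j) (k r : ℤ) (ε δ : ℤˣ) : MulAut (FreeGp n) :=
  MonoidHom.toMulEquiv (typeEnd i j k r ε δ) (typeEnd i j (-(δ * k)) (-(δ * r)) ε δ)
    (typeEnd_comp _ _ _ _ hij
      (by rw [mul_neg, neg_neg, ← mul_assoc, Int.units_coe_mul_self, one_mul])
      (by rw [mul_neg, neg_neg, ← mul_assoc, Int.units_coe_mul_self, one_mul]))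
    (typeEnd_comp _ _ _ _ hij rfl rfl)

theorem isOfType_typeAut (hij : i ≠ j) : IsOfType (typeAut hij k r ε δ) i j k r ε δ :=
  ⟨typeEnd_left .., typeEnd_right _ _ _ _ hij, fun _ hi hj => typeEnd_other _ _ _ _ hi hj⟩

theorem InvertsOne.isOfType {φ : ZxZ2 →* MulAut (FreeGp n)} (h : InvertsOne φ i) (hij : i ≠ j) :
    IsOfType (φ t1) i j 0 0 (-1) 1 := by
  refine ⟨?_, ?_, fun l hl _ => ?_⟩
  · simp [h.1]
  · simp [h.2 j hij.symm]
  · simp [h.2 l hl]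

end OfType

theorem mem_holTower_of_isOfType {m : ℕ} {i j : Fin (m + 2)} (hi : (i : ℕ) < 2) (hj : (j : ℕ) < 2)
    (hij : i ≠ j) {k r : ℤ} {ε δ : ℤˣ} {α : MulAut (FreeGp (m + 2))}
    (h : IsOfType α i j k r ε δ) (w : FreeGp (m + 2)) :
    (⟨w, α⟩ : Hol (FreeGp (m + 2))) ∈ holTower m := by
  induction m with
  | zero => trivial
  | succ m ih =>
    obtain ⟨i, rfl⟩ : ∃ i' : Fin (m + 2), i = i'.castSucc := ⟨⟨i, by omega⟩, rfl⟩
    obtain ⟨j, rfl⟩ : ∃ j' : Fin (m + 2), j = j'.castSucc := ⟨⟨j, by omega⟩, rfl⟩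
    have hij' : i ≠ j := fun e => hij (by rw [e])
    have ht := isOfType_typeAut k r ε δ hij'
    refine ⟨⟨gen j ^ (-r), typeAut hij' k r ε δ⟩, ih hi hj hij' ht _, ?_⟩
    have e : (holEnd ⟨gen j ^ (-r), typeAut hij' k r ε δ⟩) = α.toMonoidHom := by
      ext l : 1
      change holEnd _ (gen l) = α (gen l)
      refine Fin.lastCases ?_ (fun l => ?_) l
      · rw [holEnd_last, h.2.2 _ (Fin.castSucc_lt_last i).ne' (Fin.castSucc_lt_last j).ne',
          map_zpow, freeIncl_gen, zpow_neg, inv_inv]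
      · rw [← freeIncl_gen, holEnd_incl]
        change freeIncl _ (typeAut hij' k r ε δ (gen l)) = _
        rw [freeIncl_gen]
        by_cases hli : l = i
        · rw [hli, h.1, ht.1]
          simp [freeIncl_gen]
        · by_cases hlj : l = j
          · rw [hlj, h.2.1, ht.2.1]
            simp [freeIncl_gen]
          · rw [h.2.2 _ (fun e => hli (Fin.castSucc_injective _ e))
              (fun e => hlj (Fin.castSucc_injective _ e)), ht.2.2 l hli hlj]
            simp [freeIncl_gen]
    exact MulEquiv.ext fun x => DFunLike.congr_fun e x

theorem range_toHol_le_holTower {m : ℕ} {i j : Fin (m + 2)} (hi : (i : ℕ) < 2)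
    (hj : (j : ℕ) < 2) (hij : i ≠ j) {φ : ZxZ2 →* MulAut (FreeGp (m + 2))} (hφ : InvertsOne φ i)
    {k r : ℤ} {ε δ : ℤˣ} (h : ActsByType φ i j k r ε δ) : (toHol φ).range ≤ holTower m := by
  have hq : ∀ q, toHol φ (SemidirectProduct.inr q) ∈ holTower m := by
    have : Subgroup.closure {t1, t2} ≤
        (holTower m).comap ((toHol φ).comp SemidirectProduct.inr) := by
      rw [Subgroup.closure_le]
      rintro q (rfl | rfl)
      · exact mem_holTower_of_isOfType hi hj hij (hφ.isOfType hij) 1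
      · exact mem_holTower_of_isOfType hi hj hij h 1
    rw [closure_t1_t2] at this
    exact fun q => this trivial
  rintro - ⟨g, rfl⟩
  exact mem_holTower_of_right_eq (h := toHol φ (SemidirectProduct.inr g.right)) rfl (hq _)

/-! ### Amalgamated decompositions of semidirect products -/

section Amalgam

variable {ι Q G : Type} [Group Q] [Group G] {ψ : Q →* MulAut (FreeGroup ι)}

/-- The homomorphism of semidirect products that is induced by a map of the bases of free groups, if
the resulting homomorphism of free groups is equivariant. -/
def basisMap {κ : Type} (e : κ → ι) {θ : Q →* MulAut (FreeGroup κ)}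
    (hθ : ∀ q x, FreeGroup.map e (θ q x) = ψ q (FreeGroup.map e x)) :
    FreeGroup κ ⋊[θ] Q →* FreeGroup ι ⋊[ψ] Q :=
  SemidirectProduct.map (FreeGroup.map e) (MonoidHom.id _) fun q => MonoidHom.ext fun x => hθ q x

theorem basisMap_injective {κ : Type} {e : κ → ι} (he : Function.Injective e)
    {θ : Q →* MulAut (FreeGroup κ)}
    (hθ : ∀ q x, FreeGroup.map e (θ q x) = ψ q (FreeGroup.map e x)) :
    Function.Injective (basisMap e hθ) := fun _ _ hab =>
  SemidirectProduct.ext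
    (FreeGroup.map_injective he (congrArg (fun x : FreeGroup ι ⋊[ψ] Q => x.left) hab))
    (congrArg (fun x : FreeGroup ι ⋊[ψ] Q => x.right) hab)

/-- If `Q` preserves both parts of a partition of the basis of a free group, then the semidirect
product is an amalgam over `Q` of the semidirect products of the two free factors with `Q`. -/
theorem isAmalgam_of_partition (R : FreeGroup ι ⋊[ψ] Q ≃* G) {κ : Bool → Type}
    (E : (Σ b, κ b) ≃ ι) {θ : ∀ b, Q →* MulAut (FreeGroup (κ b))}
    (hθ : ∀ b q x, FreeGroup.map (fun y => E ⟨b, y⟩) (θ b q x) =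
      ψ q (FreeGroup.map (fun y => E ⟨b, y⟩) x))
    {K₁ K K₂ : Subgroup G}
    (hb : ∀ b, cond b K₁ K₂ = (R.toMonoidHom.comp (basisMap _ (hθ b))).range)
    (hK : K = (R.toMonoidHom.comp SemidirectProduct.inr).range) : IsAmalgam K₁ K K₂ := by
  have h : ∀ b : Bool, K ≤ cond b K₁ K₂ := by
    intro b
    rw [hb, hK]
    rintro - ⟨q, rfl⟩
    exact ⟨SemidirectProduct.inr q, by simp [basisMap]⟩
  let c : ∀ b, FreeGroup (κ b) ⋊[θ b] Q →* ↥(cond b K₁ K₂) := fun b =>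
    (R.toMonoidHom.comp (basisMap _ (hθ b))).codRestrict _ fun x => by
      rw [hb]
      exact ⟨x, rfl⟩
  let d : Q →* K := (R.toMonoidHom.comp SemidirectProduct.inr).codRestrict _ fun x => by
    rw [hK]
    exact ⟨x, rfl⟩
  have hc : ∀ b x, (c b x : G) = R (basisMap _ (hθ b) x) := fun _ _ => rfl
  have hd : ∀ q, (d q : G) = R (SemidirectProduct.inr q) := fun _ => rfl
  have hcs : ∀ b, Function.Surjective (c b) := by
    rintro b ⟨x, hx⟩
    have hx' := hx
    rw [hb] at hx'
    obtain ⟨z, hz⟩ := hx'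
    exact ⟨z, Subtype.ext hz⟩
  have hcd : ∀ b q, c b (SemidirectProduct.inr q) = Subgroup.inclusion (h b) (d q) := by
    intro b q
    refine Subtype.ext ?_
    rw [hc, Subgroup.coe_inclusion, hd]
    simp [basisMap]
  refine ⟨h, ?_⟩
  let P := Monoid.PushoutI (fun b => Subgroup.inclusion (h b))
  let L : P →* G := Monoid.PushoutI.lift (φ := fun b => Subgroup.inclusion (h b))
    (fun b => (cond b K₁ K₂).subtype) K.subtype (fun _ => rfl)
  let o : ∀ b, ↥(cond b K₁ K₂) →* P := fun b =>
    Monoid.PushoutI.of (φ := fun b => Subgroup.inclusion (h b)) b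
  let s : K →* P := Monoid.PushoutI.base (fun b => Subgroup.inclusion (h b))
  have hLo : ∀ b x, L (o b x) = x := fun b x => Monoid.PushoutI.lift_of ..
  have hLs : ∀ x, L (s x) = x := fun x => Monoid.PushoutI.lift_base ..
  have hos : ∀ b q, o b (c b (SemidirectProduct.inr q)) = s (d q) := by
    intro b q
    rw [hcd]
    exact Monoid.PushoutI.of_apply_eq_base (fun b => Subgroup.inclusion (h b)) b (d q)
  let j : FreeGroup ι →* P := FreeGroup.lift fun l =>
    o (E.symm l).1 (c _ (SemidirectProduct.inl (FreeGroup.of (E.symm l).2)))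
  have hj : ∀ b x, j (FreeGroup.map (fun y => E ⟨b, y⟩) x) =
      o b (c b (SemidirectProduct.inl x)) := by
    intro b x
    have : j.comp (FreeGroup.map (fun y => E ⟨b, y⟩)) =
        (o b).comp ((c b).comp SemidirectProduct.inl) := by
      ext y : 1
      simp only [MonoidHom.comp_apply, FreeGroup.map.of, j, FreeGroup.lift_apply_of]
      rw [E.symm_apply_apply]
    exact DFunLike.congr_fun this x
  let J : FreeGroup ι ⋊[ψ] Q →* P := SemidirectProduct.lift j (s.comp d) fun q => by
    ext l : 1
    obtain ⟨⟨b, y⟩, rfl⟩ := E.surjective l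
    have hl : FreeGroup.of (E ⟨b, y⟩) = FreeGroup.map (fun y => E ⟨b, y⟩) (FreeGroup.of y) :=
      FreeGroup.map.of.symm
    change j (ψ q (FreeGroup.of _)) = s (d q) * j (FreeGroup.of _) * (s (d q))⁻¹
    rw [hl, ← hθ, hj, hj, ← hos b, ← map_inv, ← map_mul, ← map_mul, ← map_inv, ← map_mul,
      ← map_mul, inr_mul_inl_mul_inv]
  have hLJ : ∀ x, L (J x) = R x := by
    intro x
    have : L.comp J = R.toMonoidHom := by
      apply SemidirectProduct.hom_ext
      · ext l : 1
        obtain ⟨⟨b, y⟩, rfl⟩ := E.surjective l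
        have hl : FreeGroup.of (E ⟨b, y⟩) = FreeGroup.map (fun y => E ⟨b, y⟩) (FreeGroup.of y) :=
          FreeGroup.map.of.symm
        change L (J (SemidirectProduct.inl (FreeGroup.of _))) =
          R (SemidirectProduct.inl (FreeGroup.of _))
        rw [SemidirectProduct.lift_inl, hl, hj, hLo, hc, basisMap, SemidirectProduct.map_inl]
      · ext q : 1
        change L (J (SemidirectProduct.inr _)) = R (SemidirectProduct.inr _)
        rw [SemidirectProduct.lift_inr, MonoidHom.comp_apply, hLs, hd]
    exact DFunLike.congr_fun this x
  have hJc : ∀ b z, J (basisMap _ (hθ b) z) = o b (c b z) := by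
    intro b z
    have : J.comp (basisMap _ (hθ b)) = (o b).comp (c b) := by
      apply SemidirectProduct.hom_ext
      · ext y : 1
        change J (basisMap _ (hθ b) (SemidirectProduct.inl (FreeGroup.of y))) =
          o b (c b (SemidirectProduct.inl (FreeGroup.of y)))
        rw [← hj, basisMap, SemidirectProduct.map_inl, SemidirectProduct.lift_inl]
      · ext q : 1
        change J (basisMap _ (hθ b) (SemidirectProduct.inr _)) = o b (c b (SemidirectProduct.inr _))
        rw [hos, basisMap, SemidirectProduct.map_inr, SemidirectProduct.lift_inr]
        rfl
    exact DFunLike.congr_fun this z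
  have hJL : ∀ p, J (R.symm (L p)) = p := by
    intro p
    have : (J.comp R.symm.toMonoidHom).comp L = MonoidHom.id P := by
      apply Monoid.PushoutI.hom_ext_nonempty
      intro b
      ext x : 1
      obtain ⟨z, rfl⟩ := hcs b x
      change J (R.symm (L (o b (c b z)))) = o b (c b z)
      rw [hLo, hc, R.symm_apply_apply, hJc]
    exact DFunLike.congr_fun this p
  refine ⟨fun p p' hp => ?_, fun g => ⟨J (R.symm g), ?_⟩⟩
  · rw [← hJL p, ← hJL p', hp]
  · rw [hLJ, R.apply_symm_apply]

end Amalgam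

/-! ### The decomposition of `F_n ⋊ (ℤ × ℤ/2)` -/

theorem forall_zxz2_equivariant {N N' : Type*} [Group N] [Group N'] {θ : ZxZ2 →* MulAut N}
    {ψ : ZxZ2 →* MulAut N'} {f : N →* N'} (h1 : ∀ x, f (θ t1 x) = ψ t1 (f x))
    (h2 : ∀ x, f (θ t2 x) = ψ t2 (f x)) (q : ZxZ2) (x : N) : f (θ q x) = ψ q (f x) := by
  have hq : q ∈ Subgroup.closure {t1, t2} := by
    rw [closure_t1_t2]
    trivial
  induction hq using Subgroup.closure_induction generalizing x with
  | mem q hq =>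
    rcases hq with rfl | rfl
    · exact h1 x
    · exact h2 x
  | one => simp
  | mul q r _ _ hq hr => simp [hq, hr]
  | inv q _ hq =>
    apply (ψ q).injective
    rw [← hq, map_inv, map_inv, MulAut.apply_inv_self, MulAut.apply_inv_self]

theorem forall_zxz2_equivariant_of_gen {κ : Type} {n : ℕ} {θ : ZxZ2 →* MulAut (FreeGroup κ)}
    {ψ : ZxZ2 →* MulAut (FreeGp n)} {f : FreeGroup κ →* FreeGp n}
    (h1 : ∀ l, f (θ t1 (FreeGroup.of l)) = ψ t1 (f (FreeGroup.of l)))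
    (h2 : ∀ l, f (θ t2 (FreeGroup.of l)) = ψ t2 (f (FreeGroup.of l))) (q : ZxZ2)
    (x : FreeGroup κ) : f (θ q x) = ψ q (f x) := by
  refine forall_zxz2_equivariant (fun x => ?_) (fun x => ?_) q x
  · have : f.comp (θ t1).toMonoidHom = (ψ t1).toMonoidHom.comp f := FreeGroup.ext_hom _ _ h1
    exact DFunLike.congr_fun this x
  · have : f.comp (θ t2).toMonoidHom = (ψ t2).toMonoidHom.comp f := FreeGroup.ext_hom _ _ h2
    exact DFunLike.congr_fun this x

/-- The homomorphism from `ℤ × ℤ/2` to `Aut(F_2)` with `t₁` of type `(0, 0, -1, 1)` and `t₂` of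
type `(k, 0, ε, δ)`. -/
theorem exists_actsByType_two (k : ℤ) (ε δ : ℤˣ) :
    ∃ θ : ZxZ2 →* MulAut (FreeGp 2), InvertsOne θ 0 ∧ ActsByType θ 0 1 k 0 ε δ := by
  have h01 : (0 : Fin 2) ≠ 1 := by decide
  have hl : ∀ l : Fin 2, l ≠ 0 → l = 1 := by omega
  set α := typeAut h01 0 0 (-1) 1 with hα
  set β := typeAut h01 k 0 ε δ with hβ
  have ha := isOfType_typeAut 0 0 (-1) 1 h01
  have hb := isOfType_typeAut k 0 ε δ h01
  rw [← hα] at ha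
  rw [← hβ] at hb
  have hα0 : α (gen 0) = (gen 0)⁻¹ := by simpa using ha.1
  have hα1 : α (gen 1) = gen 1 := by simpa using ha.2.1
  have hext : ∀ γ γ' : MulAut (FreeGp 2), γ (gen 0) = γ' (gen 0) → γ (gen 1) = γ' (gen 1) →
      γ = γ' := by
    intro γ γ' h0 h1
    have : γ.toMonoidHom = γ'.toMonoidHom := by
      ext l : 1
      by_cases hl0 : l = 0
      · rw [hl0]
        exact h0
      · rw [hl l hl0]
        exact h1
    exact MulEquiv.ext fun x => DFunLike.congr_fun this x
  have hαα : α * α = 1 := hext _ _ (by simp [hα0]) (by simp [hα1])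
  have hαβ : Commute α β :=
    hext _ _ (by simp [hb.1, hα0, hα1, mul_assoc]) (by simp [hb.2.1, hα1])
  refine ⟨zxz2Lift α β hαα hαβ, ⟨?_, fun l hl0 => ?_⟩, ?_⟩
  · rw [zxz2Lift_t1, hα0]
  · rw [zxz2Lift_t1, hl l hl0, hα1]
  · unfold ActsByType
    rw [zxz2Lift_t2]
    exact hb

section Subgroups

variable {n : ℕ} {φ : ZxZ2 →* MulAut (FreeGp n)} {j : Fin n} {r : ℤ}
  (hc : φ t1 (gen j ^ (-r)) = gen j ^ (-r))

theorem range_twistSection : (twistSection φ _ hc).range = subK φ j r := by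
  rw [MonoidHom.range_eq_map, ← closure_t1_t2, MonoidHom.map_closure, Set.image_pair,
    twistSection_t1, twistSection_t2]
  rfl

/-- The subgroups generated by `t₁`, `ξ` and a set of basis elements. -/
theorem range_resplit_basisMap {κ : Type} (e : κ → Fin n) {θ : ZxZ2 →* MulAut (FreeGroup κ)}
    (hθ : ∀ q x, FreeGroup.map e (θ q x) =
      resplitAct (twistSection φ _ hc) (twistSection_right hc) q (FreeGroup.map e x))
    {p : Fin n → Prop} (hp : ∀ l, p l ↔ ∃ y, e y = l) :
    ((resplit (twistSection φ _ hc) (twistSection_right hc)).toMonoidHom.comp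
      (basisMap e hθ)).range = Subgroup.closure ({SemidirectProduct.inr t1, xi φ j r} ∪
        {g | ∃ l, p l ∧ g = SemidirectProduct.inl (gen l)}) := by
  set S : Set (FreeGp n ⋊[φ] ZxZ2) := {SemidirectProduct.inr t1, xi φ j r} ∪
    {g | ∃ l, p l ∧ g = SemidirectProduct.inl (gen l)}
  have hinl : ∀ y, resplit (twistSection φ _ hc) (twistSection_right hc)
      (basisMap e hθ (SemidirectProduct.inl (FreeGroup.of y))) =
        SemidirectProduct.inl (gen (e y)) := by
    intro y
    rw [basisMap, SemidirectProduct.map_inl, resplit_inl, FreeGroup.map.of]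
    rfl
  have hinr : ∀ q, resplit (twistSection φ _ hc) (twistSection_right hc)
      (basisMap e hθ (SemidirectProduct.inr q)) = twistSection φ _ hc q := by
    intro q
    rw [basisMap, SemidirectProduct.map_inr, resplit_inr]
    rfl
  apply le_antisymm
  · rintro - ⟨g, rfl⟩
    rw [← SemidirectProduct.inl_left_mul_inr_right g, map_mul]
    refine mul_mem ?_ ?_
    · induction g.left using FreeGroup.induction_on with
      | C1 => simp
      | of y =>
        refine Subgroup.subset_closure (Or.inr ⟨e y, (hp _).2 ⟨y, rfl⟩, hinl y⟩)
      | inv_of y ih =>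
        rw [map_inv, map_inv]
        exact inv_mem ih
      | mul x y hx hy =>
        rw [map_mul, map_mul]
        exact mul_mem hx hy
    · have : subK φ j r ≤ Subgroup.closure S := Subgroup.closure_mono Set.subset_union_left
      refine this ?_
      rw [← range_twistSection hc]
      exact ⟨g.right, (hinr g.right).symm⟩
  · rw [Subgroup.closure_le]
    rintro - ((rfl | rfl) | ⟨l, hl, rfl⟩)
    · exact ⟨SemidirectProduct.inr t1, (hinr t1).trans (twistSection_t1 hc)⟩
    · exact ⟨SemidirectProduct.inr t2, (hinr t2).trans (twistSection_t2 hc)⟩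
    · obtain ⟨y, rfl⟩ := (hp l).1 hl
      exact ⟨SemidirectProduct.inl (FreeGroup.of y), hinl y⟩

end Subgroups

/-- The embedding of the indices of one of the two parts of the basis: the last `m` elements, or
the pair `x_i`, `x_j`. -/
def partIncl {m : ℕ} (i j : Fin (m + 2)) : ∀ b, cond b (Fin m) (Fin 2) → Fin (m + 2)
  | true => fun l => l.addNat 2
  | false => ![i, j]

theorem partIncl_bijective {m : ℕ} {i j : Fin (m + 2)} (hi : (i : ℕ) < 2) (hj : (j : ℕ) < 2)
    (hij : i ≠ j) :
    Function.Bijective fun y : Σ b, cond b (Fin m) (Fin 2) => partIncl i j y.1 y.2 := by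
  have hij' : (i : ℕ) ≠ j := fun h => hij (Fin.ext h)
  have hlt : ∀ y : Fin 2, ((![i, j] y : Fin (m + 2)) : ℕ) < 2 := by
    intro y
    fin_cases y
    · exact hi
    · exact hj
  constructor
  · rintro ⟨b, y⟩ ⟨b', y'⟩ h
    cases b <;> cases b'
    · change ![i, j] y = ![i, j] y' at h
      obtain rfl : y = y' := by
        change Fin 2 at y y'
        fin_cases y <;> fin_cases y' <;> simp_all
      rfl
    · change ![i, j] y = Fin.addNat y' 2 at h
      have := hlt y
      rw [h, Fin.val_addNat] at this
      omega
    · change Fin.addNat y 2 = ![i, j] y' at h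
      have := hlt y'
      rw [← h, Fin.val_addNat] at this
      omega
    · obtain rfl : y = y' := Fin.ext (by
        have := congrArg Fin.val h
        change (y : Fin m).val + 2 = (y' : Fin m).val + 2 at this
        omega)
      rfl
  · intro l
    by_cases hl : (l : ℕ) < 2
    · by_cases hli : (l : ℕ) = i
      · exact ⟨⟨false, (0 : Fin 2)⟩, Fin.ext hli.symm⟩
      · exact ⟨⟨false, (1 : Fin 2)⟩, Fin.ext (show (j : ℕ) = l by omega)⟩
    · refine ⟨⟨true, (⟨l - 2, by omega⟩ : Fin m)⟩, Fin.ext ?_⟩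
      change (l : ℕ) - 2 + 2 = l
      omega

/-- The subgroup generated by `t₁` and `ξ = x_j ^ (-r) * t₂` is another complement of `F_n`. It acts
trivially on the last basis elements and preserves `⟨x_i, x_j⟩`. -/
theorem amalgam_of_actsByType {m : ℕ} {i j : Fin (m + 2)} (hi : (i : ℕ) < 2) (hj : (j : ℕ) < 2)
    (hij : i ≠ j) {φ : ZxZ2 →* MulAut (FreeGp (m + 2))} (hφ : InvertsOne φ i) {k r : ℤ} {ε δ : ℤˣ}
    (h : ActsByType φ i j k r ε δ) {θ : ZxZ2 →* MulAut (FreeGp 2)} (hθ1 : InvertsOne θ 0)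
    (hθ2 : ActsByType θ 0 1 (k - r) 0 ε δ) :
    IsAmalgam (subK1 φ j r) (subK φ j r) (subK2 φ j r) ∧
      Nonempty (↥(subK1 φ j r) ≃* FreeGp m × ZxZ2) ∧
      Nonempty (↥(subK φ j r) ≃* ZxZ2) ∧
      Nonempty (↥(subK2 φ j r) ≃* FreeGp 2 ⋊[θ] ZxZ2) := by
  have hc : φ t1 (gen j ^ (-r)) = gen j ^ (-r) := by rw [map_zpow, hφ.2 j hij.symm]
  set ψ := resplitAct (twistSection φ _ hc) (twistSection_right hc) with hψ
  set R := resplit (twistSection φ _ hc) (twistSection_right hc) with hR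
  have hbij := partIncl_bijective hi hj hij
  let Θ : ∀ b, ZxZ2 →* MulAut (FreeGroup (cond b (Fin m) (Fin 2)))
    | true => 1
    | false => θ
  have hother : ∀ l : Fin m, l.addNat 2 ≠ i ∧ l.addNat 2 ≠ j := by
    intro l
    constructor <;> intro e <;> have := congrArg Fin.val e <;> rw [Fin.val_addNat] at this <;> omega
  have hΘ : ∀ b q x, FreeGroup.map (partIncl i j b) (Θ b q x) =
      ψ q (FreeGroup.map (partIncl i j b) x) := by
    intro b
    cases b
    · have h0 : FreeGroup.map ![i, j] (gen 0) = gen i := FreeGroup.map.of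
      have h1 : FreeGroup.map ![i, j] (gen 1) = gen j := FreeGroup.map.of
      have hl1 : ∀ l : Fin 2, l ≠ 0 → l = 1 := by omega
      refine forall_zxz2_equivariant_of_gen (κ := Fin 2) (θ := θ) (fun l => ?_) (fun l => ?_)
      · rw [hψ, resplitAct_t1]
        change FreeGroup.map ![i, j] (θ t1 (gen l)) = φ t1 (FreeGroup.map ![i, j] (gen l))
        by_cases hl : l = 0
        · rw [hl, hθ1.1, map_inv, h0, hφ.1]
        · rw [hθ1.2 l hl, hl1 l hl, h1, hφ.2 j hij.symm]
      · rw [hψ, resplitAct_t2]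
        change FreeGroup.map ![i, j] (θ t2 (gen l)) =
          gen j ^ (-r) * φ t2 (FreeGroup.map ![i, j] (gen l)) * (gen j ^ (-r))⁻¹
        by_cases hl : l = 0
        · rw [hl, hθ2.1]
          simp only [map_mul, map_zpow, h0, h1, h.1]
          group
        · rw [hl1 l hl, hθ2.2.1, map_zpow, h1, h.2.1]
          group
    · have h0 : ∀ l, FreeGroup.map (fun l : Fin m => l.addNat 2) (gen l) = gen (l.addNat 2) :=
        fun _ => FreeGroup.map.of
      refine forall_zxz2_equivariant_of_gen (κ := Fin m) (θ := 1) (fun l => ?_) (fun l => ?_)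
      · rw [hψ, resplitAct_t1]
        change FreeGroup.map (fun l : Fin m => l.addNat 2) (gen l) =
          φ t1 (FreeGroup.map (fun l : Fin m => l.addNat 2) (gen l))
        rw [h0, hφ.2 _ (hother l).1]
      · rw [hψ, resplitAct_t2]
        change FreeGroup.map (fun l : Fin m => l.addNat 2) (gen l) =
          gen j ^ (-r) * φ t2 (FreeGroup.map (fun l : Fin m => l.addNat 2) (gen l)) *
            (gen j ^ (-r))⁻¹
        rw [h0, h.2.2 _ (hother l).1 (hother l).2]
        group
  have hK : subK φ j r = (R.toMonoidHom.comp SemidirectProduct.inr).range := by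
    rw [← range_twistSection hc]
    congr 1
    ext q : 1
    exact (resplit_inr _ _ q).symm
  have hK1 : subK1 φ j r = (R.toMonoidHom.comp (basisMap _ (hΘ true))).range := by
    refine (range_resplit_basisMap hc _ _ fun l => ⟨fun hl => ?_, ?_⟩).symm
    · refine ⟨(⟨l - 2, by omega⟩ : Fin m), Fin.ext ?_⟩
      change (l : ℕ) - 2 + 2 = l
      omega
    · rintro ⟨y, rfl⟩
      change 2 ≤ (y : Fin m).val + 2
      omega
  have hK2 : subK2 φ j r = (R.toMonoidHom.comp (basisMap _ (hΘ false))).range := by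
    have hij' : (i : ℕ) ≠ j := fun h => hij (Fin.ext h)
    refine (range_resplit_basisMap hc _ _ fun l => ⟨fun hl => ?_, ?_⟩).symm
    · by_cases hli : (l : ℕ) = i
      · exact ⟨(0 : Fin 2), Fin.ext hli.symm⟩
      · exact ⟨(1 : Fin 2), Fin.ext (show (j : ℕ) = l by omega)⟩
    · rintro ⟨y, rfl⟩
      change Fin 2 at y
      fin_cases y
      · exact hi
      · exact hj
  have hinj : ∀ b, Function.Injective (R.toMonoidHom.comp (basisMap _ (hΘ b))) := by
    intro b
    refine R.injective.comp (basisMap_injective (fun y y' hy => ?_) _)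
    have := @hbij.1 ⟨b, y⟩ ⟨b, y'⟩ hy
    simpa using this
  refine ⟨isAmalgam_of_partition R (κ := fun b => cond b (Fin m) (Fin 2))
    (Equiv.ofBijective _ hbij) hΘ ?_ hK, ?_, ?_, ?_⟩
  · rintro (_ | _)
    · exact hK2
    · exact hK1
  · rw [hK1]
    exact ⟨(MonoidHom.ofInjective (hinj true)).symm.trans SemidirectProduct.mulEquivProd⟩
  · rw [← range_twistSection hc]
    exact ⟨(MonoidHom.ofInjective fun q q' hq => by
      rw [← twistSection_right hc q, hq, twistSection_right]).symm⟩
  · rw [hK2]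
    exact ⟨(MonoidHom.ofInjective (hinj false)).symm⟩

/-- Here `n = m + 2`, so that `holTower m` is `H_(n-1)`, and `{i, j}` are the indices of the first
two basis elements of `F_n`; the generator `t₁` of `ℤ/2` inverts the `i`-th one. -/
theorem mainTheorem4 (m : ℕ) (i j : Fin (m + 2)) (hi : (i : ℕ) < 2) (hj : (j : ℕ) < 2)
    (hij : i ≠ j) (φ : ZxZ2 →* MulAut (FreeGp (m + 2))) (hφ : InvertsOne φ i) :
    ((toHol φ).range ≤ holTower m →
      IsCAT0Group (FreeGp (m + 2) ⋊[φ] ZxZ2) ∧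
      (Function.Injective φ →
        Function.Injective (toHol φ) ∧ IsCAT0Group ↥(toHol φ).range)) ∧
    (∀ (k r : ℤ) (ε δ : ℤˣ), ActsByType φ i j k r ε δ →
      (toHol φ).range ≤ holTower m ∧
      IsAmalgam (subK1 φ j r) (subK φ j r) (subK2 φ j r) ∧
      Nonempty (↥(subK1 φ j r) ≃* FreeGp m × ZxZ2) ∧
      Nonempty (↥(subK φ j r) ≃* ZxZ2) ∧
      ∃ θ : ZxZ2 →* MulAut (FreeGp 2),
        InvertsOne θ 0 ∧ ActsByType θ 0 1 (k - r) 0 ε δ ∧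
        Nonempty (↥(subK2 φ j r) ≃* FreeGp 2 ⋊[θ] ZxZ2)) := by
  refine ⟨fun h => ?_, fun k r ε δ h => ?_⟩
  · have hG := isStewartGroup_of_range_le m φ i hi hφ h
    refine ⟨hG.isCAT0Group, fun hinj => ⟨toHol_injective hinj, ?_⟩⟩
    exact (hG.congr (MonoidHom.ofInjective (toHol_injective hinj))).isCAT0Group
  · obtain ⟨θ, hθ1, hθ2⟩ := exists_actsByType_two (k - r) ε δ
    obtain ⟨h1, h2, h3, h4⟩ := amalgam_of_actsByType hi hj hij hφ h hθ1 hθ2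
    exact ⟨range_toHol_le_holTower hi hj hij hφ h, h1, h2, h3, θ, hθ1, hθ2, h4⟩
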